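/- Let $n\ge 2$ and let $(M,g)$ be a compact smooth Riemannian $n$-manifold with smooth (possibly empty) boundary $\partial M$; $M$ includes its boundary. Let $\chi$ be a smooth symmetric $(0,2)$-tensor on $M$. Let $\Gamma\subset\mathbb R^n$ be a symmetric open convex cone with vertex $0$, $\partial\Gamma\ne\emptyset$, $\Gamma_n^+=\{\lambda:\lambda_i>0\ \forall i\}\subseteq\Gamma$, and let $f$ be a smooth symmetric concave function on $\Gamma$ with $f_i=\partial f/\partial\lambda_i>0$ for all $i$. Put $\sup_{\partial\Gamma}f=\sup_{\lambda_0\in\partial\Gamma}\limsup_{\lambda\to\lambda_0}f(\lambda)$, $\Gamma^\sigma=\{\lambda\in\Gamma:f(\lambda)>\sigma\}$ and, for $\sigma>\sup_{\partial\Gamma}f$, $\partial\Gamma^\sigma=\{\lambda\in\Gamma:f(\lambda)=\sigma\}$. Let $\mathcal C_\sigma$ be the tangent cone at infinity to $\partial\Gamma^\sigma$, i.e. the boundary of the set of those $\mu\in\mathbb R^n$ for which $\{\lambda\in\partial\Gamma^\sigma:\sum_i f_i(\lambda)(\mu_i-\lambda_i)\le 0\}$ is bounded, and let $\mathcal C_\sigma^+$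 be the component of $\Gamma\setminus(\mathcal C_\sigma\cap\Gamma)$ containing $\Gamma^\sigma$. Let $\psi=\psi(x,z)\in C^1(M\times\mathbb R)$ and let $a,b\in\mathbb R$ be such that $\inf_{M\times[a,b]}\psi>\sup_{\partial\Gamma}f$ and $\Gamma^{\psi(x,z)}\neq\emptyset$ for all $(x,z)\in M\times[a,b]$. Write $\hat\psi(x)=\max_{a\le z\le b}\psi(x,z)$. Assume one of the following: (i) $\Gamma=\Gamma_n^+$; (ii$'$) there is $\underline u\in C^2(M)$ with $\lambda[\nabla^2\underline u+\chi](x)\in\mathcal C^+_{\hat\psi(x)}$ for all $x\in M$; moreover $\psi_z\ge0$ on $M\times[a,b]$, and $(M,g)$ has nonnegative sectional curvature; (iii$'$) $\sum_i f_i(\lambda)\lambda_i\ge0$ in $\Gamma$; and for all reals $\sigma_1,\sigma_2$ with $\sigma_1>\sup_{\partial\Gamma}f$ and $\Gamma^{\sigma_2}\ne\emptyset$ there are $\delta_0>0$ and $R$ such that $f_j(\lambda)\ge\delta_0\sum_i f_i(\lambda)$ whenever $\lambda\in\partial\Gamma^\sigma$ for some $\sigma\in[\sigma_1,\sigma_2]$,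 $|\lambda|\ge R$ and $\lambda_j<0$. Then there is a constant $C$, depending on $M,g,\chi,f,\Gamma,\psi,a,b$ (and $\underline u$) only, such that every $u\in C^3(M)$ with $a\le u\le b$ that is an admissible solution of $f(\lambda[\nabla^2u+\chi])=\psi(x,u)$ in the interior of $M$ (that is, the vector $\lambda[\nabla^2u+\chi]$ of eigenvalues with respect to $g$ lies in $\Gamma$ and the equation holds there) satisfies $$\max_M|\nabla u|\le C\bigl(1+\max_{\partial M}|\nabla u|\bigr),$$ where $\max_{\partial M}|\nabla u|$ is read as $0$ if $\partial M=\emptyset$. -/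

import Mathlib

open scoped Manifold ContDiff Topology

noncomputable section

namespace HessianEq

/-- Euclidean space `ℝⁿ` with its Euclidean norm. -/
abbrev Vec (n : ℕ) : Type := EuclideanSpace ℝ (Fin n)

/-! ### The cone `Γ`, the function `f`, and the tangent cone at infinity -/

section Cone

variable {n : ℕ}

/-- The open positive cone `{λ : every component of λ is positive}`. -/
def posCone (n : ℕ) : Set (Vec n) := {lam | ∀ i, 0 < lam i}

/-- The vector `(λ_{π(1)}, …, λ_{π(n)})`. -/
def permute (π : Equiv.Perm (Fin n)) (lam : Vec n) : Vec n :=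
  WithLp.toLp 2 (fun i => lam (π i))

/-- The partial derivative `f_i = ∂f/∂λ_i`. -/
def fpart (f : Vec n → ℝ) (i : Fin n) (lam : Vec n) : ℝ :=
  fderiv ℝ f lam (EuclideanSpace.single i 1)

/-- The standing assumptions on `Γ` and `f`: `Γ` is a symmetric open convex cone with vertex at the
origin, nonempty boundary, containing the positive cone; `f` is a smooth symmetric function on `Γ`
with `f_i > 0` in `Γ` which is concave. -/
structure StructureConditions (Γ : Set (Vec n)) (f : Vec n → ℝ) : Prop where
  isOpen : IsOpen Γ
  convex : Convex ℝ Γ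
  cone : ∀ t : ℝ, 0 < t → ∀ lam ∈ Γ, t • lam ∈ Γ
  symm : ∀ π : Equiv.Perm (Fin n), ∀ lam ∈ Γ, permute π lam ∈ Γ
  frontier_nonempty : (frontier Γ).Nonempty
  posCone_subset : posCone n ⊆ Γ
  smooth : ContDiffOn ℝ ∞ f Γ
  f_symm : ∀ π : Equiv.Perm (Fin n), ∀ lam ∈ Γ, f (permute π lam) = f lam
  fpart_pos : ∀ i, ∀ lam ∈ Γ, 0 < fpart f i lam
  concave : ConcaveOn ℝ Γ f

/-- `sup_{∂Γ} f`, the supremum over `λ₀ ∈ ∂Γ` of `limsup_{λ → λ₀, λ ∈ Γ} f(λ)`,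
an extended real number. -/
def supBdry (Γ : Set (Vec n)) (f : Vec n → ℝ) : EReal :=
  ⨆ lam₀ ∈ frontier Γ, Filter.limsup (fun lam => (f lam : EReal)) (𝓝[Γ] lam₀)

/-- `Γ^σ = {λ ∈ Γ : f(λ) > σ}`. -/
def superlevel (Γ : Set (Vec n)) (f : Vec n → ℝ) (σ : ℝ) : Set (Vec n) :=
  {lam | lam ∈ Γ ∧ σ < f lam}

/-- The level surface `∂Γ^σ = {λ ∈ Γ : f(λ) = σ}` (for `σ > sup_{∂Γ} f`). -/
def levelSurface (Γ : Set (Vec n)) (f : Vec n → ℝ) (σ : ℝ) : Set (Vec n) :=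
  {lam | lam ∈ Γ ∧ f lam = σ}

/-- The points `λ` of `∂Γ^σ` such that `μ` is not strictly on the inner side (the side of `Γ^σ`)
of the tangent hyperplane `T_λ ∂Γ^σ`. -/
def visiblePart (Γ : Set (Vec n)) (f : Vec n → ℝ) (σ : ℝ) (mu : Vec n) : Set (Vec n) :=
  {lam | lam ∈ levelSurface Γ f σ ∧ ∑ i, fpart f i lam * (mu i - lam i) ≤ 0}

/-- The tangent cone at infinity `C_σ` to `∂Γ^σ`: the boundary of the convex set of those `μ` which
lie strictly on the inner side of the tangent hyperplanes of `∂Γ^σ` at all points outside some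
bounded set. For instance it is the hyperplane `∂Γ^σ` itself when `f(λ) = λ₁ + ⋯ + λₙ`,
and the boundary of the positive quadrant when `f(λ) = (λ₁λ₂)^{1/2}` there. -/
def tangentConeAtInfinity (Γ : Set (Vec n)) (f : Vec n → ℝ) (σ : ℝ) : Set (Vec n) :=
  frontier {mu | Bornology.IsBounded (visiblePart Γ f σ mu)}

/-- `C_σ⁺`, the component of `Γ \ (C_σ ∩ Γ)` containing `Γ^σ`
(which is a nonempty convex set disjoint from `C_σ`). -/
def tangentConePlus (Γ : Set (Vec n)) (f : Vec n → ℝ) (σ : ℝ) : Set (Vec n) :=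
  {mu | ∃ nu ∈ superlevel Γ f σ,
    mu ∈ connectedComponentIn (Γ \ tangentConeAtInfinity Γ f σ) nu}

/-- `λ` lists the eigenvalues (with multiplicity) of the symmetric bilinear form with matrix `U`
with respect to the inner product with matrix `G`: the columns of some `P` form a `G`-orthonormal
basis in which `U` becomes `diag(λ)`. -/
def IsEigenvalues (G U : Matrix (Fin n) (Fin n) ℝ) (lam : Vec n) : Prop :=
  ∃ P : Matrix (Fin n) (Fin n) ℝ,
    P.transpose * G * P = 1 ∧ P.transpose * U * P = Matrix.diagonal (fun i => lam i)

end Cone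

/-! ### Riemannian geometry in local coordinates

The manifold with boundary `M` is modelled on the Euclidean half space. For `c : M`, coordinates
are those of the chart `extChartAt (𝓡∂ n) c`; a coordinate point `y` lies in its target, a
relatively open subset of the half space. At boundary points derivatives are taken within the half
space. -/

section Geometry

variable {n : ℕ} [NeZero n] {M : Type*} [TopologicalSpace M]
  [ChartedSpace (EuclideanHalfSpace n) M]

/-- The partial derivative `∂_i h` at `y`, within the closed half space. -/
def pd (i : Fin n) (h : Vec n → ℝ) (y : Vec n) : ℝ :=
  fderivWithin ℝ h (Set.range (𝓡∂ n)) y (EuclideanSpace.single i 1)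

/-- A (not necessarily smooth) covariant `2`-tensor field on `M`. -/
abbrev Tensor2 (n : ℕ) [NeZero n] (M : Type*) [TopologicalSpace M]
    [ChartedSpace (EuclideanHalfSpace n) M] : Type _ :=
  ∀ x : M, TangentSpace (𝓡∂ n) x →L[ℝ] TangentSpace (𝓡∂ n) x →L[ℝ] ℝ

/-- The coordinate vector field `∂_i` of the chart at `c`, at the point with coordinates `y`. -/
def coordVec (c : M) (i : Fin n) (y : Vec n) :
    TangentSpace (𝓡∂ n) ((extChartAt (𝓡∂ n) c).symm y) :=
  mfderivWithin 𝓘(ℝ, Vec n) (𝓡∂ n) (extChartAt (𝓡∂ n) c).symm (Set.range (𝓡∂ n)) y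
    (EuclideanSpace.single i 1 : Vec n)

/-- The components `T_ij = T(∂_i, ∂_j)` of a covariant `2`-tensor in the chart at `c`. -/
def tensorCoord (T : Tensor2 n M) (c : M) (y : Vec n) : Matrix (Fin n) (Fin n) ℝ :=
  Matrix.of fun i j => T ((extChartAt (𝓡∂ n) c).symm y) (coordVec c i y) (coordVec c j y)

/-- The Christoffel symbol
`Γ^k_ij = ½ g^{kl} (∂_i g_jl + ∂_j g_il - ∂_l g_ij)` of the metric `g` in the chart at `c`. -/
def christoffel (g : Tensor2 n M) (c : M) (k i j : Fin n) (y : Vec n) : ℝ :=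
  (1 / 2) * ∑ l, (tensorCoord g c y)⁻¹ k l *
    (pd i (fun z => tensorCoord g c z j l) y + pd j (fun z => tensorCoord g c z i l) y
      - pd l (fun z => tensorCoord g c z i j) y)

/-- The Hessian `∇_ij u = ∂_i ∂_j u - Γ^k_ij ∂_k u` in the chart at `c`. -/
def hessCoord (g : Tensor2 n M) (c : M) (u : M → ℝ) (y : Vec n) : Matrix (Fin n) (Fin n) ℝ :=
  Matrix.of fun i j =>
    pd i (fun z => pd j (fun w => u ((extChartAt (𝓡∂ n) c).symm w)) z) y
      - ∑ k, christoffel g c k i j y * pd k (fun w => u ((extChartAt (𝓡∂ n) c).symm w)) y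

/-- The component `R^l_ijk` of the curvature tensor in the chart at `c`, defined by
`∇_i ∇_j ∂_k - ∇_j ∇_i ∂_k = R^l_ijk ∂_l`. -/
def curvCoord (g : Tensor2 n M) (c : M) (l i j k : Fin n) (y : Vec n) : ℝ :=
  pd i (christoffel g c l j k) y - pd j (christoffel g c l i k) y
    + ∑ m, (christoffel g c m j k y * christoffel g c l i m y
      - christoffel g c m i k y * christoffel g c l j m y)

/-- `(M, g)` has nonnegative sectional curvature: `⟨R(X, Y) Y, X⟩ ≥ 0` for all tangent vectors
`X`, `Y` at every point (with the sign for which round spheres are positively curved). -/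
def NonnegSectionalCurvature (g : Tensor2 n M) : Prop :=
  ∀ c : M, ∀ y ∈ (extChartAt (𝓡∂ n) c).target, ∀ X Y : Fin n → ℝ,
    0 ≤ ∑ i, ∑ j, ∑ k, ∑ l, ∑ p,
      tensorCoord g c y l p * curvCoord g c l i j k y * X i * Y j * Y k * X p

/-- `λ` lists the eigenvalues of `∇²u + χ` with respect to `g`, at the point with coordinates `y`
in the chart at `c`. (Up to order they do not depend on the chart.) -/
def IsHessEigenvalues (g χ : Tensor2 n M) (u : M → ℝ) (c : M) (y : Vec n) (lam : Vec n) : Prop :=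
  IsEigenvalues (tensorCoord g c y) (hessCoord g c u y + tensorCoord χ c y) lam

/-- `u` is an admissible solution of `f(λ[∇²u + χ]) = ψ(x, u)` in the interior of `M`:
at each interior point (computing in any chart) `λ[∇²u + χ] ∈ Γ` and the equation holds. -/
def IsAdmissibleSolution (g χ : Tensor2 n M) (Γ : Set (Vec n)) (f : Vec n → ℝ) (ψ : M → ℝ → ℝ)
    (u : M → ℝ) : Prop :=
  ∀ c x : M, x ∈ (chartAt (EuclideanHalfSpace n) c).source → (𝓡∂ n).IsInteriorPoint x →
    ∃ lam ∈ Γ, IsHessEigenvalues g χ u c (extChartAt (𝓡∂ n) c x) lam ∧ f lam = ψ x (u x)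

/-- `λ[∇²v + χ](x) ∈ C⁺_{σ(x)}` for all `x ∈ M`, boundary included. -/
def ConeCondition (g χ : Tensor2 n M) (Γ : Set (Vec n)) (f : Vec n → ℝ) (σ : M → ℝ)
    (v : M → ℝ) : Prop :=
  ∀ c x : M, x ∈ (chartAt (EuclideanHalfSpace n) c).source →
    ∃ lam ∈ tangentConePlus Γ f (σ x), IsHessEigenvalues g χ v c (extChartAt (𝓡∂ n) c x) lam

/-- The `C^∞` Riemannian metrics on `M`, as a smooth manifold with boundary. -/
abbrev Metric (n : ℕ) [NeZero n] (M : Type*) [TopologicalSpace M]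
    [ChartedSpace (EuclideanHalfSpace n) M] [IsManifold (𝓡∂ n) ∞ M] : Type _ :=
  Bundle.ContMDiffRiemannianMetric (𝓡∂ n) ∞ (Vec n) (fun x : M => TangentSpace (𝓡∂ n) x)

/-- Smoothness of a covariant `2`-tensor field. -/
def Tensor2.IsSmooth [IsManifold (𝓡∂ n) ∞ M] (T : Tensor2 n M) : Prop :=
  ContMDiff (𝓡∂ n) ((𝓡∂ n).prod 𝓘(ℝ, Vec n →L[ℝ] Vec n →L[ℝ] ℝ)) ∞
    (fun x => Bundle.TotalSpace.mk' (Vec n →L[ℝ] Vec n →L[ℝ] ℝ)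
      (E := fun x : M => TangentSpace (𝓡∂ n) x →L[ℝ] TangentSpace (𝓡∂ n) x →L[ℝ] ℝ) x (T x))

variable [IsManifold (𝓡∂ n) ∞ M]

/-- The inner product `g_x` as a bilinear form on the tangent space. -/
def metricForm (g : Metric n M) (x : M) : LinearMap.BilinForm ℝ (TangentSpace (𝓡∂ n) x) :=
  LinearMap.mk₂ ℝ (fun v w => g.inner x v w)
    (by intros; simp) (by intros; simp) (by intros; simp) (by intros; simp)

theorem metricForm_nondegenerate (g : Metric n M) (x : M) : (metricForm g x).Nondegenerate := by
  have key : ∀ v : TangentSpace (𝓡∂ n) x, g.inner x v v = 0 → v = 0 := by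
    intro v hv
    by_contra hne
    exact (g.pos x v hne).ne' hv
  exact ⟨fun v hv => key v (hv v), fun v hv => key v (hv v)⟩

instance tangentSpace_finiteDimensional (x : M) :
    FiniteDimensional ℝ (TangentSpace (𝓡∂ n) x) :=
  inferInstanceAs (FiniteDimensional ℝ (Vec n))

/-- The gradient `∇u(x)`: the tangent vector with `g(∇u, v) = du(v)` for all `v`. -/
def gradient (g : Metric n M) (u : M → ℝ) (x : M) : TangentSpace (𝓡∂ n) x :=
  ((metricForm g x).toDual (metricForm_nondegenerate g x)).symm
    (mfderiv (𝓡∂ n) 𝓘(ℝ, ℝ) u x).toLinearMap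

/-- The length `|∇u|(x)` of the gradient. -/
def gradNorm (g : Metric n M) (u : M → ℝ) (x : M) : ℝ :=
  Real.sqrt (g.inner x (gradient g u x) (gradient g u x))

end Geometry

end HessianEq

end

/-! The proof applies the maximum principle to `|∇u| / ζ` with `ζ = K - exp s`. Here `s = u` in
cases (i) and (iii'), and `s = v - u` in case (ii'), `v` being the comparison function. `K` is
chosen so that `1 ≤ ζ ≤ K` for all `u` with values in `[a, b]`. A maximum on `∂M` is then harmless,
and everything reduces to a bound of `w = |∇u|` at an interior maximum, uniform in `u`.

At such a point take a frame `e_i` diagonalizing `∇²u + χ`, with eigenvalues `λ_i`, and put `f_i =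
f_i(λ)`, `F = ∑ f_i`, `τ = w² exp s / ζ`, which has the order of `w²`. The first order condition is
`∇²u(a, ∇u) = -τ ds(a)`. The Bochner formula and the differentiated equation turn the second order
condition into `ψ_z w² - C w (1 + F) + ∑ f_i ⟨R(∇u, e_i) e_i, ∇u⟩ ≤ -τ ∑ f_i (∇²s(e_i, e_i) +
ds(e_i)²)` (`StructureConditions.exists_maxData`, `MaxData.scalar`).

Case (i), `MaxData.gradNorm_le_of_pos`: the first order condition gives `∇²u(∇u, ∇u) = -τ w²`,
whereas positivity of `∇²u + χ` bounds this below by `-C w²`. So `τ` is bounded.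

Case (iii'), `MaxData.gradNorm_le_of_fpart_ge`: some `e_i` carries the fraction `1/n` of `w²`. The
first order condition forces `λ_i` to be close to `-τ`, hence `f_i ≥ δ₀ F`. Then `τ f_i ds(e_i)²`
has order `w⁴ F` and beats all other terms, `F` being bounded below by concavity and `∑ f_i λ_i ≥
0`.

Case (ii'), `MaxData.gradNorm_le_of_comparison`: the sum on the right is `∑ f_i (d_i - λ_i) + ∑ f_i
ds(e_i)²`, with `d` the diagonal of `∇²v + χ`. Since `d` lies on the inner side of the tangent cone
at infinity, either the first sum is at least `θ (1 + F)`, or all `f_i` are comparable to `F` and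
the second sum dominates for large `w`. With `ψ_z ≥ 0` and nonnegative curvature this leaves `τ θ ≤
C w`.

Eigenvalues are never differentiated: the linearized equation follows from concavity, Birkhoff's
theorem and a minimum argument (`StructureConditions.deriv_eq_of_diagonal`). -/

noncomputable section

namespace HessianEq

/-! ### Symmetric concave functions on a symmetric cone. -/

section ConvexAnalysis

variable {n : ℕ} {Γ : Set (Vec n)} {f : Vec n → ℝ}

theorem vec_eq_sum_single (a : Vec n) : a = ∑ i, a i • EuclideanSpace.single i (1 : ℝ) := by
  ext j
  simp [Finset.sum_apply, Pi.single_apply]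

theorem sum_fpart_mul (f : Vec n → ℝ) (lam a : Vec n) :
    ∑ i, fpart f i lam * a i = fderiv ℝ f lam a := by
  conv_rhs => rw [vec_eq_sum_single a]
  simp [fpart, map_sum, mul_comm]

namespace StructureConditions

theorem differentiableAt (hf : StructureConditions Γ f) {lam : Vec n} (h : lam ∈ Γ) :
    DifferentiableAt ℝ f lam :=
  ((hf.smooth.contDiffAt (hf.isOpen.mem_nhds h)).differentiableAt (by simp))

theorem le_add_sum_fpart (hf : StructureConditions Γ f) {lam mu : Vec n}
    (hl : lam ∈ Γ) (hm : mu ∈ Γ) :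
    f mu ≤ f lam + ∑ i, fpart f i lam * (mu i - lam i) := by
  have h1 : ConcaveOn ℝ ((AffineMap.lineMap lam mu : ℝ →ᵃ[ℝ] Vec n) ⁻¹' Γ)
      (f ∘ (AffineMap.lineMap lam mu : ℝ →ᵃ[ℝ] Vec n)) := hf.concave.comp_affineMap _
  have h2 : HasDerivAt (f ∘ (AffineMap.lineMap lam mu : ℝ →ᵃ[ℝ] Vec n))
      (fderiv ℝ f lam (mu - lam)) 0 := by
    have h3 : HasDerivAt (AffineMap.lineMap lam mu : ℝ →ᵃ[ℝ] Vec n) (mu - lam) (0 : ℝ) :=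
      AffineMap.hasDerivAt_lineMap
    have h4 : HasFDerivAt f (fderiv ℝ f lam)
        ((AffineMap.lineMap lam mu : ℝ →ᵃ[ℝ] Vec n) (0 : ℝ)) := by
      simpa using (hf.differentiableAt hl).hasFDerivAt
    exact h4.comp_hasDerivAt _ h3
  have h5 := h1.slope_le_of_hasDerivAt (x := 0) (y := 1) (by simpa using hl) (by simpa using hm)
    one_pos h2
  rw [slope_def_field] at h5
  simp only [Function.comp, AffineMap.lineMap_apply_zero, AffineMap.lineMap_apply_one, sub_zero,
    div_one] at h5
  have h6 := sum_fpart_mul f lam (mu - lam)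
  simp only [PiLp.sub_apply] at h6
  linarith

theorem add_mem_of_mem_of_mem (hf : StructureConditions Γ f) {a b : Vec n} (ha : a ∈ Γ)
    (hb : b ∈ Γ) : a + b ∈ Γ := by
  have h := hf.convex ha hb (a := 1 / 2) (b := 1 / 2) (by norm_num) (by norm_num) (by norm_num)
  have h2 := hf.cone 2 two_pos _ h
  convert h2 using 1
  rw [smul_add, smul_smul, smul_smul]
  norm_num

/-- As `Γ` is open, a small multiple of `(1, …, 1)` can be moved from `lam` to `a`. This makes `a`
strictly positive, and both summands then lie in the convex cone `Γ`. -/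
theorem add_mem (hf : StructureConditions Γ f) {lam a : Vec n} (hl : lam ∈ Γ)
    (ha : ∀ i, 0 ≤ a i) : lam + a ∈ Γ := by
  have hc : Continuous fun t : ℝ => lam - t • (WithLp.toLp 2 (fun _ => (1 : ℝ)) : Vec n) := by
    fun_prop
  have h0 : ∀ᶠ t : ℝ in 𝓝 0, lam - t • (WithLp.toLp 2 (fun _ => (1 : ℝ)) : Vec n) ∈ Γ := by
    apply hc.continuousAt.eventually_mem
    apply hf.isOpen.mem_nhds
    simpa using hl
  obtain ⟨t, ht, htp⟩ := ((h0.filter_mono nhdsWithin_le_nhds).and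
    (self_mem_nhdsWithin (s := Set.Ioi (0 : ℝ)))).exists
  have h2 : a + t • (WithLp.toLp 2 (fun _ => (1 : ℝ)) : Vec n) ∈ Γ := by
    apply hf.posCone_subset
    intro i
    have := ha i
    have htp : 0 < t := htp
    simp
    linarith
  convert hf.add_mem_of_mem_of_mem ht h2 using 1
  abel

theorem mem_of_le (hf : StructureConditions Γ f) {lam mu : Vec n} (hl : lam ∈ Γ)
    (h : ∀ i, lam i ≤ mu i) : mu ∈ Γ := by
  have := hf.add_mem hl (a := mu - lam) (fun i => by simpa using h i)
  simpa using this

theorem mono (hf : StructureConditions Γ f) {lam mu : Vec n} (hl : lam ∈ Γ)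
    (h : ∀ i, lam i ≤ mu i) : f lam ≤ f mu := by
  have hm := hf.mem_of_le hl h
  have h1 := hf.le_add_sum_fpart hm hl
  have h2 : ∑ i, fpart f i mu * (lam i - mu i) ≤ 0 :=
    Finset.sum_nonpos fun i _ =>
      mul_nonpos_of_nonneg_of_nonpos (hf.fpart_pos i mu hm).le (by linarith [h i])
  linarith

theorem convex_superlevel (hf : StructureConditions Γ f) (σ : ℝ) :
    Convex ℝ (superlevel Γ f σ) := hf.concave.convex_gt σ

theorem permute_mem_superlevel (hf : StructureConditions Γ f) {σ : ℝ} (π : Equiv.Perm (Fin n))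
    {d : Vec n} (hd : d ∈ superlevel Γ f σ) : permute π d ∈ superlevel Γ f σ :=
  ⟨hf.symm π d hd.1, by rw [hf.f_symm π d hd.1]; exact hd.2⟩

theorem isOpen_superlevel (hf : StructureConditions Γ f) (σ : ℝ) :
    IsOpen (superlevel Γ f σ) :=
  hf.smooth.continuousOn.isOpen_inter_preimage hf.isOpen isOpen_Ioi

end StructureConditions

/-- Birkhoff's theorem: a doubly stochastic matrix is a convex combination of permutation matrices.
-/
theorem doublyStochastic_mulVec_mem {C : Set (Vec n)} (hC : Convex ℝ C)
    (hperm : ∀ π : Equiv.Perm (Fin n), ∀ d ∈ C, permute π d ∈ C) {D : Matrix (Fin n) (Fin n) ℝ}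
    (hD : D ∈ doublyStochastic ℝ (Fin n)) {mu : Vec n} (hmu : mu ∈ C) :
    (WithLp.toLp 2 (fun i => ∑ j, D i j * mu j) : Vec n) ∈ C := by
  obtain ⟨w, hw0, hw1, rfl⟩ := exists_eq_sum_perm_of_mem_doublyStochastic hD
  have h := hC.sum_mem (t := Finset.univ) (w := w) (z := fun π => permute π mu)
    (fun π _ => hw0 π) hw1 (fun π _ => hperm π mu hmu)
  convert h using 1
  ext i
  simp only [Matrix.sum_apply, Matrix.smul_apply, smul_eq_mul, Equiv.Perm.permMatrix,
    PEquiv.toMatrix_apply, Equiv.toPEquiv_apply, WithLp.ofLp_sum, Finset.sum_apply, permute,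
    PiLp.smul_apply, Finset.sum_mul]
  rw [Finset.sum_comm]
  simp

/-- Averaging over permutations can only raise a symmetric concave function, so `f (D μ) ≥ f μ`; the
tangent plane at `λ` bounds `f (D μ)` from above. This one-sided bound stands in for the derivative
of the eigenvalues. -/
theorem StructureConditions.sub_le_sum_doublyStochastic (hf : StructureConditions Γ f)
    {lam mu : Vec n} (hl : lam ∈ Γ) (hm : mu ∈ Γ) {D : Matrix (Fin n) (Fin n) ℝ}
    (hD : D ∈ doublyStochastic ℝ (Fin n)) :
    f mu - f lam ≤ ∑ i, fpart f i lam * ((∑ j, D i j * mu j) - lam i) := by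
  have h := doublyStochastic_mulVec_mem (C := {x | x ∈ Γ ∧ f mu ≤ f x}) (hf.concave.convex_ge _)
    (fun π d hd => ⟨hf.symm π d hd.1, by rw [hf.f_symm π d hd.1]; exact hd.2⟩) hD ⟨hm, le_rfl⟩
  have h2 := hf.le_add_sum_fpart hl h.1
  have h3 := h.2
  simp only at h2
  linarith

/-- If `Q` has orthonormal columns then the diagonal of `Q diag(μ) Qᵀ` is the image of `μ` under the
doubly stochastic matrix of the squares of the entries of `Q`. -/
theorem sq_mem_doublyStochastic {Q : Matrix (Fin n) (Fin n) ℝ} (hQ : Q.transpose * Q = 1) :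
    (Matrix.of fun i j => Q i j ^ 2) ∈ doublyStochastic ℝ (Fin n) := by
  have hQ' : Q * Q.transpose = 1 := mul_eq_one_comm.mp hQ
  rw [mem_doublyStochastic_iff_sum]
  refine ⟨fun i j => sq_nonneg _, fun i => ?_, fun j => ?_⟩
  · have := congrFun (congrFun hQ' i) i
    simpa [Matrix.mul_apply, sq] using this
  · have := congrFun (congrFun hQ j) j
    simpa [Matrix.mul_apply, sq] using this

theorem diag_eq_of_orthogonal {Q B : Matrix (Fin n) (Fin n) ℝ} {mu : Fin n → ℝ}
    (hQ : Q.transpose * Q = 1) (hB : Q.transpose * B * Q = Matrix.diagonal mu) (i : Fin n) :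
    B i i = ∑ j, (Matrix.of fun i j => Q i j ^ 2) i j * mu j := by
  have hQ' : Q * Q.transpose = 1 := mul_eq_one_comm.mp hQ
  have h : B = Q * Matrix.diagonal mu * Q.transpose := by
    rw [← hB]
    calc B = (Q * Q.transpose) * B * (Q * Q.transpose) := by rw [hQ']; simp
      _ = _ := by simp only [Matrix.mul_assoc]
  rw [h, Matrix.mul_apply]
  simp only [Matrix.mul_diagonal, Matrix.transpose_apply, Matrix.of_apply]
  exact Finset.sum_congr rfl fun j _ => by ring

/-! ### Points on the inner side of the tangent cone at infinity -/

/-- The vector `d - (1/k) (1, …, 1) + k e_j`. -/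
def pushed (k : ℝ) (j : Fin n) (d : Vec n) : Vec n :=
  WithLp.toLp 2 fun i => d i - 1 / k + if i = j then k else 0

/-- The vectors `d` for which every `d - (1/k) (1, …, 1) + k e_j` lies in `Γ^σ`. -/
def pushedSet (Γ : Set (Vec n)) (f : Vec n → ℝ) (σ k : ℝ) : Set (Vec n) :=
  {d | ∀ j, pushed k j d ∈ superlevel Γ f σ}

theorem superlevel_anti {σ τ : ℝ} (h : σ ≤ τ) : superlevel Γ f τ ⊆ superlevel Γ f σ :=
  fun _ hx => ⟨hx.1, h.trans_lt hx.2⟩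

namespace StructureConditions

theorem mem_superlevel_of_le (hf : StructureConditions Γ f) {σ : ℝ} {lam mu : Vec n}
    (hl : lam ∈ superlevel Γ f σ) (h : ∀ i, lam i ≤ mu i) : mu ∈ superlevel Γ f σ :=
  ⟨hf.mem_of_le hl.1 h, hl.2.trans_le (hf.mono hl.1 h)⟩

theorem exists_const_mem_superlevel (hf : StructureConditions Γ f) {σ : ℝ}
    (h : (superlevel Γ f σ).Nonempty) :
    ∃ T > 0, (WithLp.toLp 2 (fun _ => T) : Vec n) ∈ superlevel Γ f σ := by
  obtain ⟨nu, hnu⟩ := h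
  refine ⟨1 + ∑ i, |nu i|, by positivity, hf.mem_superlevel_of_le hnu fun i => ?_⟩
  have h1 : |nu i| ≤ ∑ i, |nu i| :=
    Finset.single_le_sum (f := fun i => |nu i|) (fun i _ => abs_nonneg _) (Finset.mem_univ i)
  have := le_abs_self (nu i)
  simp only
  linarith

theorem convex_pushedSet (hf : StructureConditions Γ f) (σ k : ℝ) :
    Convex ℝ (pushedSet Γ f σ k) := by
  intro x hx y hy a b ha hb hab j
  have h := hf.convex_superlevel σ (hx j) (hy j) ha hb hab
  convert h using 1
  ext i
  simp only [pushed, PiLp.add_apply, PiLp.smul_apply, smul_eq_mul]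
  linear_combination (1 / k - if i = j then k else 0) * hab

theorem permute_mem_pushedSet (hf : StructureConditions Γ f) {σ k : ℝ} (π : Equiv.Perm (Fin n))
    {d : Vec n} (hd : d ∈ pushedSet Γ f σ k) : permute π d ∈ pushedSet Γ f σ k := by
  intro j
  convert hf.permute_mem_superlevel π (hd (π j)) using 1
  ext i
  simp [pushed, permute]

/-- The alternative behind the second order estimate: at a point `λ` of the level surface, `d` is
strictly inside the tangent plane unless every `f_j` is comparable to `∑ f_i`. -/
theorem sum_fpart_pos_of_mem_pushedSet (hf : StructureConditions Γ f) {σ k : ℝ} {d lam : Vec n}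
    (hd : d ∈ pushedSet Γ f σ k) (hl : lam ∈ Γ) (hfl : f lam ≤ σ) (j : Fin n) :
    0 < ∑ i, fpart f i lam * (d i - lam i) - 1 / k * ∑ i, fpart f i lam + k * fpart f j lam := by
  have h := hf.le_add_sum_fpart hl (hd j).1
  have h2 := (hd j).2
  have h3 : ∑ i, fpart f i lam * (pushed k j d i - lam i) =
      ∑ i, fpart f i lam * (d i - lam i) - 1 / k * ∑ i, fpart f i lam + k * fpart f j lam := by
    rw [Finset.mul_sum, ← Finset.sum_sub_distrib,
      show k * fpart f j lam = ∑ i, if i = j then k * fpart f i lam else 0 by simp,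
      ← Finset.sum_add_distrib]
    refine Finset.sum_congr rfl fun i _ => ?_
    simp only [pushed]
    split_ifs <;> ring
  linarith

theorem superlevel_subset_interior (hf : StructureConditions Γ f) (σ : ℝ) :
    superlevel Γ f σ ⊆ interior {mu | Bornology.IsBounded (visiblePart Γ f σ mu)} := by
  refine interior_maximal (fun nu hnu => ?_) (hf.isOpen_superlevel σ)
  have : visiblePart Γ f σ nu = ∅ := by
    refine Set.eq_empty_of_forall_notMem fun lam hlam => ?_
    have h := hf.le_add_sum_fpart hlam.1.1 hnu.1
    have h1 := hlam.2
    have h2 := hlam.1.2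
    have h3 := hnu.2
    linarith
  simp [this]

/-- A connected set that avoids the frontier and meets the interior stays in the interior; it meets
it because `Γ^σ` lies there. -/
theorem tangentConePlus_subset_interior (hf : StructureConditions Γ f) (σ : ℝ) :
    tangentConePlus Γ f σ ⊆ Γ ∩ interior {mu | Bornology.IsBounded (visiblePart Γ f σ mu)} := by
  rintro mu ⟨nu, hnu, hmu⟩
  set S := {mu | Bornology.IsBounded (visiblePart Γ f σ mu)} with hS
  have hsub := connectedComponentIn_subset (Γ \ tangentConeAtInfinity Γ f σ) nu
  have hnuS := hf.superlevel_subset_interior σ hnu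
  have hnu' : nu ∈ Γ \ tangentConeAtInfinity Γ f σ :=
    ⟨hnu.1, fun h => disjoint_interior_frontier.le_bot ⟨hnuS, h⟩⟩
  have hpre := isPreconnected_connectedComponentIn (F := Γ \ tangentConeAtInfinity Γ f σ) (x := nu)
  refine ⟨(hsub hmu).1, ?_⟩
  by_contra hmuS
  have hmuS' : mu ∉ S := fun h => (hsub hmu).2 ⟨subset_closure h, hmuS⟩
  obtain ⟨z, -, hz, hz'⟩ := hpre (interior S) (closure S)ᶜ isOpen_interior
    isClosed_closure.isOpen_compl
    (fun z hz => by
      by_cases h1 : z ∈ closure S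
      · by_contra h2
        exact (hsub hz).2 ⟨h1, fun h => h2 (Or.inl h)⟩
      · exact Or.inr h1)
    ⟨nu, mem_connectedComponentIn hnu', hnuS⟩
    ⟨mu, hmu, fun h => (hsub hmu).2 ⟨h, hmuS⟩⟩
  exact hz' (subset_closure (interior_subset hz))

/-- This trades the tangent cone at infinity for a condition that is open, convex and invariant
under permutations. The trade works because `mu` can be lowered slightly along the diagonal with its
visible part still bounded. -/
theorem exists_mem_pushedSet (hf : StructureConditions Γ f) {σ : ℝ} {mu : Vec n}
    (hmu : mu ∈ tangentConePlus Γ f σ) : ∃ k > 0, mu ∈ pushedSet Γ f σ k := by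
  have hne : (superlevel Γ f σ).Nonempty := hmu.imp fun _ h => h.1
  obtain ⟨T, hT, hTmem⟩ := hf.exists_const_mem_superlevel hne
  set one : Vec n := WithLp.toLp 2 (fun _ => (1 : ℝ)) with hone
  have hopen : IsOpen (Γ ∩ interior {mu | Bornology.IsBounded (visiblePart Γ f σ mu)}) :=
    hf.isOpen.inter isOpen_interior
  have hc : Continuous fun t : ℝ => mu - t • one := by fun_prop
  have h0 : ∀ᶠ t : ℝ in 𝓝 0,
      mu - t • one ∈ Γ ∩ interior {mu | Bornology.IsBounded (visiblePart Γ f σ mu)} := by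
    apply hc.continuousAt.eventually_mem
    apply hopen.mem_nhds
    simpa using hf.tangentConePlus_subset_interior σ hmu
  obtain ⟨δ, ⟨hδΓ, hδS⟩, hδ⟩ := ((h0.filter_mono nhdsWithin_le_nhds).and
    (self_mem_nhdsWithin (s := Set.Ioi (0 : ℝ)))).exists
  have hδ : 0 < δ := hδ
  set nu := mu - δ • one with hnu
  have hbd : Bornology.IsBounded (visiblePart Γ f σ nu) := by
    have := interior_subset hδS
    exact this
  obtain ⟨R, hR⟩ := hbd.exists_norm_le
  -- The term `1 / δ` makes `1 / k ≤ δ`; the others make `ν_j + k` exceed `R`.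
  set k := 1 / δ + |R| + 1 + ∑ i, |nu i| with hk
  have hsum : 0 ≤ ∑ i, |nu i| := Finset.sum_nonneg fun i _ => abs_nonneg _
  have hk1 : 1 / δ ≤ k := by linarith [abs_nonneg R]
  have hk0 : 0 < k := lt_of_lt_of_le (by positivity) hk1
  refine ⟨k, hk0, fun j => ?_⟩
  have hle : nu + EuclideanSpace.single j k ∈ superlevel Γ f σ := by
    have hmem : nu + EuclideanSpace.single j k ∈ Γ := by
      refine hf.mem_of_le hδΓ fun i => ?_
      simp only [PiLp.add_apply, PiLp.single_apply]
      split_ifs <;> linarith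
    by_contra hcon
    have hfle : f (nu + EuclideanSpace.single j k) ≤ σ := by
      by_contra h
      exact hcon ⟨hmem, not_le.mp h⟩
    have hmem' : ∀ s : ℝ, 0 ≤ s → nu + EuclideanSpace.single j k + s • one ∈ Γ := fun s hs =>
      hf.add_mem hmem fun i => by simpa [hone] using hs
    set s₁ := T + ∑ i, |nu i| with hs₁
    have hs₁0 : 0 ≤ s₁ := by positivity
    have hbig : σ < f (nu + EuclideanSpace.single j k + s₁ • one) := by
      refine hTmem.2.trans_le (hf.mono hTmem.1 fun i => ?_)
      have h1 : |nu i| ≤ ∑ i, |nu i| :=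
        Finset.single_le_sum (f := fun i => |nu i|) (fun i _ => abs_nonneg _) (Finset.mem_univ i)
      have h2 := neg_abs_le (nu i)
      simp only [PiLp.add_apply, PiLp.single_apply, PiLp.smul_apply, hone, smul_eq_mul]
      split_ifs <;> linarith
    have hcont : ContinuousOn (fun s : ℝ => f (nu + EuclideanSpace.single j k + s • one))
        (Set.Icc 0 s₁) :=
      hf.smooth.continuousOn.comp (by fun_prop) fun s hs => hmem' s hs.1
    -- If `ν + k e_j` were outside `Γ^σ`, the diagonal ray from it would cross the level surface at
    -- some `λ ≥ ν`. Since all `f_i` are positive, `λ` is visible from `ν`, although `λ_j ≥ ν_j + k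
    -- > R`.
    obtain ⟨s, hs, hfs⟩ := intermediate_value_Icc hs₁0 hcont
      (show σ ∈ Set.Icc _ _ from ⟨by simpa using hfle, hbig.le⟩)
    set lam := nu + EuclideanSpace.single j k + s • one with hlam
    have hlamge : ∀ i, nu i ≤ lam i := fun i => by
      simp only [hlam, PiLp.add_apply, PiLp.single_apply, PiLp.smul_apply, hone,
        smul_eq_mul]
      split_ifs <;> linarith [hs.1]
    have hvis : lam ∈ visiblePart Γ f σ nu :=
      ⟨⟨hmem' s hs.1, hfs⟩, Finset.sum_nonpos fun i _ => mul_nonpos_of_nonneg_of_nonpos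
        (hf.fpart_pos i lam (hmem' s hs.1)).le (by linarith [hlamge i])⟩
    have h1 := hR lam hvis
    have h2 : |lam j| ≤ ‖lam‖ := PiLp.norm_apply_le lam j
    have h3 : lam j = nu j + k + s := by simp [hlam, hone]
    have h4 : |nu j| ≤ ∑ i, |nu i| :=
      Finset.single_le_sum (f := fun i => |nu i|) (fun i _ => abs_nonneg _) (Finset.mem_univ j)
    have h5 := neg_abs_le (nu j)
    have h6 := le_abs_self (lam j)
    have h7 := le_abs_self R
    have h8 : 0 < 1 / δ := by positivity
    linarith [hs.1]
  refine hf.mem_superlevel_of_le hle fun i => ?_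
  have h1 : 1 / k ≤ δ := by
    rw [div_le_iff₀ hk0]
    have := mul_le_mul_of_nonneg_left hk1 hδ.le
    rwa [mul_one_div_cancel hδ.ne'] at this
  simp only [pushed, hnu, hone, PiLp.add_apply, PiLp.single_apply, PiLp.sub_apply,
    PiLp.smul_apply, smul_eq_mul]
  split_ifs <;> linarith

end StructureConditions

end ConvexAnalysis

/-! ### Linearizing the equation without differentiating eigenvalues. -/

section Linearization

/-- A local inverse of the squaring map near `1` in a Banach algebra. -/
theorem exists_local_sqrt (A : Type*) [NormedRing A] [NormedAlgebra ℝ A] [CompleteSpace A] :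
    ∃ W : A → A, HasFDerivAt W ((1 / 2 : ℝ) • ContinuousLinearMap.id ℝ A) 1 ∧ W 1 = 1 ∧
      (∀ᶠ s in 𝓝 (1 : A), W s * W s = s) ∧ ∀ᶠ w in 𝓝 (1 : A), W (w * w) = w := by
  let D : A ≃L[ℝ] A := ContinuousLinearEquiv.smulLeft (Units.mk0 (2 : ℝ) two_ne_zero)
  have h : HasStrictFDerivAt (fun w : A => w * w) (D : A →L[ℝ] A) 1 := by
    have := (hasStrictFDerivAt_id (𝕜 := ℝ) (1 : A)).mul' (hasStrictFDerivAt_id (𝕜 := ℝ) (1 : A))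
    refine this.congr_fderiv ?_
    ext x
    simp [D, two_smul, Units.smul_def]
  have h1 := h.to_localInverse
  have h2 := h.eventually_right_inverse
  have h3 := h.eventually_left_inverse
  simp only [mul_one] at h1 h2
  refine ⟨h.localInverse _ _ _, ?_, ?_, h2, h3⟩
  · refine h1.hasFDerivAt.congr_fderiv ?_
    ext x
    rw [ContinuousLinearEquiv.coe_coe, ContinuousLinearEquiv.symm_apply_eq]
    simp [D, Units.smul_def, smul_smul]
  · have := h3.self_of_nhds
    simpa using this

variable {n : ℕ}

attribute [local instance] Matrix.linftyOpNormedRing Matrix.linftyOpNormedAlgebra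

theorem hasDerivAt_matrix {S : ℝ → Matrix (Fin n) (Fin n) ℝ} {S' : Matrix (Fin n) (Fin n) ℝ}
    {t : ℝ} (h : ∀ i j, HasDerivAt (fun t => S t i j) (S' i j) t) : HasDerivAt S S' t := by
  have h1 : HasDerivAt (fun t => ∑ i, ∑ j, S t i j • Matrix.single i j (1 : ℝ))
      (∑ i, ∑ j, S' i j • Matrix.single i j (1 : ℝ)) t :=
    HasDerivAt.fun_sum fun i _ => HasDerivAt.fun_sum fun j _ => (h i j).smul_const _
  convert h1 using 1
  · funext t
    conv_lhs => rw [Matrix.matrix_eq_sum_single (S t)]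
    simp
  · conv_lhs => rw [Matrix.matrix_eq_sum_single S']
    simp

theorem HasDerivAt.matrix_apply {S : ℝ → Matrix (Fin n) (Fin n) ℝ}
    {S' : Matrix (Fin n) (Fin n) ℝ} {t : ℝ} (h : HasDerivAt S S' t) (i j : Fin n) :
    HasDerivAt (fun t => S t i j) (S' i j) t :=
  ((LinearMap.toContinuousLinearMap (Matrix.entryLinearMap ℝ ℝ i j)).hasFDerivAt.comp_hasDerivAt
    t h)

/-- A differentiable choice of the inverse square root of a curve of symmetric matrices. -/
theorem exists_inverse_sqrt {S : ℝ → Matrix (Fin n) (Fin n) ℝ} {S' : Matrix (Fin n) (Fin n) ℝ}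
    (hS : HasDerivAt S S' 0) (hS0 : S 0 = 1) (hsymm : ∀ᶠ t in 𝓝 0, (S t).transpose = S t) :
    ∃ R N : ℝ → Matrix (Fin n) (Fin n) ℝ, HasDerivAt N (-((1 / 2 : ℝ) • S')) 0 ∧ N 0 = 1 ∧
      ∀ᶠ t in 𝓝 0, (R t).transpose = R t ∧ R t * R t = S t ∧ R t * N t = 1 ∧ N t * R t = 1 := by
  obtain ⟨W, hW, hW1, hWr, hWl⟩ := exists_local_sqrt (Matrix (Fin n) (Fin n) ℝ)
  have hR : HasDerivAt (fun t => W (S t)) ((1 / 2 : ℝ) • S') 0 := by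
    have h0 : HasFDerivAt W ((1 / 2 : ℝ) • ContinuousLinearMap.id ℝ _) (S 0) := by rwa [hS0]
    exact (h0.comp_hasDerivAt 0 hS).congr_deriv rfl
  have hSc : Filter.Tendsto S (𝓝 0) (𝓝 1) := hS0 ▸ hS.continuousAt.tendsto
  have hRc : Filter.Tendsto (fun t => W (S t)) (𝓝 0) (𝓝 1) := by
    have := hR.continuousAt.tendsto
    rwa [hS0, hW1] at this
  have hRt : Filter.Tendsto (fun t => (W (S t)).transpose) (𝓝 0) (𝓝 1) := by
    have hc : Continuous fun A : Matrix (Fin n) (Fin n) ℝ => A.transpose :=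
      Continuous.matrix_transpose continuous_id
    simpa [Function.comp_def] using (hc.tendsto 1).comp hRc
  have hunit : ∀ᶠ t in 𝓝 (0 : ℝ), IsUnit (W (S t)) :=
    hRc.eventually (Units.nhds (1 : (Matrix (Fin n) (Fin n) ℝ)ˣ))
  refine ⟨fun t => W (S t), fun t => Ring.inverse (W (S t)), ?_, by simp [hS0, hW1], ?_⟩
  · have h1 := hasFDerivAt_ringInverse (𝕜 := ℝ) (1 : (Matrix (Fin n) (Fin n) ℝ)ˣ)
    have h2 : HasFDerivAt Ring.inverse (-ContinuousLinearMap.mulLeftRight ℝ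
        (Matrix (Fin n) (Fin n) ℝ) 1 1) (W (S 0)) := by
      rw [hS0, hW1]
      simpa using h1
    have h3 : (-ContinuousLinearMap.mulLeftRight ℝ (Matrix (Fin n) (Fin n) ℝ) 1 1)
        ((1 / 2 : ℝ) • S') = -((1 / 2 : ℝ) • S') := by
      change -(1 * ((1 / 2 : ℝ) • S') * 1) = _
      rw [one_mul, mul_one]
    exact (h2.comp_hasDerivAt 0 hR).congr_deriv h3
  · filter_upwards [hsymm, hSc.eventually hWr, hRt.eventually hWl, hunit] with t h1 h2 h3 h4
    refine ⟨?_, h2, Ring.mul_inverse_cancel _ h4, Ring.inverse_mul_cancel _ h4⟩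
    -- The transpose of the root is again a square root of `S t` near `1`, so by local uniqueness it
    -- is the same root.
    rw [← h3, ← Matrix.transpose_mul, h2, h1]

variable {Γ : Set (Vec n)} {f : Vec n → ℝ}

/-- With `R` the symmetric root of the metric `S` and `N = R⁻¹`, the matrix `R Q` is orthogonal and
diagonalizes `N A N` to `μ`. The diagonal of `N A N` is therefore a doubly stochastic image of `μ`.
-/
theorem StructureConditions.sub_le_of_isEigenvalues (hf : StructureConditions Γ f) {lam mu : Vec n}
    (hl : lam ∈ Γ) (hm : mu ∈ Γ) {A S R N : Matrix (Fin n) (Fin n) ℝ} (hR : R.transpose = R)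
    (hRS : R * R = S) (hRN : R * N = 1) (hNR : N * R = 1) (h : IsEigenvalues S A mu) :
    f mu - f lam ≤ ∑ i, fpart f i lam * ((N * A * N) i i - lam i) := by
  obtain ⟨Q, hQ1, hQ2⟩ := h
  have h1 : (R * Q).transpose * (R * Q) = 1 := by
    rw [Matrix.transpose_mul, hR, ← hQ1, ← hRS]
    simp only [Matrix.mul_assoc]
  have h2 : (R * Q).transpose * (N * A * N) * (R * Q) = Matrix.diagonal fun i => mu i := by
    rw [Matrix.transpose_mul, hR, ← hQ2]
    calc _ = Q.transpose * (R * N) * A * (N * R) * Q := by simp only [Matrix.mul_assoc]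
      _ = _ := by rw [hRN, hNR, Matrix.mul_one, Matrix.mul_one]
  have h3 := hf.sub_le_sum_doublyStochastic hl hm (sq_mem_doublyStochastic h1)
  simp only [← diag_eq_of_orthogonal h1 h2] at h3
  exact h3

/-- Differentiating `f(λ(A)) = ψ` along a curve, at a point where everything is diagonal. -/
theorem StructureConditions.deriv_eq_of_diagonal (hf : StructureConditions Γ f)
    {S A : ℝ → Matrix (Fin n) (Fin n) ℝ} {S' A' : Matrix (Fin n) (Fin n) ℝ} {ψ : ℝ → ℝ} {ψ' : ℝ}
    {lam : Vec n} (hS : HasDerivAt S S' 0) (hA : HasDerivAt A A' 0) (hψ : HasDerivAt ψ ψ' 0)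
    (hS0 : S 0 = 1) (hA0 : A 0 = Matrix.diagonal fun i => lam i)
    (hsymm : ∀ᶠ t in 𝓝 0, (S t).transpose = S t) (hl : lam ∈ Γ) (hfl : f lam = ψ 0)
    (hev : ∀ᶠ t in 𝓝 0, ∃ mu ∈ Γ, IsEigenvalues (S t) (A t) mu ∧ f mu = ψ t) :
    ψ' = ∑ i, fpart f i lam * (A' i i - lam i * S' i i) := by
  obtain ⟨R, N, hN, hN0, hRN⟩ := exists_inverse_sqrt hS hS0 hsymm
  have hB : HasDerivAt (fun t => N t * A t * N t)
      ((-((1 / 2 : ℝ) • S') * A 0 + N 0 * A') * N 0 + N 0 * A 0 * -((1 / 2 : ℝ) • S')) 0 :=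
    (hN.mul hA).mul hN
  have hsum : HasDerivAt
      (fun t => ∑ i, fpart f i lam * ((N t * A t * N t) i i - lam i) - ψ t)
      (∑ i, fpart f i lam * (A' i i - lam i * S' i i) - ψ') 0 := by
    refine HasDerivAt.sub (HasDerivAt.fun_sum fun i _ => ?_) hψ
    have h1 := ((HasDerivAt.matrix_apply hB i i).sub_const (lam i)).const_mul (fpart f i lam)
    refine h1.congr_deriv ?_
    rw [hN0, hA0]
    simp [Matrix.add_apply]
    exact Or.inl (by ring)
  -- The function is at least `f μ - f λ - ψ t = -f λ`, which is its value at `0`. The concavity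
  -- inequality thus becomes an identity between first derivatives.
  have hmin : IsLocalMin (fun t => ∑ i, fpart f i lam * ((N t * A t * N t) i i - lam i) - ψ t)
      0 := by
    filter_upwards [hRN, hev] with t ⟨h1, h2, h3, h4⟩ ⟨mu, hm, h5, h6⟩
    have h7 := hf.sub_le_of_isEigenvalues hl hm h1 h2 h3 h4 h5
    have h8 : ∑ i, fpart f i lam * ((N 0 * A 0 * N 0) i i - lam i) = 0 := by
      simp [hN0, hA0]
    rw [h8]
    linarith
  have := hmin.hasDerivAt_eq_zero hsum
  linarith

/-- The linearized equation, in a frame `P` diagonalizing `U` with respect to `G`. -/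
theorem StructureConditions.deriv_eq_of_isEigenvalues (hf : StructureConditions Γ f)
    {G U : ℝ → Matrix (Fin n) (Fin n) ℝ} {G' U' P : Matrix (Fin n) (Fin n) ℝ} {ψ : ℝ → ℝ}
    {ψ' : ℝ} {lam : Vec n} (hG : ∀ i j, HasDerivAt (fun t => G t i j) (G' i j) 0)
    (hU : ∀ i j, HasDerivAt (fun t => U t i j) (U' i j) 0) (hψ : HasDerivAt ψ ψ' 0)
    (hP1 : P.transpose * G 0 * P = 1)
    (hP2 : P.transpose * U 0 * P = Matrix.diagonal fun i => lam i)
    (hsymm : ∀ᶠ t in 𝓝 0, (G t).transpose = G t) (hl : lam ∈ Γ) (hfl : f lam = ψ 0)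
    (hev : ∀ᶠ t in 𝓝 0, ∃ mu ∈ Γ, IsEigenvalues (G t) (U t) mu ∧ f mu = ψ t) :
    ψ' = ∑ i, fpart f i lam *
      ((P.transpose * U' * P) i i - lam i * (P.transpose * G' * P) i i) := by
  have hinv : P * (P.transpose * G 0) = 1 := mul_eq_one_comm.mp hP1
  set Pi := P.transpose * G 0 with hPi
  have hPP : Pi * P = 1 := hP1
  have hconj : ∀ {B : ℝ → Matrix (Fin n) (Fin n) ℝ} {B' : Matrix (Fin n) (Fin n) ℝ},
      (∀ i j, HasDerivAt (fun t => B t i j) (B' i j) 0) →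
      HasDerivAt (fun t => P.transpose * B t * P) (P.transpose * B' * P) 0 := by
    intro B B' h
    have h1 := hasDerivAt_matrix h
    exact (h1.const_mul P.transpose).mul_const P
  refine hf.deriv_eq_of_diagonal (hconj hG) (hconj hU) hψ hP1 hP2 ?_ hl hfl ?_
  · filter_upwards [hsymm] with t ht
    rw [Matrix.transpose_mul, Matrix.transpose_mul, ht, Matrix.transpose_transpose,
      Matrix.mul_assoc]
  · filter_upwards [hev] with t ⟨mu, hm, ⟨Q, hQ1, hQ2⟩, h6⟩
    have key : ∀ B : Matrix (Fin n) (Fin n) ℝ, (Pi * Q).transpose * (P.transpose * B * P) *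
        (Pi * Q) = Q.transpose * B * Q := by
      intro B
      have h1 : P * (Pi * Q) = Q := by rw [← Matrix.mul_assoc, hinv, Matrix.one_mul]
      calc _ = (P * (Pi * Q)).transpose * B * (P * (Pi * Q)) := by
            simp only [Matrix.transpose_mul, Matrix.mul_assoc]
        _ = _ := by rw [h1]
    exact ⟨mu, hm, ⟨Pi * Q, by rw [key, hQ1], by rw [key, hQ2]⟩, h6⟩

end Linearization

/-! ### Gradient, Hessian and Bochner formula on a normed space with a metric. -/

section LocalGeometry

variable {E : Type*} [NormedAddCommGroup E] [NormedSpace ℝ E]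

/-- `Γ` is the Levi-Civita connection of the metric `g` near the point `y` of a normed space. -/
structure IsLeviCivitaNear (g : E → E →L[ℝ] E →L[ℝ] ℝ) (Γ : E → E →L[ℝ] E →L[ℝ] E) (y : E) :
    Prop where
  metric_symm : ∀ᶠ z in 𝓝 y, ∀ a b, g z a b = g z b a
  metric_diff : ∀ᶠ z in 𝓝 y, DifferentiableAt ℝ g z
  koszul : ∀ᶠ z in 𝓝 y, ∀ a b c,
    2 * g z (Γ z a b) c = fderiv ℝ g z a b c + fderiv ℝ g z b a c - fderiv ℝ g z c a b
  conn_symm : ∀ᶠ z in 𝓝 y, ∀ a b, Γ z a b = Γ z b a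
  conn_diff : DifferentiableAt ℝ Γ y

/-- `X` is the gradient of `u` near `y`. -/
structure IsGradientNear (g : E → E →L[ℝ] E →L[ℝ] ℝ) (u : E → ℝ) (X : E → E) (y : E) :
    Prop where
  eq : ∀ᶠ z in 𝓝 y, ∀ b, g z (X z) b = fderiv ℝ u z b
  diff : ∀ᶠ z in 𝓝 y, DifferentiableAt ℝ X z

/-- The Hessian `∇²u(a, b)` with respect to the connection `Γ`. -/
def covHess (Γ : E → E →L[ℝ] E →L[ℝ] E) (u : E → ℝ) (z a b : E) : ℝ :=
  fderiv ℝ (fderiv ℝ u) z a b - fderiv ℝ u z (Γ z a b)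

/-- The vector `R(X, e) e`. -/
def curvVec (Γ : E → E →L[ℝ] E →L[ℝ] E) (z X e : E) : E :=
  fderiv ℝ Γ z X e e - fderiv ℝ Γ z e X e + Γ z X (Γ z e e) - Γ z e (Γ z X e)

/-- The covariant derivative `∇_a X`. -/
def covDeriv (Γ : E → E →L[ℝ] E →L[ℝ] E) (X : E → E) (z a : E) : E :=
  fderiv ℝ X z a + Γ z a (X z)

/-- The derivative in the direction `X` of the function `∇²u(e, e)`. -/
def dCovHess (Γ : E → E →L[ℝ] E →L[ℝ] E) (u : E → ℝ) (z X e : E) : ℝ :=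
  fderiv ℝ (fderiv ℝ (fderiv ℝ u)) z X e e - fderiv ℝ (fderiv ℝ u) z X (Γ z e e)
    - fderiv ℝ u z (fderiv ℝ Γ z X e e)

variable {g : E → E →L[ℝ] E →L[ℝ] ℝ} {Γ : E → E →L[ℝ] E →L[ℝ] E} {u : E → ℝ} {X : E → E} {y : E}

theorem hasDerivAt_line {F : Type*} [NormedAddCommGroup F] [NormedSpace ℝ F] {φ : E → F}
    {φ' : E →L[ℝ] F} {z : E} (h : HasFDerivAt φ φ' z) (a : E) :
    HasDerivAt (fun t : ℝ => φ (z + t • a)) (φ' a) 0 := by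
  have hline : HasDerivAt (fun t : ℝ => z + t • a) a 0 := by
    simpa using ((hasDerivAt_id (0 : ℝ)).smul_const a).const_add z
  have h2 : HasFDerivAt φ φ' (z + (0 : ℝ) • a) := by simpa using h
  exact h2.comp_hasDerivAt (0 : ℝ) hline

theorem eventually_differentiableAt_fderiv (hu : ContDiffAt ℝ 2 u y) :
    ∀ᶠ z in 𝓝 y, DifferentiableAt ℝ u z ∧ DifferentiableAt ℝ (fderiv ℝ u) z ∧
      ∀ a b, fderiv ℝ (fderiv ℝ u) z a b = fderiv ℝ (fderiv ℝ u) z b a := by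
  filter_upwards [hu.eventually (by simp)] with z hz
  refine ⟨hz.differentiableAt (by simp), (hz.fderiv_right (m := 1) (by norm_num)).differentiableAt
    (by simp), fun a b => ?_⟩
  exact (hz.isSymmSndFDerivAt (by simp)).eq a b

theorem IsGradientNear.fderiv_fderiv_apply (hg : IsLeviCivitaNear g Γ y)
    (hX : IsGradientNear g u X y) (hu : ContDiffAt ℝ 2 u y) :
    ∀ᶠ z in 𝓝 y, ∀ a b, fderiv ℝ (fderiv ℝ u) z a b =
      fderiv ℝ g z a (X z) b + g z (fderiv ℝ X z a) b := by
  filter_upwards [hX.eq.eventually_nhds, hX.diff, hg.metric_diff,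
    eventually_differentiableAt_fderiv hu] with z h1 h2 h3 h4 a b
  have e1 : HasFDerivAt (fun w => fderiv ℝ u w b)
      ((fderiv ℝ (fderiv ℝ u) z).flip b) z := by
    simpa using h4.2.1.hasFDerivAt.clm_apply (hasFDerivAt_const b z)
  have e2 := (h3.hasFDerivAt.clm_apply h2.hasFDerivAt).clm_apply (hasFDerivAt_const b z)
  have e3 : (fun w => g w (X w) b) =ᶠ[𝓝 z] fun w => fderiv ℝ u w b := h1.mono fun w hw => hw b
  have e4 := (e1.congr_of_eventuallyEq e3).unique e2
  have := DFunLike.congr_fun e4 a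
  simp at this
  linarith

/-- Differentiating `g(X, b) = du(b)` gives the second derivatives of `u`; the Koszul formula
converts the derivatives of `g` into the connection terms. -/
theorem IsGradientNear.metric_covDeriv (hg : IsLeviCivitaNear g Γ y)
    (hX : IsGradientNear g u X y) (hu : ContDiffAt ℝ 2 u y) :
    ∀ᶠ z in 𝓝 y, ∀ a b, g z (covDeriv Γ X z a) b = covHess Γ u z a b := by
  filter_upwards [hX.eq, hX.fderiv_fderiv_apply hg hu, hg.koszul, hg.metric_symm,
    hg.metric_symm.eventually_nhds, hg.metric_diff] with z h1 h2 h3 h4 h5 h6 a b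
  have hsym : ∀ c d e, fderiv ℝ g z c d e = fderiv ℝ g z c e d := by
    intro c d e
    have e1 := (h6.hasFDerivAt.clm_apply (hasFDerivAt_const d z)).clm_apply (hasFDerivAt_const e z)
    have e2 := (h6.hasFDerivAt.clm_apply (hasFDerivAt_const e z)).clm_apply (hasFDerivAt_const d z)
    have e3 := (e1.congr_of_eventuallyEq (h5.mono fun w hw => hw e d)).unique e2
    have := DFunLike.congr_fun e3 c
    simpa using this
  have k1 := h3 a (X z) b
  have k2 := h3 a b (X z)
  have k3 := h1 (Γ z a b)
  have k4 := h4 (X z) (Γ z a b)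
  simp only [covDeriv, covHess, map_add, _root_.add_apply]
  rw [h2, ← k3, k4]
  have s1 := hsym a (X z) b
  linarith

/-- `∂_a |∇u|² = 2 ∇²u(a, ∇u)`. -/
theorem IsGradientNear.hasFDerivAt_sqNorm (hg : IsLeviCivitaNear g Γ y)
    (hX : IsGradientNear g u X y) (hu : ContDiffAt ℝ 2 u y) :
    ∀ᶠ z in 𝓝 y, ∀ a, HasDerivAt (fun t : ℝ => fderiv ℝ u (z + t • a) (X (z + t • a)))
      (2 * covHess Γ u z a (X z)) 0 := by
  filter_upwards [hX.eq, hX.fderiv_fderiv_apply hg hu, hg.koszul, hg.metric_symm, hX.diff,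
    eventually_differentiableAt_fderiv hu] with z h1 h2 h3 h4 h5 h6 a
  have e1 := h6.2.1.hasFDerivAt.clm_apply h5.hasFDerivAt
  refine (hasDerivAt_line e1 a).congr_deriv ?_
  have k1 := h3 a (X z) (X z)
  have k2 := h1 (Γ z a (X z))
  have k3 := h4 (X z) (Γ z a (X z))
  have k4 := h2 a (X z)
  have k5 := h1 (fderiv ℝ X z a)
  have k6 := h4 (X z) (fderiv ℝ X z a)
  simp [covHess]
  linarith

/-- The Bochner formula for `½ ∂_e ∂_e |∇u|²`. -/
theorem IsGradientNear.hasDerivAt_covHess (hg : IsLeviCivitaNear g Γ y)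
    (hX : IsGradientNear g u X y) (hu : ContDiffAt ℝ 3 u y) (e : E) :
    HasDerivAt (fun t : ℝ => covHess Γ u (y + t • e) e (X (y + t • e)))
      (dCovHess Γ u y (X y) e + covHess Γ u y (X y) (Γ y e e)
        - 2 * covHess Γ u y e (Γ y e (X y)) + g y (curvVec Γ y (X y) e) (X y)
        + g y (covDeriv Γ X y e) (covDeriv Γ X y e)) 0 := by
  have hu2 : ContDiffAt ℝ 2 u y := hu.of_le (by norm_num)
  have hd2 := eventually_differentiableAt_fderiv hu2
  have hu' : ContDiffAt ℝ 2 (fderiv ℝ u) y := hu.fderiv_right (by norm_num)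
  have hu'' : DifferentiableAt ℝ (fderiv ℝ (fderiv ℝ u)) y :=
    (hu'.fderiv_right (m := 1) (by norm_num)).differentiableAt (by simp)
  have hXd := hX.diff.self_of_nhds
  have hud := hd2.self_of_nhds
  have e1 := (hu''.hasFDerivAt.clm_apply (hasFDerivAt_const e y)).clm_apply hXd.hasFDerivAt
  have e2 := (hg.conn_diff.hasFDerivAt.clm_apply (hasFDerivAt_const e y)).clm_apply
    hXd.hasFDerivAt
  have e3 := hud.2.1.hasFDerivAt.clm_apply e2
  refine (hasDerivAt_line (e1.sub e3) e).congr_deriv ?_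
  -- Third derivatives of `u` commute, so `X` can be moved to the front. The derivatives of `Γ` do
  -- not, and what is left over, with the quadratic terms in `Γ`, is the curvature.
  have hsym3 : ∀ a b c, fderiv ℝ (fderiv ℝ (fderiv ℝ u)) y a b c =
      fderiv ℝ (fderiv ℝ (fderiv ℝ u)) y b a c := fun a b c =>
    DFunLike.congr_fun ((hu'.isSymmSndFDerivAt (by simp)).eq a b) c
  have hsym3' : ∀ a b c, fderiv ℝ (fderiv ℝ (fderiv ℝ u)) y a b c =
      fderiv ℝ (fderiv ℝ (fderiv ℝ u)) y a c b := by
    intro a b c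
    have f1 := (hu''.hasFDerivAt.clm_apply (hasFDerivAt_const b y)).clm_apply
      (hasFDerivAt_const c y)
    have f2 := (hu''.hasFDerivAt.clm_apply (hasFDerivAt_const c y)).clm_apply
      (hasFDerivAt_const b y)
    have f3 := (f1.congr_of_eventuallyEq (hd2.mono fun w hw => hw.2.2 c b)).unique f2
    have := DFunLike.congr_fun f3 a
    simpa using this
  have hsymΓ : ∀ a b c, fderiv ℝ Γ y a b c = fderiv ℝ Γ y a c b := by
    intro a b c
    have hd := hg.conn_diff
    have f1 := (hd.hasFDerivAt.clm_apply (hasFDerivAt_const b y)).clm_apply (hasFDerivAt_const c y)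
    have f2 := (hd.hasFDerivAt.clm_apply (hasFDerivAt_const c y)).clm_apply (hasFDerivAt_const b y)
    have f3 := (f1.congr_of_eventuallyEq (hg.conn_symm.mono fun w hw => hw c b)).unique f2
    have := DFunLike.congr_fun f3 a
    simpa using this
  have hΓ := hg.conn_symm.self_of_nhds
  have hXe := hX.eq.self_of_nhds
  have hgs := hg.metric_symm.self_of_nhds
  have hcov := (hX.metric_covDeriv hg hu2).self_of_nhds e (covDeriv Γ X y e)
  have hR : g y (curvVec Γ y (X y) e) (X y) = fderiv ℝ u y (curvVec Γ y (X y) e) := by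
    rw [hgs, hXe]
  rw [hcov, hR]
  have t1 := hsym3' e e (X y)
  have t2 := hsym3 e (X y) e
  have t3 := hud.2.2
  have t4 := hsymΓ e e (X y)
  have t5 := hΓ e (X y)
  simp only [covHess, dCovHess, curvVec, covDeriv, map_add, map_sub,
    _root_.sub_apply, _root_.add_apply, ContinuousLinearMap.comp_apply,
    ContinuousLinearMap.flip_apply, _root_.zero_apply, map_zero, t1, t2, t4]
  simp [← t5]
  have t6 := t3 (X y) (Γ y e e)
  linarith

end LocalGeometry

/-! ### First and second order conditions at a maximum of `|∇u| / ζ`. -/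

section MaximumPrinciple

/-- If `c > 0`, then `0` would be a local minimum as well, so `F` would be constant nearby and `c =
0`. -/
theorem le_zero_of_isLocalMax {F F₁ : ℝ → ℝ} {c : ℝ} (hmax : IsLocalMax F 0)
    (hF : ∀ᶠ t in 𝓝 0, HasDerivAt F (F₁ t) t) (hF₁ : HasDerivAt F₁ c 0) : c ≤ 0 := by
  by_contra! hc
  have h1 : deriv F =ᶠ[𝓝 0] F₁ := hF.mono fun t ht => ht.deriv
  have h2 : deriv (deriv F) 0 = c := (hF₁.congr_of_eventuallyEq h1).deriv
  have hmin : IsLocalMin F 0 := isLocalMin_of_deriv_deriv_pos (by rwa [h2]) hmax.deriv_eq_zero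
    hF.self_of_nhds.continuousAt
  have hconst : F =ᶠ[𝓝 0] fun _ => F 0 := by
    filter_upwards [hmax, hmin] with t h3 h4
    exact le_antisymm h3 h4
  have h5 : deriv F =ᶠ[𝓝 0] fun _ => 0 := by
    filter_upwards [hconst.eventually_nhds] with t ht
    rw [Filter.EventuallyEq.deriv_eq (show F =ᶠ[𝓝 t] fun _ => F 0 from ht)]
    simp
  have h6 : deriv (deriv F) 0 = 0 := by
    rw [h5.deriv_eq]
    simp
  linarith

variable {E : Type*} [NormedAddCommGroup E] [NormedSpace ℝ E]

theorem tendsto_line (y e : E) : Filter.Tendsto (fun t : ℝ => y + t • e) (𝓝 0) (𝓝 y) := by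
  have : Continuous fun t : ℝ => y + t • e := by fun_prop
  simpa using this.tendsto 0

theorem HasDerivAt.of_line {φ : E → ℝ} {y e : E} {c t : ℝ}
    (h : HasDerivAt (fun s : ℝ => φ (y + t • e + s • e)) c 0) :
    HasDerivAt (fun s : ℝ => φ (y + s • e)) c t := by
  have h2 : HasDerivAt (fun s : ℝ => φ (y + t • e + s • e)) c (t - t) := by simpa using h
  have h3 : (fun s : ℝ => φ (y + s • e)) = fun s => φ (y + t • e + (s - t) • e) := by
    funext s
    congr 1
    module
  rw [h3]
  exact h2.comp_sub_const t t

variable {g : E → E →L[ℝ] E →L[ℝ] ℝ} {Γ : E → E →L[ℝ] E →L[ℝ] E} {u ζ : E → ℝ} {X : E → E}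
  {y : E}

theorem covHess_comm (hΓ : ∀ a b, Γ y a b = Γ y b a) (hu : ContDiffAt ℝ 2 u y) (a b : E) :
    covHess Γ u y a b = covHess Γ u y b a := by
  simp only [covHess]
  rw [hΓ a b, (eventually_differentiableAt_fderiv hu).self_of_nhds.2.2 a b]

/-- Maximality of the quotient is expressed through `|∇u|² - m ζ²`, with the constant `m = |∇u|² /
ζ²` frozen at `y`, so no quotient needs to be differentiated. -/
theorem IsGradientNear.covHess_eq_of_isMax (hg : IsLeviCivitaNear g Γ y)
    (hX : IsGradientNear g u X y) (hu : ContDiffAt ℝ 3 u y) (hζ : ContDiffAt ℝ 2 ζ y)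
    (hζ0 : 0 < ζ y)
    (hmax : ∀ᶠ z in 𝓝 y, fderiv ℝ u z (X z) ≤ fderiv ℝ u y (X y) / ζ y ^ 2 * ζ z ^ 2) (a : E) :
    covHess Γ u y a (X y) = fderiv ℝ u y (X y) / ζ y * fderiv ℝ ζ y a := by
  have h1 := (hX.hasFDerivAt_sqNorm hg (hu.of_le (by norm_num))).self_of_nhds a
  have h2 := hasDerivAt_line (hζ.differentiableAt (by simp)).hasFDerivAt a
  have h3 := h1.sub ((h2.pow 2).const_mul (fderiv ℝ u y (X y) / ζ y ^ 2))
  have h4 : IsLocalMax (fun t : ℝ => fderiv ℝ u (y + t • a) (X (y + t • a)) -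
      fderiv ℝ u y (X y) / ζ y ^ 2 * ζ (y + t • a) ^ 2) 0 := by
    filter_upwards [(tendsto_line y a).eventually hmax] with t ht
    have : fderiv ℝ u y (X y) / ζ y ^ 2 * ζ y ^ 2 = fderiv ℝ u y (X y) :=
      div_mul_cancel₀ _ (by positivity)
    simp only [zero_smul, add_zero, this]
    linarith
  have h5 := h4.hasDerivAt_eq_zero h3
  simp only [zero_smul, add_zero] at h5
  field_simp at h5 ⊢
  refine mul_left_cancel₀ hζ0.ne' ?_
  linear_combination h5 / 2

/-- The square `|∇_e ∇u|²` of the Bochner formula absorbs exactly the term `m dζ(e)²` from the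
second derivative of `m ζ²`, so that only the Hessian of `ζ` remains. -/
theorem IsGradientNear.bochner_le_of_isMax (hg : IsLeviCivitaNear g Γ y)
    (hX : IsGradientNear g u X y) (hu : ContDiffAt ℝ 3 u y) (hζ : ContDiffAt ℝ 2 ζ y)
    (hζ0 : 0 < ζ y) (hpos : ∀ a, 0 ≤ g y a a) (hv : 0 < fderiv ℝ u y (X y))
    (hmax : ∀ᶠ z in 𝓝 y, fderiv ℝ u z (X z) ≤ fderiv ℝ u y (X y) / ζ y ^ 2 * ζ z ^ 2) (e : E) :
    dCovHess Γ u y (X y) e - 2 * covHess Γ u y e (Γ y e (X y)) + g y (curvVec Γ y (X y) e) (X y)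
      ≤ fderiv ℝ u y (X y) / ζ y * covHess Γ ζ y e e := by
  have hu2 : ContDiffAt ℝ 2 u y := hu.of_le (by norm_num)
  have hfirst := hX.covHess_eq_of_isMax hg hu hζ hζ0 hmax
  set v := fderiv ℝ u y (X y) with hvdef
  set m := v / ζ y ^ 2 with hm
  have hd1 : ∀ᶠ t : ℝ in 𝓝 0, HasDerivAt (fun t : ℝ => fderiv ℝ u (y + t • e) (X (y + t • e)) -
      m * ζ (y + t • e) ^ 2) (2 * covHess Γ u (y + t • e) e (X (y + t • e)) -
        m * (2 * ζ (y + t • e) * fderiv ℝ ζ (y + t • e) e)) t := by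
    filter_upwards [(tendsto_line y e).eventually (hX.hasFDerivAt_sqNorm hg hu2),
      (tendsto_line y e).eventually (eventually_differentiableAt_fderiv hζ)] with t h1 h2
    have k1 := HasDerivAt.of_line (φ := fun z => fderiv ℝ u z (X z)) (h1 e)
    have k2 := HasDerivAt.of_line (hasDerivAt_line h2.1.hasFDerivAt e)
    refine (k1.sub ((k2.pow 2).const_mul m)).congr_deriv ?_
    norm_num
  have hd2 : HasDerivAt (fun t : ℝ => 2 * covHess Γ u (y + t • e) e (X (y + t • e)) -
        m * (2 * ζ (y + t • e) * fderiv ℝ ζ (y + t • e) e))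
      (2 * (dCovHess Γ u y (X y) e + covHess Γ u y (X y) (Γ y e e)
        - 2 * covHess Γ u y e (Γ y e (X y)) + g y (curvVec Γ y (X y) e) (X y)
        + g y (covDeriv Γ X y e) (covDeriv Γ X y e)) -
        m * (2 * fderiv ℝ ζ y e * fderiv ℝ ζ y e + 2 * ζ y * fderiv ℝ (fderiv ℝ ζ) y e e)) 0 := by
    have k0 := (eventually_differentiableAt_fderiv hζ).self_of_nhds
    have k1 := (hX.hasDerivAt_covHess hg hu e).const_mul 2
    have k2 := (hasDerivAt_line k0.1.hasFDerivAt e).const_mul 2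
    have k3 := hasDerivAt_line (k0.2.1.hasFDerivAt.clm_apply (hasFDerivAt_const e y)) e
    refine (k1.sub ((k2.mul k3).const_mul m)).congr_deriv ?_
    simp
  have hmax' : IsLocalMax (fun t : ℝ => fderiv ℝ u (y + t • e) (X (y + t • e)) -
      m * ζ (y + t • e) ^ 2) 0 := by
    filter_upwards [(tendsto_line y e).eventually hmax] with t ht
    have : m * ζ y ^ 2 = v := div_mul_cancel₀ _ (by positivity)
    simp only [zero_smul, add_zero, this]
    linarith
  have hle := le_zero_of_isLocalMax hmax' hd1 hd2
  have hcs : m * fderiv ℝ ζ y e ^ 2 ≤ g y (covDeriv Γ X y e) (covDeriv Γ X y e) := by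
    have q1 := (hX.metric_covDeriv hg hu2).self_of_nhds e (X y)
    have q2 := hX.eq.self_of_nhds (X y)
    rw [hfirst e] at q1
    rw [← hvdef] at q2
    -- Cauchy–Schwarz: by the first order condition this is the component of `∇_e X` orthogonal to
    -- `X`.
    have q3 := hpos (covDeriv Γ X y e - (fderiv ℝ ζ y e / ζ y) • X y)
    have q4 := hg.metric_symm.self_of_nhds (X y) (covDeriv Γ X y e)
    simp only [map_sub, map_smul, _root_.sub_apply, _root_.smul_apply, smul_eq_mul, q4, q1, q2]
      at q3
    have q5 : m * fderiv ℝ ζ y e ^ 2 = fderiv ℝ ζ y e / ζ y * (v / ζ y * fderiv ℝ ζ y e) := by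
      rw [hm]
      field_simp
    have q6 : fderiv ℝ ζ y e / ζ y * v = v / ζ y * fderiv ℝ ζ y e := by ring
    rw [q6] at q3
    linarith
  have hsym := covHess_comm hg.conn_symm.self_of_nhds hu2 (X y) (Γ y e e)
  rw [hfirst] at hsym
  have hmv : m * ζ y = v / ζ y := by
    rw [hm]
    field_simp
  rw [hsym] at hle
  have hfin : v / ζ y * covHess Γ ζ y e e =
      m * (ζ y * fderiv ℝ (fderiv ℝ ζ) y e e) - v / ζ y * fderiv ℝ ζ y (Γ y e e) := by
    rw [← hmv]
    simp only [covHess]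
    ring
  rw [hfin]
  linarith

/-- The differential inequality at a maximum of `|∇u| / ζ`, for a solution of an equation
linearized with the weights `F`. -/
theorem IsGradientNear.weighted_le_of_isMax {ι : Type*} [Fintype ι] (hg : IsLeviCivitaNear g Γ y)
    (hX : IsGradientNear g u X y) (hu : ContDiffAt ℝ 3 u y) (hζ : ContDiffAt ℝ 2 ζ y)
    (hζ0 : 0 < ζ y) (hpos : ∀ a, 0 ≤ g y a a) (hv : 0 < fderiv ℝ u y (X y))
    (hmax : ∀ᶠ z in 𝓝 y, fderiv ℝ u z (X z) ≤ fderiv ℝ u y (X y) / ζ y ^ 2 * ζ z ^ 2)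
    {χ : E → E →L[ℝ] E →L[ℝ] ℝ} {e : ι → E} {F lam : ι → ℝ} {ψ' : ℝ} (hF : ∀ i, 0 ≤ F i)
    (hU : ∀ i w, covHess Γ u y (e i) w + χ y (e i) w = lam i * g y (e i) w)
    (hlin : ψ' = ∑ i, F i * (dCovHess Γ u y (X y) (e i) + fderiv ℝ χ y (X y) (e i) (e i)
      - lam i * fderiv ℝ g y (X y) (e i) (e i))) :
    ψ' - ∑ i, F i * (fderiv ℝ χ y (X y) (e i) (e i) - 2 * χ y (e i) (Γ y (e i) (X y)))
      + ∑ i, F i * g y (curvVec Γ y (X y) (e i)) (X y)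
      ≤ fderiv ℝ u y (X y) / ζ y * ∑ i, F i * covHess Γ ζ y (e i) (e i) := by
  rw [hlin, ← Finset.sum_sub_distrib, ← Finset.sum_add_distrib, Finset.mul_sum]
  refine Finset.sum_le_sum fun i _ => ?_
  have h1 := hX.bochner_le_of_isMax hg hu hζ hζ0 hpos hv hmax (e i)
  have h2 := hU i (Γ y (e i) (X y))
  have h3 := hg.koszul.self_of_nhds (e i) (X y) (e i)
  have h4 := hg.metric_symm.self_of_nhds (e i) (Γ y (e i) (X y))
  have h5 : fderiv ℝ g y (e i) (X y) (e i) = fderiv ℝ g y (e i) (e i) (X y) := by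
    have hd := hg.metric_diff.self_of_nhds
    have f1 := (hd.hasFDerivAt.clm_apply (hasFDerivAt_const (X y) y)).clm_apply
      (hasFDerivAt_const (e i) y)
    have f2 := (hd.hasFDerivAt.clm_apply (hasFDerivAt_const (e i) y)).clm_apply
      (hasFDerivAt_const (X y) y)
    have f3 := (f1.congr_of_eventuallyEq (hg.metric_symm.mono fun w hw => hw (e i) (X y))).unique f2
    have := DFunLike.congr_fun f3 (e i)
    simpa using this
  have h6 := mul_le_mul_of_nonneg_left h1 (hF i)
  -- By Koszul `(∂_X g)(e, e) = 2 g(Γ(e, X), e)`. Hence the metric term of the linearized equation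
  -- cancels the coordinate term `2 ∇²u(e, Γ(e, X))` up to `χ`, and no normal coordinates are
  -- needed.
  have h7 : lam i * fderiv ℝ g y (X y) (e i) (e i) =
      2 * (covHess Γ u y (e i) (Γ y (e i) (X y)) + χ y (e i) (Γ y (e i) (X y))) := by
    rw [h2, h4]
    linear_combination lam i * (-h3 - h5)
  rw [h7]
  linarith

theorem fderiv_const_sub_exp {s : E → ℝ} (hs : ContDiffAt ℝ 2 s y) (K : ℝ) (a : E) :
    fderiv ℝ (fun z => K - Real.exp (s z)) y a = -(Real.exp (s y) * fderiv ℝ s y a) := by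
  have h := ((hs.differentiableAt (by simp)).hasFDerivAt.exp).const_sub K
  rw [h.fderiv]
  simp

/-- The square of `ds` is what the exponential is for: it supplies the good term `∑ f_i ds(e_i)²`.
-/
theorem covHess_const_sub_exp {s : E → ℝ} (hs : ContDiffAt ℝ 2 s y) (K : ℝ) (a : E) :
    covHess Γ (fun z => K - Real.exp (s z)) y a a =
      -(Real.exp (s y) * (covHess Γ s y a a + fderiv ℝ s y a ^ 2)) := by
  have h0 := eventually_differentiableAt_fderiv hs
  have h1 : fderiv ℝ (fun z => K - Real.exp (s z)) =ᶠ[𝓝 y]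
      fun z => -(Real.exp (s z) • fderiv ℝ s z) := by
    filter_upwards [h0] with z hz
    exact ((hz.1.hasFDerivAt.exp).const_sub K).fderiv
  have h2 := h0.self_of_nhds
  have h3 := ((h2.1.hasFDerivAt.exp).smul h2.2.1.hasFDerivAt).neg
  have h4 := h3.congr_of_eventuallyEq h1
  simp only [covHess]
  rw [h4.fderiv, fderiv_const_sub_exp hs]
  simp
  ring

end MaximumPrinciple

/-! ### Bilinear maps given by their coefficients. -/

section Bilin

variable {n : ℕ} {W : Type*} [NormedAddCommGroup W] [NormedSpace ℝ W]

/-- The linear map sending `w` to the bilinear map `(a, b) ↦ a_i b_j w`. -/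
def bilinCoeff (W : Type*) [NormedAddCommGroup W] [NormedSpace ℝ W] (i j : Fin n) :
    W →L[ℝ] (Vec n →L[ℝ] Vec n →L[ℝ] W) :=
  (ContinuousLinearMap.smulRightL ℝ (Vec n) (Vec n →L[ℝ] W)
    (EuclideanSpace.proj i : Vec n →L[ℝ] ℝ)).comp
  (ContinuousLinearMap.smulRightL ℝ (Vec n) W (EuclideanSpace.proj j : Vec n →L[ℝ] ℝ))

theorem contDiff_bilinCoeff {m : WithTop ℕ∞} (i j : Fin n) :
    ContDiff ℝ m (fun w => bilinCoeff W i j w) := by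
  fun_prop

/-- The bilinear map with given values on pairs of coordinate vectors. -/
def bilin (A : Fin n → Fin n → W) : Vec n →L[ℝ] Vec n →L[ℝ] W :=
  ∑ i, ∑ j, bilinCoeff W i j (A i j)

theorem bilin_apply (A : Fin n → Fin n → W) (a b : Vec n) :
    bilin A a b = ∑ i, ∑ j, (a i * b j) • A i j := by
  simp [bilin, bilinCoeff, smul_smul]

theorem bilin_single (A : Fin n → Fin n → W) (i j : Fin n) :
    bilin A (EuclideanSpace.single i 1) (EuclideanSpace.single j 1) = A i j := by
  simp [bilin_apply]

theorem contDiffOn_bilin {A : Fin n → Fin n → Vec n → W} {s : Set (Vec n)} {m : WithTop ℕ∞}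
    (h : ∀ i j, ContDiffOn ℝ m (A i j) s) :
    ContDiffOn ℝ m (fun y => bilin fun i j => A i j y) s :=
  ContDiffOn.sum fun i _ => ContDiffOn.sum fun j _ =>
    (contDiff_bilinCoeff i j).comp_contDiffOn (h i j)

theorem fderiv_bilin_apply {A : Fin n → Fin n → Vec n → W} {y : Vec n}
    (h : ∀ i j, DifferentiableAt ℝ (A i j) y) (c a b : Vec n) :
    fderiv ℝ (fun y => bilin fun i j => A i j y) y c a b =
      bilin (fun i j => fderiv ℝ (A i j) y c) a b := by
  have h0 : DifferentiableAt ℝ (fun y => bilin fun i j => A i j y) y := by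
    unfold bilin
    exact DifferentiableAt.fun_sum fun i _ => DifferentiableAt.fun_sum fun j _ =>
      ((contDiff_bilinCoeff i j).differentiable one_ne_zero).differentiableAt.comp y (h i j)
  have h1 := (h0.hasFDerivAt.clm_apply (hasFDerivAt_const a y)).clm_apply (hasFDerivAt_const b y)
  have h2 : HasFDerivAt (fun y => ∑ i, ∑ j, (a i * b j) • A i j y)
      (∑ i, ∑ j, (a i * b j) • fderiv ℝ (A i j) y) y :=
    HasFDerivAt.fun_sum fun i _ => HasFDerivAt.fun_sum fun j _ =>
      (h i j).hasFDerivAt.const_smul _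
  have h3 : (fun y => bilin (fun i j => A i j y) a b) =
      fun y => ∑ i, ∑ j, (a i * b j) • A i j y := by
    funext z
    exact bilin_apply _ a b
  rw [h3] at h1
  have := DFunLike.congr_fun (h1.unique h2) c
  simp only [bilin_apply]
  simpa using this

/-- Used one argument at a time, to reduce multilinear identities to coordinate vectors. -/
theorem linear_eq_zero {Φ : Vec n → ℝ} (h : IsLinearMap ℝ Φ)
    (h0 : ∀ i, Φ (EuclideanSpace.single i 1) = 0) (a : Vec n) : Φ a = 0 := by
  have : Φ a = h.mk' Φ a := rfl
  rw [this, vec_eq_sum_single a]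
  simp [map_sum, h0]

theorem bilin_eq_matrix (B : Matrix (Fin n) (Fin n) ℝ) (P : Matrix (Fin n) (Fin n) ℝ)
    (i j : Fin n) : bilin (fun i j => B i j) (WithLp.toLp 2 fun k => P k i)
      (WithLp.toLp 2 fun k => P k j) =
      (P.transpose * B * P) i j := by
  rw [bilin_apply, Matrix.mul_apply]
  simp only [Matrix.mul_apply, Matrix.transpose_apply, Finset.sum_mul, smul_eq_mul]
  rw [Finset.sum_comm]
  exact Finset.sum_congr rfl fun k _ => Finset.sum_congr rfl fun l _ => by ring

end Bilin

/-! ### Tensors in a chart, smooth up to the boundary. -/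

section Chart

variable {n : ℕ} [NeZero n] {M : Type*} [TopologicalSpace M]
  [ChartedSpace (EuclideanHalfSpace n) M]

/-- The differential of the inverse of the chart at `c`. -/
def coordMap (c : M) (y : Vec n) :
    Vec n →L[ℝ] TangentSpace (𝓡∂ n) ((extChartAt (𝓡∂ n) c).symm y) :=
  mfderivWithin 𝓘(ℝ, Vec n) (𝓡∂ n) (extChartAt (𝓡∂ n) c).symm (Set.range (𝓡∂ n)) y

/-- A covariant `2`-tensor in the chart at `c`. -/
def chartForm (T : Tensor2 n M) (c : M) (y : Vec n) : Vec n →L[ℝ] Vec n →L[ℝ] ℝ :=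
  bilin fun i j => tensorCoord T c y i j

theorem chartForm_apply (T : Tensor2 n M) (c : M) (y a b : Vec n) :
    chartForm T c y a b =
      T ((extChartAt (𝓡∂ n) c).symm y) (coordMap c y a) (coordMap c y b) := by
  rw [chartForm, bilin_apply]
  conv_rhs => rw [vec_eq_sum_single a, vec_eq_sum_single b]
  simp only [map_sum, map_smul]
  simp only [FunLike.coe_sum, Finset.sum_apply, FunLike.coe_smul, Pi.smul_apply, smul_eq_mul,
    Finset.mul_sum]
  rw [Finset.sum_comm]
  refine Finset.sum_congr rfl fun i _ => Finset.sum_congr rfl fun j _ => ?_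
  rw [mul_comm (a j), mul_assoc]
  rfl

theorem tensorCoord_eq (T : Tensor2 n M) (c : M) (y : Vec n) (i j : Fin n) :
    tensorCoord T c y i j =
      chartForm T c y (EuclideanSpace.single i 1) (EuclideanSpace.single j 1) := by
  rw [chartForm, bilin_single]

/-- The Levi-Civita connection in the chart at `c`. -/
def chartConn (g : Tensor2 n M) (c : M) (y : Vec n) : Vec n →L[ℝ] Vec n →L[ℝ] Vec n :=
  bilin fun i j => WithLp.toLp 2 fun k => christoffel g c k i j y

/-- Derivatives within the half space thereby become derivatives within the chart target, the set on
which smoothness is known. -/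
theorem target_eventuallyEq_range {c : M} {y : Vec n} (hy : y ∈ (extChartAt (𝓡∂ n) c).target) :
    (extChartAt (𝓡∂ n) c).target =ᶠ[𝓝 y] Set.range (𝓡∂ n) := by
  have h1 := extChartAt_target_mem_nhdsWithin_of_mem hy
  have h2 := extChartAt_target_subset_range (I := 𝓡∂ n) c
  rw [mem_nhdsWithin] at h1
  obtain ⟨o, ho, hyo, hsub⟩ := h1
  filter_upwards [ho.mem_nhds hyo] with z hz
  exact propext ⟨fun h => h2 h, fun h => hsub ⟨hz, h⟩⟩

theorem fderivWithin_range_eq {F : Type*} [NormedAddCommGroup F] [NormedSpace ℝ F]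
    {c : M} {y : Vec n} (hy : y ∈ (extChartAt (𝓡∂ n) c).target) (h : Vec n → F) :
    fderivWithin ℝ h (Set.range (𝓡∂ n)) y = fderivWithin ℝ h (extChartAt (𝓡∂ n) c).target y :=
  (fderivWithin_congr_set (target_eventuallyEq_range hy)).symm

theorem contDiffOn_fderivWithin_range {F : Type*} [NormedAddCommGroup F] [NormedSpace ℝ F]
    {c : M} {h : Vec n → F} {m k : WithTop ℕ∞}
    (hh : ContDiffOn ℝ m h (extChartAt (𝓡∂ n) c).target) (hk : k + 1 ≤ m) :
    ContDiffOn ℝ k (fun y => fderivWithin ℝ h (Set.range (𝓡∂ n)) y)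
      (extChartAt (𝓡∂ n) c).target :=
  (hh.fderivWithin (uniqueDiffOn_extChartAt_target c) hk).congr fun _ hy =>
    fderivWithin_range_eq hy h

theorem contDiffOn_pd {c : M} {h : Vec n → ℝ} {m k : WithTop ℕ∞}
    (hh : ContDiffOn ℝ m h (extChartAt (𝓡∂ n) c).target) (hk : k + 1 ≤ m) (i : Fin n) :
    ContDiffOn ℝ k (pd i h) (extChartAt (𝓡∂ n) c).target :=
  (contDiffOn_fderivWithin_range hh hk).clm_apply contDiffOn_const

theorem target_mem_nhds {c : M} {y : Vec n} (hy : y ∈ (extChartAt (𝓡∂ n) c).target)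
    (hi : y ∈ interior (Set.range (𝓡∂ n))) : (extChartAt (𝓡∂ n) c).target ∈ 𝓝 y := by
  filter_upwards [target_eventuallyEq_range hy, mem_interior_iff_mem_nhds.1 hi] with z h1 h2
  exact h1.mpr h2

theorem pd_eq_fderiv {y : Vec n} (hi : y ∈ interior (Set.range (𝓡∂ n))) (i : Fin n)
    (h : Vec n → ℝ) : pd i h y = fderiv ℝ h y (EuclideanSpace.single i 1) := by
  rw [pd, fderivWithin_of_mem_nhds (mem_interior_iff_mem_nhds.1 hi)]

variable [IsManifold (𝓡∂ n) ∞ M]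

/-- The field is the tangent map of the inverse chart composed with a constant section. -/
theorem coordVec_smooth (c : M) (a : Vec n) :
    ContMDiffOn 𝓘(ℝ, Vec n) ((𝓡∂ n).tangent) ∞
      (fun y => (⟨(extChartAt (𝓡∂ n) c).symm y, coordMap c y a⟩ : TangentBundle (𝓡∂ n) M))
      (extChartAt (𝓡∂ n) c).target := by
  have h1 := (contMDiffOn_extChartAt_symm (I := 𝓡∂ n) (n := ∞) c).contMDiffOn_tangentMapWithin
    (m := ∞) (by simp) (uniqueDiffOn_extChartAt_target c).uniqueMDiffOn
  have h2 : ContMDiffOn 𝓘(ℝ, Vec n) (𝓘(ℝ, Vec n).tangent) ∞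
      (fun y => (⟨y, a⟩ : TangentBundle 𝓘(ℝ, Vec n) (Vec n))) (extChartAt (𝓡∂ n) c).target :=
    contMDiffOn_vectorSpace_iff_contDiffOn.2 contDiffOn_const
  refine (h1.comp h2 fun y hy => hy).congr fun y hy => ?_
  simp only [Function.comp, tangentMapWithin, coordMap]
  rw [mfderivWithin_congr_set (target_eventuallyEq_range hy)]
  rfl

theorem contDiffOn_tensorCoord {T : Tensor2 n M} (hT : T.IsSmooth) (c : M) (i j : Fin n) :
    ContDiffOn ℝ ∞ (fun y => tensorCoord T c y i j) (extChartAt (𝓡∂ n) c).target := by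
  have h0 : ContMDiffOn 𝓘(ℝ, Vec n) ((𝓡∂ n).prod 𝓘(ℝ, Vec n →L[ℝ] Vec n →L[ℝ] ℝ)) ∞
      (fun y => Bundle.TotalSpace.mk' (Vec n →L[ℝ] Vec n →L[ℝ] ℝ)
      (E := fun x : M => TangentSpace (𝓡∂ n) x →L[ℝ] TangentSpace (𝓡∂ n) x →L[ℝ] ℝ)
      ((extChartAt (𝓡∂ n) c).symm y) (T ((extChartAt (𝓡∂ n) c).symm y)))
      (extChartAt (𝓡∂ n) c).target :=
    ContMDiff.comp_contMDiffOn hT (contMDiffOn_extChartAt_symm c)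
  rw [← contMDiffOn_iff_contDiffOn]
  intro y hy
  have : ContMDiffWithinAt 𝓘(ℝ, Vec n) ((𝓡∂ n).prod 𝓘(ℝ)) ∞
      (fun m ↦ Bundle.TotalSpace.mk' ℝ (E := Bundle.Trivial M ℝ) ((extChartAt (𝓡∂ n) c).symm m)
        (T ((extChartAt (𝓡∂ n) c).symm m) (coordMap c m (EuclideanSpace.single i 1))
          (coordMap c m (EuclideanSpace.single j 1)))) (extChartAt (𝓡∂ n) c).target y := by
    apply ContMDiffWithinAt.clm_bundle_apply₂ (F₁ := Vec n) (F₂ := Vec n)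
    · exact h0 y hy
    · exact coordVec_smooth c _ y hy
    · exact coordVec_smooth c _ y hy
  simp only [Bundle.contMDiffWithinAt_totalSpace] at this
  exact this.2

theorem coordMap_bijective {c : M} {y : Vec n} (hy : y ∈ (extChartAt (𝓡∂ n) c).target) :
    Function.Bijective (coordMap c y) := by
  obtain ⟨L, hL⟩ := isInvertible_mfderivWithin_extChartAt_symm (I := 𝓡∂ n) hy
  have : (coordMap c y : Vec n → _) = L := by
    rw [coordMap, ← hL]
    rfl
  rw [this]
  exact L.bijective

theorem chartForm_pos (g : Metric n M) {c : M} {y : Vec n}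
    (hy : y ∈ (extChartAt (𝓡∂ n) c).target) {a : Vec n} (ha : a ≠ 0) :
    0 < chartForm g.inner c y a a := by
  rw [chartForm_apply]
  refine g.pos _ _ fun h => ha ((coordMap_bijective hy).1 ?_)
  rw [h, map_zero]

theorem chartForm_symm (g : Metric n M) (c : M) (y a b : Vec n) :
    chartForm g.inner c y a b = chartForm g.inner c y b a := by
  rw [chartForm_apply, chartForm_apply, g.symm]

end Chart

/-! ### Smoothness of the inverse matrix. -/

section MatrixInverse

variable {n : ℕ}

attribute [local instance] Matrix.linftyOpNormedRing Matrix.linftyOpNormedAlgebra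

theorem contDiffOn_matrix_inv {E : Type*} [NormedAddCommGroup E] [NormedSpace ℝ E]
    {A : E → Matrix (Fin n) (Fin n) ℝ} {s : Set E} {m : WithTop ℕ∞}
    (hA : ∀ i j, ContDiffOn ℝ m (fun y => A y i j) s) (hdet : ∀ y ∈ s, (A y).det ≠ 0)
    (i j : Fin n) : ContDiffOn ℝ m (fun y => (A y)⁻¹ i j) s := by
  have h1 : ContDiffOn ℝ m A s := by
    have : A = fun y => ∑ i, ∑ j, A y i j • Matrix.single i j (1 : ℝ) := by
      funext y
      conv_lhs => rw [Matrix.matrix_eq_sum_single (A y)]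
      simp
    rw [this]
    exact ContDiffOn.sum fun i _ => ContDiffOn.sum fun j _ => (hA i j).smul contDiffOn_const
  have h2 : ContDiffOn ℝ m (fun y => (A y)⁻¹) s := by
    intro y hy
    have hu : IsUnit (A y) := (Matrix.isUnit_iff_isUnit_det _).2 (hdet y hy).isUnit
    obtain ⟨x, hx⟩ := hu
    have h3 : ContDiffAt ℝ m Ring.inverse (A y) := hx ▸ contDiffAt_ringInverse ℝ x
    have h4 := h3.comp_contDiffWithinAt y (h1 y hy)
    refine h4.congr (fun z _ => ?_) ?_ <;> exact Matrix.nonsing_inv_eq_ringInverse _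
  have h5 : ContDiff ℝ m (fun B : Matrix (Fin n) (Fin n) ℝ => B i j) :=
    (LinearMap.toContinuousLinearMap (Matrix.entryLinearMap ℝ ℝ i j)).contDiff
  exact h5.comp_contDiffOn h2

theorem contDiffOn_toLp {E : Type*} [NormedAddCommGroup E] [NormedSpace ℝ E]
    {A : Fin n → E → ℝ} {s : Set E} {m : WithTop ℕ∞}
    (h : ∀ k, ContDiffOn ℝ m (A k) s) :
    ContDiffOn ℝ m (fun y => (WithLp.toLp 2 fun k => A k y : Vec n)) s := by
  rw [contDiffOn_euclidean]
  exact h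

end MatrixInverse

/-! ### Levi-Civita connection and Hessian in a chart. -/

section ChartGeometry

variable {n : ℕ} [NeZero n] {M : Type*} [TopologicalSpace M]
  [ChartedSpace (EuclideanHalfSpace n) M]

theorem chartForm_eq_mulVec (T : Tensor2 n M) (c : M) (y a b : Vec n) :
    chartForm T c y a b = ∑ i, a i * (tensorCoord T c y).mulVec (fun j => b j) i := by
  rw [chartForm, bilin_apply]
  refine Finset.sum_congr rfl fun i _ => ?_
  rw [Matrix.mulVec, dotProduct, Finset.mul_sum]
  exact Finset.sum_congr rfl fun j _ => by simp only [smul_eq_mul]; ring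

/-- The set of coordinates, in the chart at `c`, of interior points. -/
def chartInterior (c : M) : Set (Vec n) :=
  (extChartAt (𝓡∂ n) c).target ∩ interior (Set.range (𝓡∂ n))

theorem chartInterior_mem_nhds {c : M} {y : Vec n} (hy : y ∈ chartInterior c) :
    chartInterior c ∈ 𝓝 y :=
  Filter.inter_mem (target_mem_nhds hy.1 hy.2) (isOpen_interior.mem_nhds hy.2)

theorem contDiffAt_of_contDiffOn_target {F : Type*} [NormedAddCommGroup F] [NormedSpace ℝ F]
    {c : M} {y : Vec n} (hy : y ∈ chartInterior c) {h : Vec n → F} {m : WithTop ℕ∞}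
    (hh : ContDiffOn ℝ m h (extChartAt (𝓡∂ n) c).target) : ContDiffAt ℝ m h y :=
  hh.contDiffAt (target_mem_nhds hy.1 hy.2)

variable [IsManifold (𝓡∂ n) ∞ M] (g : Metric n M)

theorem Metric.isSmooth : Tensor2.IsSmooth (n := n) (M := M) g.inner := g.contMDiff

theorem det_tensorCoord_ne_zero {c : M} {y : Vec n} (hy : y ∈ (extChartAt (𝓡∂ n) c).target) :
    (tensorCoord g.inner c y).det ≠ 0 := by
  intro h
  obtain ⟨v, hv, hv0⟩ := Matrix.exists_mulVec_eq_zero_iff.2 h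
  have h1 : (WithLp.toLp 2 v : Vec n) ≠ 0 := by simpa using hv
  have h2 := chartForm_pos g hy h1
  rw [chartForm_eq_mulVec] at h2
  simp [hv0] at h2

theorem tensorCoord_symm (c : M) (y : Vec n) (i j : Fin n) :
    tensorCoord g.inner c y i j = tensorCoord g.inner c y j i := by
  rw [tensorCoord_eq, chartForm_symm, ← tensorCoord_eq]

theorem contDiffOn_inv_tensorCoord (c : M) (i j : Fin n) :
    ContDiffOn ℝ ∞ (fun y => (tensorCoord g.inner c y)⁻¹ i j) (extChartAt (𝓡∂ n) c).target :=
  contDiffOn_matrix_inv (fun i j => contDiffOn_tensorCoord g.isSmooth c i j)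
    (fun _ hy => det_tensorCoord_ne_zero g hy) i j

theorem contDiffOn_christoffel (c : M) (k i j : Fin n) :
    ContDiffOn ℝ ∞ (christoffel g.inner c k i j) (extChartAt (𝓡∂ n) c).target := by
  have h := fun i j => contDiffOn_tensorCoord (c := c) g.isSmooth i j
  unfold christoffel
  exact contDiffOn_const.mul (ContDiffOn.sum fun l _ =>
    (contDiffOn_inv_tensorCoord g c k l).mul
      (((contDiffOn_pd (h j l) (by simp) i).add (contDiffOn_pd (h i l) (by simp) j)).sub
        (contDiffOn_pd (h i j) (by simp) l)))

theorem contDiffOn_chartForm {T : Tensor2 n M} (hT : T.IsSmooth) (c : M) :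
    ContDiffOn ℝ ∞ (chartForm T c) (extChartAt (𝓡∂ n) c).target :=
  contDiffOn_bilin fun i j => contDiffOn_tensorCoord hT c i j

theorem contDiffOn_chartConn (c : M) :
    ContDiffOn ℝ ∞ (chartConn g.inner c) (extChartAt (𝓡∂ n) c).target :=
  contDiffOn_bilin (A := fun i j y => (WithLp.toLp 2 fun k => christoffel g.inner c k i j y))
    fun i j => contDiffOn_toLp fun k => contDiffOn_christoffel g c k i j

theorem christoffel_symm (c : M) (k i j : Fin n) (y : Vec n) :
    christoffel g.inner c k i j y = christoffel g.inner c k j i y := by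
  unfold christoffel
  congr 1
  refine Finset.sum_congr rfl fun l _ => ?_
  have : (fun z => tensorCoord g.inner c z i j) = fun z => tensorCoord g.inner c z j i := by
    funext z
    exact tensorCoord_symm g c z i j
  rw [this]
  ring

theorem chartConn_symm (c : M) (y a b : Vec n) :
    chartConn g.inner c y a b = chartConn g.inner c y b a := by
  simp only [chartConn, bilin_apply]
  rw [Finset.sum_comm]
  refine Finset.sum_congr rfl fun i _ => Finset.sum_congr rfl fun j _ => ?_
  simp only [christoffel_symm g c _ j i, mul_comm]

theorem fderiv_chartForm_single {T : Tensor2 n M} (hT : T.IsSmooth) {c : M} {y : Vec n}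
    (hy : y ∈ chartInterior c) (l i j : Fin n) :
    fderiv ℝ (chartForm T c) y (EuclideanSpace.single l 1) (EuclideanSpace.single i 1)
      (EuclideanSpace.single j 1) = pd l (fun z => tensorCoord T c z i j) y := by
  have h := fun i j => (contDiffAt_of_contDiffOn_target hy
    (contDiffOn_tensorCoord hT c i j)).differentiableAt (by simp)
  have h1 := fderiv_bilin_apply (A := fun i j z => tensorCoord T c z i j) h
    (EuclideanSpace.single l 1) (EuclideanSpace.single i 1) (EuclideanSpace.single j 1)
  rw [bilin_single] at h1
  rw [pd_eq_fderiv hy.2]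
  exact h1

theorem chartForm_chartConn_single {c : M} {y : Vec n}
    (hy : y ∈ (extChartAt (𝓡∂ n) c).target) (i j l : Fin n) :
    2 * chartForm g.inner c y (chartConn g.inner c y (EuclideanSpace.single i 1)
      (EuclideanSpace.single j 1)) (EuclideanSpace.single l 1) =
    pd i (fun z => tensorCoord g.inner c z j l) y + pd j (fun z => tensorCoord g.inner c z i l) y
      - pd l (fun z => tensorCoord g.inner c z i j) y := by
  set S : Fin n → ℝ := fun m => pd i (fun z => tensorCoord g.inner c z j m) y +
    pd j (fun z => tensorCoord g.inner c z i m) y - pd m (fun z => tensorCoord g.inner c z i j) y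
    with hS
  set G := tensorCoord g.inner c y with hG
  have hu : IsUnit G.det := (det_tensorCoord_ne_zero g hy).isUnit
  have h1 : chartForm g.inner c y (chartConn g.inner c y (EuclideanSpace.single i 1)
      (EuclideanSpace.single j 1)) (EuclideanSpace.single l 1) =
      ∑ k, ((1 / 2) * ∑ m, G⁻¹ k m * S m) * G l k := by
    rw [chartConn, bilin_single, chartForm, bilin_apply]
    refine Finset.sum_congr rfl fun k _ => ?_
    simp only [christoffel, PiLp.single_apply, smul_eq_mul, mul_ite, mul_one, mul_zero, ite_mul,
      zero_mul, Finset.sum_ite_eq', Finset.mem_univ, if_true]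
    rw [tensorCoord_symm g c y k l]
  have h2 : ∑ k, ((1 / 2) * ∑ m, G⁻¹ k m * S m) * G l k =
      (1 / 2) * ((G * G⁻¹).mulVec S) l := by
    rw [← Matrix.mulVec_mulVec]
    simp only [Matrix.mulVec, dotProduct, Finset.mul_sum]
    refine Finset.sum_congr rfl fun k _ => ?_
    rw [Finset.sum_mul]
    exact Finset.sum_congr rfl fun m _ => by ring
  rw [h1, h2, Matrix.mul_nonsing_inv _ hu, Matrix.one_mulVec]
  ring

theorem isLeviCivitaNear_chart {c : M} {y : Vec n} (hy : y ∈ chartInterior c) :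
    IsLeviCivitaNear (chartForm g.inner c) (chartConn g.inner c) y where
  metric_symm := Filter.Eventually.of_forall fun z a b => chartForm_symm g c z a b
  metric_diff := by
    filter_upwards [chartInterior_mem_nhds hy] with z hz
    exact (contDiffAt_of_contDiffOn_target hz
      (contDiffOn_chartForm g.isSmooth c)).differentiableAt (by simp)
  koszul := by
    filter_upwards [chartInterior_mem_nhds hy] with z hz a b c'
    rw [← sub_eq_zero]
    set L := chartForm g.inner c z
    set D := fderiv ℝ (chartForm g.inner c) z
    set Γ := chartConn g.inner c z
    refine linear_eq_zero (Φ := fun a => 2 * L (Γ a b) c' - (D a b c' + D b a c' - D c' a b))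
      ⟨by intros; simp; ring, by intros; simp; ring⟩ (fun i => ?_) a
    refine linear_eq_zero (Φ := fun b => 2 * L (Γ (EuclideanSpace.single i 1) b) c' -
      (D (EuclideanSpace.single i 1) b c' + D b (EuclideanSpace.single i 1) c' -
        D c' (EuclideanSpace.single i 1) b))
      ⟨by intros; simp; ring, by intros; simp; ring⟩ (fun j => ?_) b
    refine linear_eq_zero (Φ := fun c' => 2 * L (Γ (EuclideanSpace.single i 1)
      (EuclideanSpace.single j 1)) c' - (D (EuclideanSpace.single i 1) (EuclideanSpace.single j 1)
        c' + D (EuclideanSpace.single j 1) (EuclideanSpace.single i 1) c' -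
        D c' (EuclideanSpace.single i 1) (EuclideanSpace.single j 1)))
      ⟨by intros; simp; ring, by intros; simp; ring⟩ (fun l => ?_) c'
    simp only [L, D, Γ, fderiv_chartForm_single g.isSmooth hz, chartForm_chartConn_single g hz.1]
    ring
  conn_symm := Filter.Eventually.of_forall fun z a b => chartConn_symm g c z a b
  conn_diff := (contDiffAt_of_contDiffOn_target hy (contDiffOn_chartConn g c)).differentiableAt
    (by simp)

/-- The coordinate Hessian is the Hessian of the local representative. -/
theorem hessCoord_eq_covHess {c : M} {y : Vec n} (hy : y ∈ chartInterior c) {u : M → ℝ}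
    (hu : ContDiffAt ℝ 2 (fun w => u ((extChartAt (𝓡∂ n) c).symm w)) y) (i j : Fin n) :
    hessCoord g.inner c u y i j = covHess (chartConn g.inner c)
      (fun w => u ((extChartAt (𝓡∂ n) c).symm w)) y (EuclideanSpace.single i 1)
      (EuclideanSpace.single j 1) := by
  set U : Vec n → ℝ := fun w => u ((extChartAt (𝓡∂ n) c).symm w) with hU
  have hd := (eventually_differentiableAt_fderiv hu).self_of_nhds
  have h1 : pd i (fun z => pd j U z) y =
      fderiv ℝ (fderiv ℝ U) y (EuclideanSpace.single i 1) (EuclideanSpace.single j 1) := by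
    rw [pd_eq_fderiv hy.2]
    have h2 : (fun z => pd j U z) =ᶠ[𝓝 y] fun z => fderiv ℝ U z (EuclideanSpace.single j 1) := by
      filter_upwards [chartInterior_mem_nhds hy] with z hz
      exact pd_eq_fderiv hz.2 j U
    rw [h2.fderiv_eq]
    have h3 := hd.2.1.hasFDerivAt.clm_apply (hasFDerivAt_const (EuclideanSpace.single j (1 : ℝ)) y)
    rw [h3.fderiv]
    simp
  simp only [hessCoord, covHess, Matrix.of_apply]
  rw [← h1, chartConn, bilin_single]
  congr 1
  rw [vec_eq_sum_single (WithLp.toLp 2 fun k => christoffel g.inner c k i j y)]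
  simp only [map_sum, map_smul, smul_eq_mul, pd_eq_fderiv hy.2]
  rfl

theorem bilin_hessCoord {c : M} {y : Vec n} (hy : y ∈ chartInterior c) {u : M → ℝ}
    (hu : ContDiffAt ℝ 2 (fun w => u ((extChartAt (𝓡∂ n) c).symm w)) y) (a b : Vec n) :
    bilin (fun i j => hessCoord g.inner c u y i j) a b = covHess (chartConn g.inner c)
      (fun w => u ((extChartAt (𝓡∂ n) c).symm w)) y a b := by
  rw [← sub_eq_zero]
  refine linear_eq_zero (Φ := fun a => bilin (fun i j => hessCoord g.inner c u y i j) a b -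
    covHess (chartConn g.inner c) (fun w => u ((extChartAt (𝓡∂ n) c).symm w)) y a b)
    ⟨by intros; simp [covHess]; ring, by intros; simp [covHess]; ring⟩ (fun i => ?_) a
  refine linear_eq_zero (Φ := fun b => bilin (fun i j => hessCoord g.inner c u y i j)
    (EuclideanSpace.single i 1) b - covHess (chartConn g.inner c)
    (fun w => u ((extChartAt (𝓡∂ n) c).symm w)) y (EuclideanSpace.single i 1) b)
    ⟨by intros; simp [covHess]; ring, by intros; simp [covHess]; ring⟩ (fun j => ?_) b
  simp only [bilin_single, hessCoord_eq_covHess g hy hu, sub_self]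

end ChartGeometry

/-! ### Curvature in a chart. -/

section ChartCurvature

variable {n : ℕ} [NeZero n] {M : Type*} [TopologicalSpace M]
  [ChartedSpace (EuclideanHalfSpace n) M] [IsManifold (𝓡∂ n) ∞ M] (g : Metric n M)

theorem chartConn_single_apply (c : M) (y v : Vec n) (i l : Fin n) :
    chartConn g.inner c y (EuclideanSpace.single i 1) v l =
      ∑ m, v m * christoffel g.inner c l i m y := by
  simp [chartConn, bilin_apply]

theorem fderiv_chartConn_single {c : M} {y : Vec n} (hy : y ∈ chartInterior c)
    (i j k l : Fin n) :
    fderiv ℝ (chartConn g.inner c) y (EuclideanSpace.single i 1) (EuclideanSpace.single j 1)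
      (EuclideanSpace.single k 1) l = pd i (christoffel g.inner c l j k) y := by
  have h : ∀ i j, DifferentiableAt ℝ
      (fun z => (WithLp.toLp 2 fun k => christoffel g.inner c k i j z : Vec n)) y := fun i j =>
    (contDiffAt_of_contDiffOn_target hy
      (contDiffOn_toLp fun k => contDiffOn_christoffel g c k i j)).differentiableAt (by simp)
  have h1 := fderiv_bilin_apply h (EuclideanSpace.single i 1) (EuclideanSpace.single j 1)
    (EuclideanSpace.single k 1)
  rw [bilin_single] at h1
  rw [pd_eq_fderiv hy.2]
  have h2 : HasFDerivAt (christoffel g.inner c l j k) _ y :=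
    (EuclideanSpace.proj l : Vec n →L[ℝ] ℝ).hasFDerivAt.comp y (h j k).hasFDerivAt
  rw [h2.fderiv]
  exact congrArg (fun v : Vec n => v l) h1

theorem sum_rotate {ι : Type*} [Fintype ι] (C : ι → ι → ι → ι → ℝ) :
    ∑ i, ∑ j, ∑ k, ∑ l, C i j k l = ∑ l, ∑ i, ∑ j, ∑ k, C i j k l :=
  calc _ = ∑ i, ∑ j, ∑ l, ∑ k, C i j k l :=
        Finset.sum_congr rfl fun _ _ => Finset.sum_congr rfl fun _ _ => Finset.sum_comm
    _ = ∑ i, ∑ l, ∑ j, ∑ k, C i j k l := Finset.sum_congr rfl fun _ _ => Finset.sum_comm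
    _ = _ := Finset.sum_comm

theorem curvVec_apply {c : M} {y : Vec n} (hy : y ∈ chartInterior c) (X Y : Vec n) (l : Fin n) :
    curvVec (chartConn g.inner c) y X Y l =
      ∑ i, ∑ j, ∑ k, curvCoord g.inner c l i j k y * X i * Y j * Y k := by
  set Γ := chartConn g.inner c with hΓ
  set D := fderiv ℝ Γ y with hD
  -- The expression is quadratic in `Y`. Splitting the repeated argument into `Y` and `Z` makes it
  -- trilinear, so that coordinate vectors suffice.
  suffices h : ∀ X Y Z : Vec n, (D X Y Z - D Y X Z + Γ y X (Γ y Y Z) - Γ y Y (Γ y X Z)) l -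
      ∑ i, ∑ j, ∑ k, curvCoord g.inner c l i j k y * X i * Y j * Z k = 0 from
    sub_eq_zero.1 (h X Y Y)
  clear X Y
  have hadd : ∀ (a b : Fin n → Fin n → Fin n → ℝ), ∑ i, ∑ j, ∑ k, (a i j k + b i j k) =
      ∑ i, ∑ j, ∑ k, a i j k + ∑ i, ∑ j, ∑ k, b i j k := by
    intros
    simp only [Finset.sum_add_distrib]
  have hsmul : ∀ (t : ℝ) (a : Fin n → Fin n → Fin n → ℝ), ∑ i, ∑ j, ∑ k, t * a i j k =
      t * ∑ i, ∑ j, ∑ k, a i j k := by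
    intros
    simp only [Finset.mul_sum]
  intro X Y Z
  refine linear_eq_zero (Φ := fun X : Vec n => (D X Y Z - D Y X Z + Γ y X (Γ y Y Z) -
    Γ y Y (Γ y X Z)) l - ∑ i, ∑ j, ∑ k, curvCoord g.inner c l i j k y * X i * Y j * Z k)
    ⟨fun a b => ?_, fun t a => ?_⟩ (fun i => ?_) X
  · simp only [map_add, _root_.add_apply, PiLp.add_apply, PiLp.sub_apply, mul_add, add_mul, hadd]
    ring
  · simp only [map_smul, _root_.smul_apply, PiLp.add_apply, PiLp.sub_apply, PiLp.smul_apply,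
      smul_eq_mul, mul_sub]
    rw [← hsmul]
    simp only [mul_add, mul_left_comm t, mul_assoc]
    ring
  set X := EuclideanSpace.single i (1 : ℝ) with hX
  refine linear_eq_zero (Φ := fun Y : Vec n => (D X Y Z - D Y X Z + Γ y X (Γ y Y Z) -
    Γ y Y (Γ y X Z)) l - ∑ i, ∑ j, ∑ k, curvCoord g.inner c l i j k y * X i * Y j * Z k)
    ⟨fun a b => ?_, fun t a => ?_⟩ (fun j => ?_) Y
  · simp only [map_add, _root_.add_apply, PiLp.add_apply, PiLp.sub_apply, mul_add, add_mul, hadd]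
    ring
  · simp only [map_smul, _root_.smul_apply, PiLp.add_apply, PiLp.sub_apply, PiLp.smul_apply,
      smul_eq_mul, mul_sub]
    rw [← hsmul]
    simp only [mul_add, mul_left_comm t, mul_assoc]
    ring
  set Y := EuclideanSpace.single j (1 : ℝ) with hY
  refine linear_eq_zero (Φ := fun Z : Vec n => (D X Y Z - D Y X Z + Γ y X (Γ y Y Z) -
    Γ y Y (Γ y X Z)) l - ∑ i, ∑ j, ∑ k, curvCoord g.inner c l i j k y * X i * Y j * Z k)
    ⟨fun a b => ?_, fun t a => ?_⟩ (fun k => ?_) Z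
  · simp only [map_add, PiLp.add_apply, PiLp.sub_apply, mul_add, hadd]
    ring
  · simp only [map_smul, PiLp.add_apply, PiLp.sub_apply, PiLp.smul_apply,
      smul_eq_mul, mul_sub]
    rw [← hsmul]
    simp only [mul_add, mul_left_comm t, mul_assoc]
    ring
  have hsum : ∑ i', ∑ j', ∑ k', curvCoord g.inner c l i' j' k' y * X i' * Y j' *
      (EuclideanSpace.single k (1 : ℝ) : Vec n) k' = curvCoord g.inner c l i j k y := by
    simp [hX, hY, PiLp.single_apply]
  rw [hsum]
  have hcomp : ∀ j k m, chartConn g.inner c y (EuclideanSpace.single j 1)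
      (EuclideanSpace.single k 1) m = christoffel g.inner c m j k y := by
    intro j k m
    rw [chartConn, bilin_single]
  simp only [PiLp.add_apply, PiLp.sub_apply, hX, hY, hD, hΓ, fderiv_chartConn_single g hy,
    chartConn_single_apply, hcomp, curvCoord, Finset.sum_sub_distrib]
  ring

theorem NonnegSectionalCurvature.inner_curvVec_nonneg
    (h : NonnegSectionalCurvature (n := n) (M := M) g.inner) {c : M} {y : Vec n}
    (hy : y ∈ chartInterior c) (X Y : Vec n) :
    0 ≤ chartForm g.inner c y (curvVec (chartConn g.inner c) y X Y) X := by
  have h1 := h c y hy.1 (fun i => X i) (fun i => Y i)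
  convert h1 using 1
  rw [sum_rotate]
  simp only [fun l => sum_rotate fun i j k p => tensorCoord g.inner c y l p *
    curvCoord g.inner c l i j k y * X i * Y j * Y k * X p]
  rw [chartForm, bilin_apply]
  refine Finset.sum_congr rfl fun l _ => Finset.sum_congr rfl fun p _ => ?_
  rw [curvVec_apply g hy, smul_eq_mul]
  simp only [Finset.sum_mul]
  refine Finset.sum_congr rfl fun i _ => Finset.sum_congr rfl fun j _ =>
    Finset.sum_congr rfl fun k _ => by ring

end ChartCurvature

/-! ### Gradient and interior points in a chart. -/

section ChartGradient

variable {n : ℕ} [NeZero n] {M : Type*} [TopologicalSpace M]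
  [ChartedSpace (EuclideanHalfSpace n) M]

/-- The representative of a function in the chart at `c`. -/
def chartFun (c : M) (u : M → ℝ) (y : Vec n) : ℝ := u ((extChartAt (𝓡∂ n) c).symm y)

/-- The gradient in the chart at `c`. -/
def chartGrad (g : Tensor2 n M) (c : M) (u : M → ℝ) (y : Vec n) : Vec n :=
  WithLp.toLp 2 fun k => ∑ l, (tensorCoord g c y)⁻¹ k l * pd l (chartFun c u) y

variable [IsManifold (𝓡∂ n) ∞ M] (g : Metric n M)

theorem contDiffOn_chartFun {u : M → ℝ} {m : ℕ∞} (hu : ContMDiff (𝓡∂ n) 𝓘(ℝ, ℝ) m u) (c : M) :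
    ContDiffOn ℝ m (chartFun c u) (extChartAt (𝓡∂ n) c).target := by
  rw [← contMDiffOn_iff_contDiffOn]
  exact hu.comp_contMDiffOn
    ((contMDiffOn_extChartAt_symm (n := ∞) c).of_le (by exact_mod_cast le_top))

theorem contDiffOn_chartGrad {u : M → ℝ} (hu : ContMDiff (𝓡∂ n) 𝓘(ℝ, ℝ) 3 u) (c : M) :
    ContDiffOn ℝ 2 (chartGrad g.inner c u) (extChartAt (𝓡∂ n) c).target :=
  contDiffOn_toLp fun k => ContDiffOn.sum fun l _ =>
    ((contDiffOn_inv_tensorCoord g c k l).of_le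
      (mod_cast le_top : ((2 : ℕ∞) : WithTop ℕ∞) ≤ ∞)).mul
      (contDiffOn_pd (contDiffOn_chartFun (m := 3) hu c) (by norm_num) l)

theorem chartForm_chartGrad {u : M → ℝ} {c : M} {y : Vec n}
    (hy : y ∈ (extChartAt (𝓡∂ n) c).target) (b : Vec n) :
    chartForm g.inner c y (chartGrad g.inner c u y) b =
      fderivWithin ℝ (chartFun c u) (Set.range (𝓡∂ n)) y b := by
  have hu : IsUnit (tensorCoord g.inner c y).det := (det_tensorCoord_ne_zero g hy).isUnit
  have h1 : chartForm g.inner c y b (chartGrad g.inner c u y) =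
      ∑ i, b i * pd i (chartFun c u) y := by
    rw [chartForm_eq_mulVec]
    refine Finset.sum_congr rfl fun i _ => ?_
    have : (fun j => chartGrad g.inner c u y j) =
        ((tensorCoord g.inner c y)⁻¹).mulVec fun l => pd l (chartFun c u) y := by
      funext k
      simp [chartGrad, Matrix.mulVec, dotProduct]
    rw [this, Matrix.mulVec_mulVec, Matrix.mul_nonsing_inv _ hu, Matrix.one_mulVec]
  rw [chartForm_symm, h1]
  conv_rhs => rw [vec_eq_sum_single b]
  simp only [map_sum, map_smul, smul_eq_mul, pd]

theorem inner_gradient (u : M → ℝ) (x : M) (w : TangentSpace (𝓡∂ n) x) :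
    g.inner x (gradient g u x) w = mfderiv (𝓡∂ n) 𝓘(ℝ, ℝ) u x w := by
  have h := LinearEquiv.apply_symm_apply
    ((metricForm g x).toDual (metricForm_nondegenerate g x))
    (mfderiv (𝓡∂ n) 𝓘(ℝ, ℝ) u x).toLinearMap
  exact LinearMap.congr_fun h w

theorem fderivWithin_chartFun {u : M → ℝ} (hu : MDifferentiable (𝓡∂ n) 𝓘(ℝ, ℝ) u) {c : M}
    {y : Vec n} (hy : y ∈ (extChartAt (𝓡∂ n) c).target) (a : Vec n) :
    fderivWithin ℝ (chartFun c u) (Set.range (𝓡∂ n)) y a =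
      mfderiv (𝓡∂ n) 𝓘(ℝ, ℝ) u ((extChartAt (𝓡∂ n) c).symm y) (coordMap c y a) := by
  have h1 := mdifferentiableWithinAt_extChartAt_symm hy
  have hU : UniqueMDiffWithinAt 𝓘(ℝ, Vec n) (Set.range (𝓡∂ n)) y :=
    ((𝓡∂ n).uniqueDiffOn _ (extChartAt_target_subset_range c hy)).uniqueMDiffWithinAt
  have h2 := mfderiv_comp_mfderivWithin y (hu ((extChartAt (𝓡∂ n) c).symm y)) h1 hU
  rw [← mfderivWithin_eq_fderivWithin]
  exact DFunLike.congr_fun h2 a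

/-- `|∇u|²` in coordinates. -/
theorem gradNorm_sq {u : M → ℝ} (hu : MDifferentiable (𝓡∂ n) 𝓘(ℝ, ℝ) u) {c : M} {y : Vec n}
    (hy : y ∈ (extChartAt (𝓡∂ n) c).target) :
    gradNorm g u ((extChartAt (𝓡∂ n) c).symm y) ^ 2 =
      fderivWithin ℝ (chartFun c u) (Set.range (𝓡∂ n)) y (chartGrad g.inner c u y) := by
  set x := (extChartAt (𝓡∂ n) c).symm y with hx
  have h1 : coordMap c y (chartGrad g.inner c u y) = gradient g u x := by
    refine ((metricForm g x).toDual (metricForm_nondegenerate g x)).injective ?_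
    ext w
    obtain ⟨b, rfl⟩ := (coordMap_bijective hy).2 w
    rw [LinearMap.BilinForm.toDual_def, LinearMap.BilinForm.toDual_def]
    change g.inner x _ _ = g.inner x _ _
    rw [inner_gradient, ← fderivWithin_chartFun hu hy, ← chartForm_chartGrad g hy, chartForm_apply]
  have hpos : 0 ≤ g.inner x (gradient g u x) (gradient g u x) := by
    by_cases h : gradient g u x = 0
    · simp [h]
    · exact (g.pos x _ h).le
  rw [gradNorm, Real.sq_sqrt hpos, inner_gradient, fderivWithin_chartFun hu hy, h1]

/-- Being interior does not depend on the chart, so the chart at a fixed `c` can serve all nearby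
maximum points; this keeps the constants uniform. -/
theorem mem_chartInterior_iff {c : M} {y : Vec n} (hy : y ∈ (extChartAt (𝓡∂ n) c).target) :
    y ∈ chartInterior c ↔ (𝓡∂ n).IsInteriorPoint ((extChartAt (𝓡∂ n) c).symm y) := by
  have hx : (extChartAt (𝓡∂ n) c).symm y ∈ (chartAt (EuclideanHalfSpace n) c).source := by
    simpa using (extChartAt (𝓡∂ n) c).map_target hy
  rw [ModelWithCorners.isInteriorPoint_iff_of_mem_atlas (n := ∞) (by simp)
    (chart_mem_atlas (EuclideanHalfSpace n) c) hx]
  have : ((chartAt (EuclideanHalfSpace n) c).extend (𝓡∂ n)) ((extChartAt (𝓡∂ n) c).symm y) = y :=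
    (extChartAt (𝓡∂ n) c).right_inv hy
  rw [this]
  change _ ↔ y ∈ interior (extChartAt (𝓡∂ n) c).target
  constructor
  · intro h
    exact mem_interior_iff_mem_nhds.2 (target_mem_nhds h.1 h.2)
  · intro h
    exact ⟨hy, interior_mono (extChartAt_target_subset_range c) h⟩

theorem IsAdmissibleSolution.exists_chart {χ : Tensor2 n M} {Γ : Set (Vec n)} {f : Vec n → ℝ}
    {ψ : M → ℝ → ℝ} {u : M → ℝ} (h : IsAdmissibleSolution g.inner χ Γ f ψ u) {c : M} {y : Vec n}
    (hy : y ∈ chartInterior c) :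
    ∃ lam ∈ Γ, IsEigenvalues (tensorCoord g.inner c y)
      (hessCoord g.inner c u y + tensorCoord χ c y) lam ∧
      f lam = ψ ((extChartAt (𝓡∂ n) c).symm y) (chartFun c u y) := by
  have hx : (extChartAt (𝓡∂ n) c).symm y ∈ (chartAt (EuclideanHalfSpace n) c).source := by
    simpa using (extChartAt (𝓡∂ n) c).map_target hy.1
  obtain ⟨lam, h1, h2, h3⟩ := h c _ hx ((mem_chartInterior_iff hy.1).1 hy)
  rw [IsHessEigenvalues, (extChartAt (𝓡∂ n) c).right_inv hy.1] at h2
  exact ⟨lam, h1, h2, h3⟩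

end ChartGradient

/-! ### Orthonormal frames. -/

section Frame

variable {n : ℕ}

theorem bilin_eq_of_linear {Φ : Vec n → Vec n → ℝ} (h1 : ∀ b, IsLinearMap ℝ fun a => Φ a b)
    (h2 : ∀ a, IsLinearMap ℝ (Φ a)) (a b : Vec n) :
    bilin (fun i j => Φ (EuclideanSpace.single i 1) (EuclideanSpace.single j 1)) a b = Φ a b := by
  have e1 : Φ a b = (h1 b).mk' _ a := rfl
  rw [e1, vec_eq_sum_single a, bilin_apply]
  simp only [map_sum, map_smul, IsLinearMap.mk'_apply]
  simp only [← vec_eq_sum_single a]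
  refine Finset.sum_congr rfl fun i _ => ?_
  have e2 : Φ (EuclideanSpace.single i 1) b = (h2 (EuclideanSpace.single i 1)).mk' _ b := rfl
  rw [e2, vec_eq_sum_single b]
  simp only [map_sum, map_smul, IsLinearMap.mk'_apply, smul_eq_mul, Finset.mul_sum]
  simp only [← vec_eq_sum_single b, mul_assoc]

theorem covHess_line_hasDerivAt {Γc : Vec n → Vec n →L[ℝ] Vec n →L[ℝ] Vec n} {U : Vec n → ℝ}
    {y : Vec n}
    (hΓ : DifferentiableAt ℝ Γc y) (hU : ContDiffAt ℝ 3 U y) (X a b : Vec n) :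
    HasDerivAt (fun t : ℝ => covHess Γc U (y + t • X) a b)
      (fderiv ℝ (fderiv ℝ (fderiv ℝ U)) y X a b - fderiv ℝ (fderiv ℝ U) y X (Γc y a b)
        - fderiv ℝ U y (fderiv ℝ Γc y X a b)) 0 := by
  have hU' : ContDiffAt ℝ 2 (fderiv ℝ U) y := hU.fderiv_right (by norm_num)
  have hU'' : DifferentiableAt ℝ (fderiv ℝ (fderiv ℝ U)) y :=
    (hU'.fderiv_right (m := 1) (by norm_num)).differentiableAt (by simp)
  have e1 := (hU''.hasFDerivAt.clm_apply (hasFDerivAt_const a y)).clm_apply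
    (hasFDerivAt_const b y)
  have e2 := (hΓ.hasFDerivAt.clm_apply (hasFDerivAt_const a y)).clm_apply (hasFDerivAt_const b y)
  have e3 := (hU'.differentiableAt (by simp)).hasFDerivAt.clm_apply e2
  refine (hasDerivAt_line (e1.sub e3) X).congr_deriv ?_
  simp
  ring

/-- The columns of `P` as vectors. -/
def frameOf (P : Matrix (Fin n) (Fin n) ℝ) (i : Fin n) : Vec n := WithLp.toLp 2 fun k => P k i

/-- `e` is an orthonormal frame with respect to `G`. -/
def IsFrame (G : Vec n →L[ℝ] Vec n →L[ℝ] ℝ) (e : Fin n → Vec n) : Prop :=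
  ∀ i j, G (e i) (e j) = if i = j then 1 else 0

variable [NeZero n] {M : Type*} [TopologicalSpace M] [ChartedSpace (EuclideanHalfSpace n) M]

theorem isFrame_frameOf (T : Tensor2 n M) (c : M) (y : Vec n) (P : Matrix (Fin n) (Fin n) ℝ) :
    IsFrame (chartForm T c y) (frameOf P) ↔ P.transpose * tensorCoord T c y * P = 1 := by
  have h : ∀ i j, chartForm T c y (frameOf P i) (frameOf P j) =
      (P.transpose * tensorCoord T c y * P) i j := fun i j => bilin_eq_matrix _ P i j
  simp only [IsFrame, h]
  constructor
  · intro h'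
    ext i j
    rw [h' i j, Matrix.one_apply]
  · intro h' i j
    rw [h', Matrix.one_apply]

variable [IsManifold (𝓡∂ n) ∞ M]

theorem IsFrame.expand {g : Metric n M} {c : M} {y : Vec n} {e : Fin n → Vec n}
    (he : IsFrame (chartForm g.inner c y) e) (a : Vec n) :
    a = ∑ i, chartForm g.inner c y a (e i) • e i := by
  set P : Matrix (Fin n) (Fin n) ℝ := Matrix.of fun k i => e i k with hP
  have heP : e = frameOf P := rfl
  rw [heP, isFrame_frameOf] at he
  have h2 : P * (P.transpose * tensorCoord g.inner c y) = 1 := mul_eq_one_comm.mp he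
  have h3 : ∀ i, chartForm g.inner c y a (e i) =
      (P.transpose * tensorCoord g.inner c y).mulVec (fun j => a j) i := by
    intro i
    rw [chartForm_symm, chartForm_eq_mulVec, ← Matrix.mulVec_mulVec]
    rfl
  ext k
  have h4 : (P * (P.transpose * tensorCoord g.inner c y)).mulVec (fun j => a j) k = a k := by
    rw [h2, Matrix.one_mulVec]
  rw [← Matrix.mulVec_mulVec] at h4
  rw [← h4]
  simp only [h3, Matrix.mulVec, dotProduct, WithLp.ofLp_sum, WithLp.ofLp_smul, Finset.sum_apply,
    Pi.smul_apply, smul_eq_mul]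
  exact Finset.sum_congr rfl fun i _ => mul_comm _ _

theorem IsFrame.apply_eq_sum {g : Metric n M} {c : M} {y : Vec n} {e : Fin n → Vec n}
    (he : IsFrame (chartForm g.inner c y) e) (a b : Vec n) :
    chartForm g.inner c y a b =
      ∑ i, chartForm g.inner c y a (e i) * chartForm g.inner c y b (e i) := by
  conv_lhs => rw [he.expand b]
  simp only [map_sum, map_smul, smul_eq_mul]
  exact Finset.sum_congr rfl fun i _ => mul_comm _ _

end Frame

/-! ### The differentiated equation and the conditions at a maximum point. -/

section Equation

variable {n : ℕ} [NeZero n] {M : Type*} [TopologicalSpace M]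
  [ChartedSpace (EuclideanHalfSpace n) M] [IsManifold (𝓡∂ n) ∞ M] {g : Metric n M}
  {χ : Tensor2 n M} {Γ : Set (Vec n)} {f : Vec n → ℝ} {ψ : M → ℝ → ℝ} {u : M → ℝ} {c : M}
  {y : Vec n}

/-- The right-hand side `ψ` in the chart at `c`. -/
def chartRhs (ψ : M → ℝ → ℝ) (c : M) (p : Vec n × ℝ) : ℝ :=
  ψ ((extChartAt (𝓡∂ n) c).symm p.1) p.2

theorem contDiffOn_chartRhs
    (hψ : ContMDiff ((𝓡∂ n).prod 𝓘(ℝ, ℝ)) 𝓘(ℝ, ℝ) 1 (fun p : M × ℝ => ψ p.1 p.2)) (c : M) :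
    ContDiffOn ℝ 1 (chartRhs ψ c) ((extChartAt (𝓡∂ n) c).target ×ˢ Set.univ) := by
  rw [← contMDiffOn_iff_contDiffOn]
  have h1 : ContMDiffOn 𝓘(ℝ, Vec n × ℝ) (𝓡∂ n) 1
      (fun p : Vec n × ℝ => (extChartAt (𝓡∂ n) c).symm p.1)
      ((extChartAt (𝓡∂ n) c).target ×ˢ Set.univ) :=
    (contMDiffOn_extChartAt_symm (n := 1) c).comp contDiff_fst.contMDiff.contMDiffOn
      fun p hp => hp.1
  have h2 : ContMDiffOn 𝓘(ℝ, Vec n × ℝ) 𝓘(ℝ, ℝ) 1 (fun p : Vec n × ℝ => p.2)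
      ((extChartAt (𝓡∂ n) c).target ×ˢ Set.univ) := contDiff_snd.contMDiff.contMDiffOn
  exact hψ.comp_contMDiffOn (h1.prodMk h2)

/-- The equation differentiated in the direction `X`. -/
theorem StructureConditions.linearized_equation (hf : StructureConditions Γ f)
    (hχ : Tensor2.IsSmooth χ) (hu : ContMDiff (𝓡∂ n) 𝓘(ℝ, ℝ) 3 u)
    (hψ : ContMDiff ((𝓡∂ n).prod 𝓘(ℝ, ℝ)) 𝓘(ℝ, ℝ) 1 (fun p : M × ℝ => ψ p.1 p.2))
    (hadm : IsAdmissibleSolution g.inner χ Γ f ψ u) (hy : y ∈ chartInterior c)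
    {lam : Vec n} (hl : lam ∈ Γ) {P : Matrix (Fin n) (Fin n) ℝ}
    (hP1 : P.transpose * tensorCoord g.inner c y * P = 1)
    (hP2 : P.transpose * (hessCoord g.inner c u y + tensorCoord χ c y) * P =
      Matrix.diagonal fun i => lam i)
    (hfl : f lam = ψ ((extChartAt (𝓡∂ n) c).symm y) (chartFun c u y)) (X : Vec n) :
    fderiv ℝ (chartRhs ψ c) (y, chartFun c u y) (X, fderiv ℝ (chartFun c u) y X) =
      ∑ i, fpart f i lam * (dCovHess (chartConn g.inner c) (chartFun c u) y X (frameOf P i) +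
        fderiv ℝ (chartForm χ c) y X (frameOf P i) (frameOf P i) -
        lam i * fderiv ℝ (chartForm g.inner c) y X (frameOf P i) (frameOf P i)) := by
  have hU : ContDiffAt ℝ 3 (chartFun c u) y :=
    contDiffAt_of_contDiffOn_target hy (contDiffOn_chartFun (m := 3) hu c)
  have hnhds := chartInterior_mem_nhds hy
  have hform : ∀ {T : Tensor2 n M}, T.IsSmooth → ∀ a b, HasDerivAt
      (fun t : ℝ => chartForm T c (y + t • X) a b) (fderiv ℝ (chartForm T c) y X a b) 0 := by
    intro T hT a b
    have hd := (contDiffAt_of_contDiffOn_target hy (contDiffOn_chartForm hT c)).differentiableAt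
      (by simp)
    refine (hasDerivAt_line ((hd.hasFDerivAt.clm_apply (hasFDerivAt_const a y)).clm_apply
      (hasFDerivAt_const b y)) X).congr_deriv ?_
    simp
  have hrhs : HasDerivAt (fun t : ℝ => ψ ((extChartAt (𝓡∂ n) c).symm (y + t • X))
      (chartFun c u (y + t • X)))
      (fderiv ℝ (chartRhs ψ c) (y, chartFun c u y) (X, fderiv ℝ (chartFun c u) y X)) 0 := by
    have h1 : DifferentiableAt ℝ (chartRhs ψ c) (y, chartFun c u y) :=
      ((contDiffOn_chartRhs hψ c).contDiffAt (prod_mem_nhds (target_mem_nhds hy.1 hy.2)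
        Filter.univ_mem)).differentiableAt (by simp)
    have h2 : HasFDerivAt (fun z => (z, chartFun c u z)) _ y :=
      (hasFDerivAt_id y).prodMk (hU.differentiableAt (by simp)).hasFDerivAt
    refine (hasDerivAt_line (h1.hasFDerivAt.comp y h2) X).congr_deriv ?_
    simp
  have hhess : ∀ i j, HasDerivAt (fun t : ℝ => hessCoord g.inner c u (y + t • X) i j) _ 0 :=
    fun i j => (covHess_line_hasDerivAt (isLeviCivitaNear_chart g hy).conn_diff hU X
      (EuclideanSpace.single i 1) (EuclideanSpace.single j 1)).congr_of_eventuallyEq (by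
        filter_upwards [(tendsto_line y X).eventually hnhds] with t ht
        exact hessCoord_eq_covHess g ht ((contDiffAt_of_contDiffOn_target ht
          (contDiffOn_chartFun (m := 3) hu c)).of_le (by norm_num)) i j)
  have key := hf.deriv_eq_of_isEigenvalues
    (G := fun t => tensorCoord g.inner c (y + t • X))
    (U := fun t => hessCoord g.inner c u (y + t • X) + tensorCoord χ c (y + t • X))
    (G' := Matrix.of fun i j => fderiv ℝ (chartForm g.inner c) y X (EuclideanSpace.single i 1)
      (EuclideanSpace.single j 1))
    (U' := Matrix.of fun i j => _ + fderiv ℝ (chartForm χ c) y X (EuclideanSpace.single i 1)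
      (EuclideanSpace.single j 1)) (P := P) (lam := lam)
    (fun i j => by
      simp only [tensorCoord_eq, Matrix.of_apply]
      exact hform g.isSmooth _ _)
    (fun i j => by
      simp only [tensorCoord_eq, Matrix.add_apply, Matrix.of_apply]
      exact (hhess i j).fun_add (hform hχ _ _))
    hrhs (by simpa using hP1) (by simpa using hP2)
    (Filter.Eventually.of_forall fun t => by
      ext i j
      exact tensorCoord_symm g c _ j i) hl (by simpa using hfl) (by
      filter_upwards [(tendsto_line y X).eventually hnhds] with t ht
      exact hadm.exists_chart g ht)
  rw [key]
  refine Finset.sum_congr rfl fun i _ => ?_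
  rw [← bilin_eq_matrix, ← bilin_eq_matrix]
  simp only [Matrix.of_apply]
  rw [bilin_eq_of_linear (Φ := fun a b => fderiv ℝ (chartForm g.inner c) y X a b)
    (fun b => ⟨by intros; simp, by intros; simp⟩) (fun a => ⟨by intros; simp, by intros; simp⟩),
    bilin_eq_of_linear (Φ := fun a b => fderiv ℝ (fderiv ℝ (fderiv ℝ (chartFun c u))) y X a b -
      fderiv ℝ (fderiv ℝ (chartFun c u)) y X (chartConn g.inner c y a b) -
      fderiv ℝ (chartFun c u) y (fderiv ℝ (chartConn g.inner c) y X a b) +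
      fderiv ℝ (chartForm χ c) y X a b)
    (fun b => ⟨by intros; simp; ring, by intros; simp; ring⟩)
    (fun a => ⟨by intros; simp; ring, by intros; simp; ring⟩)]
  rfl

/-- The quadratic form of `U = ∇²u + χ` in the chart. -/
theorem covHess_add_chartForm (χ : Tensor2 n M)
    (hU : ContDiffAt ℝ 2 (chartFun c u) y) (hy : y ∈ chartInterior c)
    (P : Matrix (Fin n) (Fin n) ℝ) (i j : Fin n) :
    covHess (chartConn g.inner c) (chartFun c u) y (frameOf P i) (frameOf P j) +
      chartForm χ c y (frameOf P i) (frameOf P j) =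
      (P.transpose * (hessCoord g.inner c u y + tensorCoord χ c y) * P) i j := by
  rw [← bilin_eq_matrix, bilin_apply]
  have h1 := bilin_hessCoord g hy hU (frameOf P i) (frameOf P j)
  change _ = covHess (chartConn g.inner c) (chartFun c u) y (frameOf P i) (frameOf P j) at h1
  rw [← h1, chartForm, bilin_apply, bilin_apply, ← Finset.sum_add_distrib]
  refine Finset.sum_congr rfl fun k _ => ?_
  rw [← Finset.sum_add_distrib]
  refine Finset.sum_congr rfl fun l _ => ?_
  simp only [Matrix.add_apply, smul_eq_mul]
  change _ = P k i * P l j * _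
  change P k i * P l j * _ + P k i * P l j * _ = _
  ring

/-- What is known at an interior maximum, with coordinates `y` in the chart at `c`, of
`|∇u| / (K - exp s)`: there is a frame `e` diagonalizing `∇²u + χ`, with eigenvalues `λ`, for which
the first and the second order condition take the following form. -/
structure MaxData (g : Metric n M) (χ : Tensor2 n M) (Γ : Set (Vec n)) (f : Vec n → ℝ)
    (ψ : M → ℝ → ℝ) (u s : M → ℝ) (K : ℝ) (c : M) (y : Vec n) (e : Fin n → Vec n)
    (lam : Vec n) : Prop where
  frame : IsFrame (chartForm g.inner c y) e
  mem : lam ∈ Γ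
  eq : f lam = ψ ((extChartAt (𝓡∂ n) c).symm y) (chartFun c u y)
  diag : ∀ i w, covHess (chartConn g.inner c) (chartFun c u) y (e i) w + chartForm χ c y (e i) w =
    lam i * chartForm g.inner c y (e i) w
  first : ∀ a, covHess (chartConn g.inner c) (chartFun c u) y a (chartGrad g.inner c u y) =
    -(gradNorm g u ((extChartAt (𝓡∂ n) c).symm y) ^ 2 / (K - Real.exp (chartFun c s y)) *
      Real.exp (chartFun c s y) * fderiv ℝ (chartFun c s) y a)
  second : fderiv ℝ (chartRhs ψ c) (y, chartFun c u y) (chartGrad g.inner c u y,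
        fderiv ℝ (chartFun c u) y (chartGrad g.inner c u y)) -
      ∑ i, fpart f i lam * (fderiv ℝ (chartForm χ c) y (chartGrad g.inner c u y) (e i) (e i) -
        2 * chartForm χ c y (e i) (chartConn g.inner c y (e i) (chartGrad g.inner c u y))) +
      ∑ i, fpart f i lam * chartForm g.inner c y (curvVec (chartConn g.inner c) y
        (chartGrad g.inner c u y) (e i)) (chartGrad g.inner c u y) ≤
    -(gradNorm g u ((extChartAt (𝓡∂ n) c).symm y) ^ 2 / (K - Real.exp (chartFun c s y)) *
      Real.exp (chartFun c s y) * ∑ i, fpart f i lam *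
        (covHess (chartConn g.inner c) (chartFun c s) y (e i) (e i) +
          fderiv ℝ (chartFun c s) y (e i) ^ 2))

theorem isGradientNear_chart (hu : ContMDiff (𝓡∂ n) 𝓘(ℝ, ℝ) 3 u) (hy : y ∈ chartInterior c) :
    IsGradientNear (chartForm g.inner c) (chartFun c u) (chartGrad g.inner c u) y where
  eq := by
    filter_upwards [chartInterior_mem_nhds hy] with z hz b
    rw [chartForm_chartGrad g hz.1,
      fderivWithin_of_mem_nhds (mem_interior_iff_mem_nhds.1 hz.2)]
  diff := by
    filter_upwards [chartInterior_mem_nhds hy] with z hz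
    exact (contDiffAt_of_contDiffOn_target hz (contDiffOn_chartGrad g hu c)).differentiableAt
      (by simp)

theorem gradNorm_sq_interior (hu : ContMDiff (𝓡∂ n) 𝓘(ℝ, ℝ) 3 u) (hy : y ∈ chartInterior c) :
    gradNorm g u ((extChartAt (𝓡∂ n) c).symm y) ^ 2 =
      fderiv ℝ (chartFun c u) y (chartGrad g.inner c u y) := by
  rw [gradNorm_sq g (hu.mdifferentiable (by norm_num)) hy.1,
    fderivWithin_of_mem_nhds (mem_interior_iff_mem_nhds.1 hy.2)]

/-- The hypothesis `hmax` is maximality of `(|∇u| / ζ)²` with one denominator cleared. The frame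
consists of the columns of the diagonalizing matrix at `y`; it is not extended to a neighbourhood.
-/
theorem StructureConditions.exists_maxData (hf : StructureConditions Γ f)
    (hχ : Tensor2.IsSmooth χ) (hu : ContMDiff (𝓡∂ n) 𝓘(ℝ, ℝ) 3 u) {s : M → ℝ}
    (hs : ContMDiff (𝓡∂ n) 𝓘(ℝ, ℝ) 2 s) {K : ℝ} (hK : ∀ x, 0 < K - Real.exp (s x))
    (hψ : ContMDiff ((𝓡∂ n).prod 𝓘(ℝ, ℝ)) 𝓘(ℝ, ℝ) 1 (fun p : M × ℝ => ψ p.1 p.2))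
    (hadm : IsAdmissibleSolution g.inner χ Γ f ψ u) (hy : y ∈ chartInterior c)
    (hv : gradNorm g u ((extChartAt (𝓡∂ n) c).symm y) ≠ 0)
    (hmax : ∀ x, gradNorm g u x ^ 2 ≤ gradNorm g u ((extChartAt (𝓡∂ n) c).symm y) ^ 2 /
      (K - Real.exp (chartFun c s y)) ^ 2 * (K - Real.exp (s x)) ^ 2) :
    ∃ e lam, MaxData g χ Γ f ψ u s K c y e lam := by
  obtain ⟨lam, hl, ⟨P, hP1, hP2⟩, hfl⟩ := hadm.exists_chart g hy
  have hU : ContDiffAt ℝ 3 (chartFun c u) y :=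
    contDiffAt_of_contDiffOn_target hy (contDiffOn_chartFun (m := 3) hu c)
  have hS : ContDiffAt ℝ 2 (chartFun c s) y :=
    contDiffAt_of_contDiffOn_target hy (contDiffOn_chartFun (m := 2) hs c)
  have hLC := isLeviCivitaNear_chart g hy
  have hX := isGradientNear_chart (g := g) hu hy
  have hv0 := gradNorm_sq_interior (g := g) hu hy
  set G := chartForm g.inner c with hG
  set X := chartGrad g.inner c u with hXdef
  set ζ : Vec n → ℝ := fun z => K - Real.exp (chartFun c s z) with hζdef
  have hζ : ContDiffAt ℝ 2 ζ y := contDiffAt_const.sub hS.exp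
  have hζ0 : 0 < ζ y := hK _
  have hvpos : 0 < fderiv ℝ (chartFun c u) y (X y) := by
    rw [← hv0]
    positivity
  have hmax' : ∀ᶠ z in 𝓝 y, fderiv ℝ (chartFun c u) z (X z) ≤
      fderiv ℝ (chartFun c u) y (X y) / ζ y ^ 2 * ζ z ^ 2 := by
    filter_upwards [chartInterior_mem_nhds hy] with z hz
    rw [← hv0, ← gradNorm_sq_interior (g := g) hu hz]
    exact hmax _
  have hpos : ∀ a, 0 ≤ G y a a := fun a => by
    by_cases ha : a = 0
    · simp [ha]
    · exact (chartForm_pos g hy.1 ha).le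
  have hframe : IsFrame (G y) (frameOf P) := (isFrame_frameOf _ _ _ _).2 hP1
  have hdiag : ∀ i w, covHess (chartConn g.inner c) (chartFun c u) y (frameOf P i) w +
      chartForm χ c y (frameOf P i) w = lam i * G y (frameOf P i) w := by
    intro i w
    have h1 : ∀ j, covHess (chartConn g.inner c) (chartFun c u) y (frameOf P i) (frameOf P j) +
        chartForm χ c y (frameOf P i) (frameOf P j) = if i = j then lam i else 0 := by
      intro j
      rw [covHess_add_chartForm (g := g) χ (hU.of_le (by norm_num)) hy, hP2, Matrix.diagonal_apply]
    -- The eigenvector equation is needed against all `w`, in particular against the non-frame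
    -- vectors `Γ(e_i, X)`; it follows from the frame vectors by expanding `w`.
    have h2 : covHess (chartConn g.inner c) (chartFun c u) y (frameOf P i) w +
        chartForm χ c y (frameOf P i) w = ∑ j, G y w (frameOf P j) *
        (covHess (chartConn g.inner c) (chartFun c u) y (frameOf P i) (frameOf P j) +
        chartForm χ c y (frameOf P i) (frameOf P j)) := by
      conv_lhs => rw [hframe.expand w]
      simp only [covHess, map_sum, map_smul, smul_eq_mul, ← Finset.sum_sub_distrib,
        ← Finset.sum_add_distrib]
      exact Finset.sum_congr rfl fun j _ => by ring
    rw [h2, hLC.metric_symm.self_of_nhds (frameOf P i) w]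
    simp only [h1]
    simp [mul_comm]
  refine ⟨frameOf P, lam, hframe, hl, hfl, hdiag, fun a => ?_, ?_⟩
  · rw [hX.covHess_eq_of_isMax hLC hU hζ hζ0 hmax' a, fderiv_const_sub_exp hS, hv0]
    ring
  · have h1 := hX.weighted_le_of_isMax hLC hU hζ hζ0 hpos hvpos hmax'
      (χ := chartForm χ c) (e := frameOf P) (F := fun i => fpart f i lam) (lam := fun i => lam i)
      (fun i => (hf.fpart_pos i lam hl).le) hdiag
      (hf.linearized_equation hχ hu hψ hadm hy hl hP1 hP2 hfl (X y))
    refine h1.trans_eq ?_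
    simp only [hζdef, covHess_const_sub_exp hS]
    rw [hv0, mul_assoc, ← mul_neg]
    congr 1
    rw [Finset.mul_sum, ← Finset.sum_neg_distrib]
    exact Finset.sum_congr rfl fun i _ => by ring

end Equation

/-! ### Local bounds with a common constant. -/

section Bounds

/-- The bound is claimed for all large `C`, so that finitely many bounds of this form can be met by
one constant. -/
theorem eventually_norm_le_of_continuousOn {E F : Type*} [TopologicalSpace E]
    [NormedAddCommGroup F] {h : E → F} {s : Set E} {y₀ : E} (hh : ContinuousOn h s)
    (hy : y₀ ∈ s) : ∀ᶠ C : ℝ in Filter.atTop, ∀ᶠ y in 𝓝[s] y₀, ‖h y‖ ≤ C := by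
  filter_upwards [Filter.eventually_gt_atTop ‖h y₀‖] with C hC
  exact (hh y₀ hy).norm.eventually_le_const hC

theorem eventually_norm_sub_le_of_continuousOn {E F : Type*} [TopologicalSpace E]
    [NormedAddCommGroup F] {h : E → F} {s : Set E} {y₀ : E} (hh : ContinuousOn h s)
    (hy : y₀ ∈ s) {ε : ℝ} (hε : 0 < ε) : ∀ᶠ y in 𝓝[s] y₀, ‖h y - h y₀‖ ≤ ε := by
  filter_upwards [Metric.tendsto_nhds.1 (hh y₀ hy).tendsto ε hε] with y hy
  rw [dist_eq_norm] at hy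
  exact hy.le

theorem eventually_norm_le_of_isCompact {E E' F : Type*} [TopologicalSpace E]
    [TopologicalSpace E'] [NormedAddCommGroup F] {h : E × E' → F} {s : Set E} {y₀ : E}
    (hh : ContinuousOn h (s ×ˢ Set.univ)) (hy : y₀ ∈ s) {k : Set E'} (hk : IsCompact k) :
    ∀ᶠ C : ℝ in Filter.atTop, ∀ᶠ y in 𝓝[s] y₀, ∀ z ∈ k, ‖h (y, z)‖ ≤ C := by
  have hc : ContinuousOn (fun z => h (y₀, z)) k :=
    hh.comp (by fun_prop) fun z _ => ⟨hy, Set.mem_univ z⟩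
  obtain ⟨C₀, hC₀⟩ := hk.exists_bound_of_continuousOn hc
  filter_upwards [Filter.eventually_gt_atTop C₀] with C hC
  rw [eventually_nhdsWithin_iff]
  have := hk.eventually_forall_of_forall_eventually
    (P := fun y z => y ∈ s → ‖h (y, z)‖ ≤ C) (x₀ := y₀) (fun z hz => by
      have h1 := (hh (y₀, z) ⟨hy, Set.mem_univ z⟩).norm.eventually_le_const
        ((hC₀ z hz).trans_lt hC)
      rw [eventually_nhdsWithin_iff] at h1
      filter_upwards [h1] with p hp hps
      exact hp ⟨hps, Set.mem_univ _⟩)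
  filter_upwards [this] with y hy' hys z hz
  exact hy' z hz hys

variable {n : ℕ}

/-- The minimum `m` of the form at `y₀` on the unit sphere is positive, and `m / 2` survives a small
perturbation. The constant enters as `C ^ 2` so that unit vectors of the metric have norm at most
`C`. -/
theorem eventually_coercive {G : Vec n → Vec n →L[ℝ] Vec n →L[ℝ] ℝ} {s : Set (Vec n)}
    {y₀ : Vec n} (hG : ContinuousOn G s) (hy : y₀ ∈ s) (hpos : ∀ a ≠ 0, 0 < G y₀ a a) :
    ∀ᶠ C : ℝ in Filter.atTop, ∀ᶠ y in 𝓝[s] y₀, ∀ a, ‖a‖ ^ 2 ≤ C ^ 2 * G y a a := by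
  obtain ⟨m, hm, hmin⟩ := (isCompact_sphere (0 : Vec n) 1).exists_forall_le'
    (f := fun a => G y₀ a a) (by fun_prop) (a := 0) (fun a ha => hpos a (by
      rintro rfl
      simp at ha))
  have hmin' : ∀ a, m * ‖a‖ ^ 2 ≤ G y₀ a a := by
    intro a
    by_cases ha : a = 0
    · simp [ha]
    have h1 := hmin (‖a‖⁻¹ • a) (by simp [norm_smul, ha])
    simp only [map_smul, _root_.smul_apply, smul_eq_mul] at h1
    have h2 : 0 < ‖a‖ := norm_pos_iff.2 ha
    field_simp at h1
    linarith
  filter_upwards [Filter.eventually_ge_atTop (2 / m), Filter.eventually_ge_atTop 1] with C hC hC1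
  filter_upwards [eventually_norm_sub_le_of_continuousOn
    (F := Vec n →L[ℝ] Vec n →L[ℝ] ℝ) hG hy (half_pos hm)] with y hy a
  have h6 := (G y - G y₀).le_opNorm₂ a a
  rw [_root_.sub_apply, _root_.sub_apply, Real.norm_eq_abs] at h6
  have h7 := neg_le_of_abs_le h6
  have h8 : m / 2 * ‖a‖ ^ 2 ≤ G y a a := by
    nlinarith [hmin' a, mul_le_mul_of_nonneg_right hy (sq_nonneg ‖a‖)]
  have h9 : 1 ≤ C ^ 2 * (m / 2) := by
    have : 2 / m * (m / 2) = 1 := by field_simp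
    have h10 := mul_le_mul_of_nonneg_right (hC.trans (le_self_pow₀ hC1 two_ne_zero))
      (half_pos hm).le
    linarith
  nlinarith [sq_nonneg ‖a‖, mul_le_mul_of_nonneg_left h8 (sq_nonneg C)]

end Bounds

/-! ### Bounds for the data of the equation near a point. -/

section ChartBounds

variable {n : ℕ} [NeZero n] {M : Type*} [TopologicalSpace M]
  [ChartedSpace (EuclideanHalfSpace n) M]

/-- The derivative within the half space is continuous up to the boundary and equals `fderiv` at
interior points, so the bound holds even when `c` is a boundary point. -/
theorem eventually_norm_fderiv_le {F : Type*} [NormedAddCommGroup F] [NormedSpace ℝ F] {c : M}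
    {h : Vec n → F} (hh : ContDiffOn ℝ 1 h (extChartAt (𝓡∂ n) c).target) :
    ∀ᶠ C : ℝ in Filter.atTop, ∀ᶠ y in 𝓝[(extChartAt (𝓡∂ n) c).target] (extChartAt (𝓡∂ n) c c),
      y ∈ chartInterior c → ‖fderiv ℝ h y‖ ≤ C := by
  filter_upwards [eventually_norm_le_of_continuousOn
    (contDiffOn_fderivWithin_range (k := 0) hh (by simp)).continuousOn
    (mem_extChartAt_target c)] with C hC
  filter_upwards [hC] with y hy hy'
  rwa [fderivWithin_of_mem_nhds (mem_interior_iff_mem_nhds.1 hy'.2)] at hy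

variable [IsManifold (𝓡∂ n) ∞ M]

set_option maxSynthPendingDepth 3 in
/-- Bounds by `C` at the point `y` of the chart at `c` for the data of the equation. -/
structure ChartBounds (g : Metric n M) (χ : Tensor2 n M) (ψ : M → ℝ → ℝ) (I : Set ℝ) (c : M)
    (C : ℝ) (y : Vec n) : Prop where
  one_le : 1 ≤ C
  coercive : ∀ a, ‖a‖ ^ 2 ≤ C ^ 2 * chartForm g.inner c y a a
  metric : ‖chartForm g.inner c y‖ ≤ C
  form : ‖chartForm χ c y‖ ≤ C
  dform : ‖fderiv ℝ (chartForm χ c) y‖ ≤ C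
  conn : ‖chartConn g.inner c y‖ ≤ C
  dconn : ‖fderiv ℝ (chartConn g.inner c) y‖ ≤ C
  rhs : ∀ z ∈ I, ‖fderiv ℝ (chartRhs ψ c) (y, z)‖ ≤ C

set_option maxSynthPendingDepth 3 in
theorem exists_chartBounds (g : Metric n M) {χ : Tensor2 n M} (hχ : χ.IsSmooth) {ψ : M → ℝ → ℝ}
    (hψ : ContMDiff ((𝓡∂ n).prod 𝓘(ℝ, ℝ)) 𝓘(ℝ, ℝ) 1 (fun p : M × ℝ => ψ p.1 p.2))
    {I : Set ℝ} (hI : IsCompact I) (c : M) :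
    ∀ᶠ C : ℝ in Filter.atTop, ∀ᶠ y in 𝓝[(extChartAt (𝓡∂ n) c).target] (extChartAt (𝓡∂ n) c c),
      y ∈ chartInterior c → ChartBounds g χ ψ I c C y := by
  have h0 : extChartAt (𝓡∂ n) c c ∈ (extChartAt (𝓡∂ n) c).target := mem_extChartAt_target c
  have hG := (contDiffOn_chartForm g.isSmooth c).continuousOn
  have hle : (1 : WithTop ℕ∞) ≤ ∞ := mod_cast le_top
  have hU : UniqueDiffOn ℝ ((extChartAt (𝓡∂ n) c).target ×ˢ (Set.univ : Set ℝ)) :=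
    (uniqueDiffOn_extChartAt_target c).prod uniqueDiffOn_univ
  have hR := (contDiffOn_chartRhs hψ c).continuousOn_fderivWithin hU le_rfl
  filter_upwards [Filter.eventually_ge_atTop 1,
    eventually_coercive hG h0 fun a ha => chartForm_pos g h0 ha,
    eventually_norm_le_of_continuousOn hG h0,
    eventually_norm_le_of_continuousOn (contDiffOn_chartForm hχ c).continuousOn h0,
    eventually_norm_fderiv_le ((contDiffOn_chartForm hχ c).of_le hle),
    eventually_norm_le_of_continuousOn (contDiffOn_chartConn g c).continuousOn h0,
    eventually_norm_fderiv_le ((contDiffOn_chartConn g c).of_le hle),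
    eventually_norm_le_of_isCompact hR h0 hI] with C h1 h2 h3 h4 h5 h6 h7 h8
  filter_upwards [h2, h3, h4, h5, h6, h7, h8] with y h2 h3 h4 h5 h6 h7 h8 hy
  refine ⟨h1, h2, h3, h4, h5 hy, h6, h7 hy, fun z hz => ?_⟩
  have := h8 z hz
  rwa [fderivWithin_of_mem_nhds (prod_mem_nhds (target_mem_nhds hy.1 hy.2)
    Filter.univ_mem)] at this

end ChartBounds

theorem covHess_sub {E : Type*} [NormedAddCommGroup E] [NormedSpace ℝ E]
    {Γ : E → E →L[ℝ] E →L[ℝ] E} {u v : E → ℝ} {y : E} (hu : ContDiffAt ℝ 2 u y)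
    (hv : ContDiffAt ℝ 2 v y) (a b : E) :
    covHess Γ (fun z => u z - v z) y a b = covHess Γ u y a b - covHess Γ v y a b := by
  have h1 : fderiv ℝ (fun z => u z - v z) =ᶠ[𝓝 y] fun z => fderiv ℝ u z - fderiv ℝ v z := by
    filter_upwards [hu.eventually (by simp), hv.eventually (by simp)] with z hz hz'
    exact fderiv_fun_sub (hz.differentiableAt (by simp)) (hz'.differentiableAt (by simp))
  have h2 : DifferentiableAt ℝ (fderiv ℝ u) y :=
    (hu.fderiv_right (m := 1) (by norm_num)).differentiableAt (by simp)
  have h3 : DifferentiableAt ℝ (fderiv ℝ v) y :=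
    (hv.fderiv_right (m := 1) (by norm_num)).differentiableAt (by simp)
  rw [covHess, h1.fderiv_eq, h1.self_of_nhds, fderiv_fun_sub h2 h3]
  simp only [covHess, _root_.sub_apply]
  ring

/-- The left side has order `w⁴ F`, as `τ` has at least the order of `w²`. The right side has order
`w² F` once the terms without `F` are absorbed by `1 ≤ F / F₀`. -/
theorem le_of_scalar_inequality {w C F F₀ δ₀ τ E₀ K N : ℝ} (hC1 : 1 ≤ C) (hw1 : 1 ≤ w)
    (hF₀ : 0 < F₀) (hF : F₀ ≤ F) (hE₀ : 0 < E₀) (hK : 0 < K) (hδ₀ : 0 < δ₀) (hN : 0 < N)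
    (hτ0 : w ^ 2 * E₀ / K ≤ τ)
    (h : τ * (δ₀ * F * (w ^ 2 / N) - C ^ 3 * F) ≤
      C * w ^ 2 + 3 * C ^ 5 * w * (1 + F) + 4 * C ^ 7 * w ^ 2 * F) :
    w ≤ N * (C ^ 3 + 8 * C ^ 7 * (1 / F₀ + 1) * K / E₀) / δ₀ := by
  have hw2 : 0 < w ^ 2 := by positivity
  have hFpos : 0 < F := hF₀.trans_le hF
  set L := 8 * C ^ 7 * (1 / F₀ + 1) with hL
  have hmain : τ * (F * (δ₀ * (w ^ 2 / N) - C ^ 3)) ≤ w ^ 2 * F * L := by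
    have h1 : τ * (F * (δ₀ * (w ^ 2 / N) - C ^ 3)) ≤
        C * w ^ 2 + 3 * C ^ 5 * w * (1 + F) + 4 * C ^ 7 * w ^ 2 * F := by
      linarith
    have hFF : 1 ≤ F * (1 / F₀) := by
      rw [mul_one_div, le_div_iff₀ hF₀]
      linarith
    have hp1 : C ≤ C ^ 7 := le_self_pow₀ hC1 (by norm_num)
    have hp5 : C ^ 5 ≤ C ^ 7 := pow_le_pow_right₀ hC1 (by norm_num)
    have hww : w ≤ w ^ 2 := le_self_pow₀ hw1 two_ne_zero
    have h4 : C * w ^ 2 ≤ C ^ 7 * w ^ 2 := by gcongr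
    have h5 : 3 * C ^ 5 * w * (1 + F) ≤ 3 * C ^ 7 * w ^ 2 * (1 + F) := by gcongr
    have h6 := mul_le_mul_of_nonneg_left hFF (by positivity : 0 ≤ 8 * C ^ 7 * w ^ 2)
    have h7 : 0 ≤ C ^ 7 * w ^ 2 * F := by positivity
    have h8 : 0 ≤ C ^ 7 * w ^ 2 := by positivity
    rw [hL]
    linarith
  have hfin : δ₀ * (w ^ 2 / N) - C ^ 3 ≤ L * K / E₀ := by
    by_cases hneg : δ₀ * (w ^ 2 / N) - C ^ 3 ≤ 0
    · exact hneg.trans (by positivity)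
    push Not at hneg
    have h1 := mul_le_mul_of_nonneg_right hτ0 (mul_pos hFpos hneg).le
    rw [le_div_iff₀ hE₀]
    have h2 := h1.trans hmain
    rw [div_mul_eq_mul_div, div_le_iff₀ hK] at h2
    refine le_of_mul_le_mul_left ?_ (by positivity : 0 < w ^ 2 * F)
    linarith
  rw [le_div_iff₀ hδ₀]
  have hww : w ≤ w ^ 2 := le_self_pow₀ hw1 two_ne_zero
  have h2 : δ₀ * (w ^ 2 / N) ≤ C ^ 3 + L * K / E₀ := by linarith
  rw [← mul_div_assoc, div_le_iff₀ (by positivity)] at h2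
  nlinarith

/-! ### The gradient bound at an interior maximum, in each of the three cases. -/

section Estimates

variable {n : ℕ} [NeZero n] {M : Type*} [TopologicalSpace M]
  [ChartedSpace (EuclideanHalfSpace n) M] [IsManifold (𝓡∂ n) ∞ M] {g : Metric n M}
  {χ : Tensor2 n M} {Γ : Set (Vec n)} {f : Vec n → ℝ} {ψ : M → ℝ → ℝ} {u s : M → ℝ} {c : M}
  {y : Vec n} {K C : ℝ} {I : Set ℝ} {e : Fin n → Vec n} {lam : Vec n}

theorem ChartBounds.norm_frame_le (hB : ChartBounds g χ ψ I c C y)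
    (he : IsFrame (chartForm g.inner c y) e) (i : Fin n) : ‖e i‖ ≤ C := by
  have h1 := hB.coercive (e i)
  rw [he i i, if_pos rfl, mul_one] at h1
  exact le_of_sq_le_sq h1 (by linarith [hB.one_le])

theorem chartForm_chartGrad_interior (hy : y ∈ chartInterior c) (b : Vec n) :
    chartForm g.inner c y (chartGrad g.inner c u y) b = fderiv ℝ (chartFun c u) y b := by
  rw [chartForm_chartGrad g hy.1, fderivWithin_of_mem_nhds (mem_interior_iff_mem_nhds.1 hy.2)]

theorem gradNorm_nonneg (x : M) : 0 ≤ gradNorm g u x := Real.sqrt_nonneg _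

theorem ChartBounds.norm_chartGrad_le (hB : ChartBounds g χ ψ I c C y)
    (hu : ContMDiff (𝓡∂ n) 𝓘(ℝ, ℝ) 3 u) (hy : y ∈ chartInterior c) :
    ‖chartGrad g.inner c u y‖ ≤ C * gradNorm g u ((extChartAt (𝓡∂ n) c).symm y) := by
  have h1 := hB.coercive (chartGrad g.inner c u y)
  rw [chartForm_chartGrad_interior hy, ← gradNorm_sq_interior hu hy, ← mul_pow] at h1
  exact le_of_sq_le_sq h1 (mul_nonneg (by linarith [hB.one_le]) (gradNorm_nonneg _))

theorem ChartBounds.abs_form_le (hB : ChartBounds g χ ψ I c C y) {a b : Vec n} {p q : ℝ}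
    (ha : ‖a‖ ≤ p) (hb : ‖b‖ ≤ q) : |chartForm χ c y a b| ≤ C * p * q := by
  have hC : 0 ≤ C := by linarith [hB.one_le]
  have hp : 0 ≤ p := (norm_nonneg a).trans ha
  refine ((chartForm χ c y).le_opNorm₂ a b).trans ?_
  have := hB.form
  gcongr

set_option maxSynthPendingDepth 3 in
theorem ChartBounds.abs_dform_le (hB : ChartBounds g χ ψ I c C y) {X a b : Vec n} {o p q : ℝ}
    (hX : ‖X‖ ≤ o) (ha : ‖a‖ ≤ p) (hb : ‖b‖ ≤ q) :
    |fderiv ℝ (chartForm χ c) y X a b| ≤ C * o * p * q := by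
  have hC : 0 ≤ C := by linarith [hB.one_le]
  have ho : 0 ≤ o := (norm_nonneg X).trans hX
  have hp : 0 ≤ p := (norm_nonneg a).trans ha
  refine ((fderiv ℝ (chartForm χ c) y X).le_opNorm₂ a b).trans ?_
  have h1 : ‖fderiv ℝ (chartForm χ c) y X‖ ≤ C * o :=
    (ContinuousLinearMap.le_opNorm _ X).trans (by
      have := hB.dform
      gcongr)
  gcongr

theorem ChartBounds.norm_conn_le (hB : ChartBounds g χ ψ I c C y) {a b : Vec n} {p q : ℝ}
    (ha : ‖a‖ ≤ p) (hb : ‖b‖ ≤ q) : ‖chartConn g.inner c y a b‖ ≤ C * p * q := by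
  have hC : 0 ≤ C := by linarith [hB.one_le]
  have hp : 0 ≤ p := (norm_nonneg a).trans ha
  refine ((chartConn g.inner c y).le_opNorm₂ a b).trans ?_
  have := hB.conn
  gcongr

set_option maxSynthPendingDepth 3 in
theorem ChartBounds.norm_dconn_le (hB : ChartBounds g χ ψ I c C y) {X a b : Vec n} {o p q : ℝ}
    (hX : ‖X‖ ≤ o) (ha : ‖a‖ ≤ p) (hb : ‖b‖ ≤ q) :
    ‖fderiv ℝ (chartConn g.inner c) y X a b‖ ≤ C * o * p * q := by
  have hC : 0 ≤ C := by linarith [hB.one_le]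
  have ho : 0 ≤ o := (norm_nonneg X).trans hX
  have hp : 0 ≤ p := (norm_nonneg a).trans ha
  refine ((fderiv ℝ (chartConn g.inner c) y X).le_opNorm₂ a b).trans ?_
  have h1 : ‖fderiv ℝ (chartConn g.inner c) y X‖ ≤ C * o :=
    (ContinuousLinearMap.le_opNorm _ X).trans (by
      have := hB.dconn
      gcongr)
  gcongr

theorem ChartBounds.abs_inner_curvVec_le (hB : ChartBounds g χ ψ I c C y) {X a : Vec n} {o p : ℝ}
    (hX : ‖X‖ ≤ o) (ha : ‖a‖ ≤ p) :
    |chartForm g.inner c y (curvVec (chartConn g.inner c) y X a) X| ≤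
      4 * C ^ 3 * o ^ 2 * p ^ 2 := by
  have hC1 := hB.one_le
  have hC : 0 ≤ C := by linarith
  have ho : 0 ≤ o := (norm_nonneg X).trans hX
  have hp : 0 ≤ p := (norm_nonneg a).trans ha
  have h1 := hB.norm_dconn_le hX ha ha
  have h2 := hB.norm_dconn_le ha hX ha
  have h3 := hB.norm_conn_le hX (hB.norm_conn_le ha ha)
  have h4 := hB.norm_conn_le ha (hB.norm_conn_le hX ha)
  have h5 : ‖curvVec (chartConn g.inner c) y X a‖ ≤ 4 * C ^ 2 * o * p ^ 2 := by
    have hCC : C ≤ C ^ 2 := le_self_pow₀ hC1 two_ne_zero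
    have hnn : 0 ≤ o * p ^ 2 := by positivity
    have h6 := mul_le_mul_of_nonneg_right hCC hnn
    unfold curvVec
    refine (norm_sub_le _ _).trans ((add_le_add ((norm_add_le _ _).trans
      (add_le_add (norm_sub_le _ _) le_rfl)) le_rfl).trans ?_)
    nlinarith
  refine ((chartForm g.inner c y).le_opNorm₂ _ X).trans ?_
  have := hB.metric
  calc _ ≤ C * (4 * C ^ 2 * o * p ^ 2) * o := by gcongr
    _ = _ := by ring

theorem ChartBounds.abs_rhs_le (hB : ChartBounds g χ ψ I c C y) {z : ℝ} (hz : z ∈ I) {X : Vec n}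
    {o t : ℝ} (hX : ‖X‖ ≤ o) (ht : |t| ≤ o) : |fderiv ℝ (chartRhs ψ c) (y, z) (X, t)| ≤ C * o := by
  have hC : 0 ≤ C := by linarith [hB.one_le]
  refine ((fderiv ℝ (chartRhs ψ c) (y, z)).le_opNorm (X, t)).trans ?_
  have := hB.rhs z hz
  have h2 : ‖(X, t)‖ ≤ o := max_le hX ht
  gcongr

/-- The second order condition at a maximum point, with the terms that are not essential
estimated. -/
theorem MaxData.scalar (hD : MaxData g χ Γ f ψ u s K c y e lam) (hf : StructureConditions Γ f)
    (hu : ContMDiff (𝓡∂ n) 𝓘(ℝ, ℝ) 3 u) (hy : y ∈ chartInterior c)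
    (hB : ChartBounds g χ ψ I c C y) (hI : chartFun c u y ∈ I) {w : ℝ}
    (hw : gradNorm g u ((extChartAt (𝓡∂ n) c).symm y) = w) :
    fderiv ℝ (chartRhs ψ c) (y, chartFun c u y) (0, 1) * w ^ 2 -
        3 * C ^ 5 * w * (1 + ∑ i, fpart f i lam) +
        ∑ i, fpart f i lam * chartForm g.inner c y (curvVec (chartConn g.inner c) y
          (chartGrad g.inner c u y) (e i)) (chartGrad g.inner c u y) ≤
      -(w ^ 2 / (K - Real.exp (chartFun c s y)) *
        Real.exp (chartFun c s y) * ∑ i, fpart f i lam *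
          (covHess (chartConn g.inner c) (chartFun c s) y (e i) (e i) +
            fderiv ℝ (chartFun c s) y (e i) ^ 2)) := by
  have h0 := hD.second
  have hX := hB.norm_chartGrad_le hu hy
  have hw0 : 0 ≤ w := hw ▸ gradNorm_nonneg _
  have hC1 := hB.one_le
  rw [← gradNorm_sq_interior hu hy] at h0
  rw [hw] at h0 hX
  set X := chartGrad g.inner c u y
  have h1 : fderiv ℝ (chartRhs ψ c) (y, chartFun c u y) (X, w ^ 2) =
      fderiv ℝ (chartRhs ψ c) (y, chartFun c u y) (X, 0) +
        fderiv ℝ (chartRhs ψ c) (y, chartFun c u y) (0, 1) * w ^ 2 := by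
    have : ((X, w ^ 2) : Vec n × ℝ) = (X, 0) + w ^ 2 • (0, 1) := by simp
    rw [this, map_add, map_smul, smul_eq_mul, mul_comm]
  have h2 := neg_le_of_abs_le (hB.abs_rhs_le hI hX (t := 0) (by simp; positivity))
  -- Here `‖X‖ ≤ C w` and `‖e i‖ ≤ C`: the first term is at most `C⁴ w`, the second at most `2 C⁵
  -- w`.
  have h3 : ∀ i, fderiv ℝ (chartForm χ c) y X (e i) (e i) -
        2 * chartForm χ c y (e i) (chartConn g.inner c y (e i) X) ≤ 3 * C ^ 5 * w := by
    intro i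
    have he := hB.norm_frame_le hD.frame i
    have h4 := le_of_abs_le (hB.abs_dform_le hX he he)
    have h5 := neg_le_of_abs_le (hB.abs_form_le he (hB.norm_conn_le he hX))
    have h6 := mul_le_mul_of_nonneg_right hC1 (by positivity : 0 ≤ C ^ 4 * w)
    nlinarith
  have h7 : ∑ i, fpart f i lam * (fderiv ℝ (chartForm χ c) y X (e i) (e i) -
        2 * chartForm χ c y (e i) (chartConn g.inner c y (e i) X)) ≤
      ∑ i, fpart f i lam * (3 * C ^ 5 * w) :=
    Finset.sum_le_sum fun i _ => mul_le_mul_of_nonneg_left (h3 i) (hf.fpart_pos i lam hD.mem).le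
  rw [← Finset.sum_mul] at h7
  have h8 : C * (C * w) ≤ 3 * C ^ 5 * w := by
    have : C ^ 2 ≤ C ^ 5 := pow_le_pow_right₀ hC1 (by norm_num)
    nlinarith [pow_nonneg (zero_le_one.trans hC1) 5]
  rw [h1] at h0
  linarith

theorem MaxData.covHess_add (hD : MaxData g χ Γ f ψ u s K c y e lam) (a w : Vec n) :
    covHess (chartConn g.inner c) (chartFun c u) y a w + chartForm χ c y a w =
      ∑ i, lam i * chartForm g.inner c y a (e i) * chartForm g.inner c y (e i) w := by
  have h : covHess (chartConn g.inner c) (chartFun c u) y a w + chartForm χ c y a w =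
      ∑ i, chartForm g.inner c y a (e i) *
        (covHess (chartConn g.inner c) (chartFun c u) y (e i) w + chartForm χ c y (e i) w) := by
    conv_lhs => rw [hD.frame.expand a]
    simp only [covHess, map_sum, map_smul, FunLike.coe_sum, Finset.sum_apply, smul_eq_mul,
      _root_.smul_apply, ← Finset.sum_sub_distrib, ← Finset.sum_add_distrib]
    exact Finset.sum_congr rfl fun j _ => by ring
  rw [h]
  exact Finset.sum_congr rfl fun i _ => by rw [hD.diag]; ring

/-- The gradient bound at a maximum point when all eigenvalues are positive. -/
theorem MaxData.gradNorm_le_of_pos (hD : MaxData g χ Γ f ψ u u K c y e lam)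
    (hlam : ∀ i, 0 < lam i)
    (hu : ContMDiff (𝓡∂ n) 𝓘(ℝ, ℝ) 3 u) (hy : y ∈ chartInterior c)
    (hB : ChartBounds g χ ψ I c C y) {w E₀ : ℝ}
    (hw : gradNorm g u ((extChartAt (𝓡∂ n) c).symm y) = w) (hw1 : 1 ≤ w)
    (hζ : 0 < K - Real.exp (chartFun c u y)) (hE₀ : 0 < E₀)
    (hE : E₀ ≤ Real.exp (chartFun c u y)) : w ≤ C ^ 3 * K / E₀ := by
  have hX := hB.norm_chartGrad_le hu hy
  have h1 := hD.first (chartGrad g.inner c u y)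
  have h2 := hD.covHess_add (chartGrad g.inner c u y) (chartGrad g.inner c u y)
  rw [← gradNorm_sq_interior hu hy] at h1
  rw [hw] at h1 hX
  have h3 := le_of_abs_le (hB.abs_form_le hX hX)
  set X := chartGrad g.inner c u y
  have h4 : 0 ≤ ∑ i, lam i * chartForm g.inner c y X (e i) * chartForm g.inner c y (e i) X := by
    refine Finset.sum_nonneg fun i _ => ?_
    rw [chartForm_symm g c y (e i), mul_assoc]
    exact mul_nonneg (hlam i).le (mul_self_nonneg _)
  set E := Real.exp (chartFun c u y)
  -- The first order condition in the direction `∇u` gives `∇²u(∇u, ∇u) = -τ w²`, while `∇²u + χ` is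
  -- positive. The second order condition plays no role here.
  have h5 : w ^ 2 / (K - E) * E * w ^ 2 ≤ C * (C * w) * (C * w) := by linarith
  have h6 : w ^ 2 / (K - E) * E * w ^ 2 = w ^ 2 * (w ^ 2 * E / (K - E)) := by ring
  have h7 : w ^ 2 * E / (K - E) ≤ C ^ 3 := by
    have h8 : 0 < w ^ 2 := by positivity
    refine le_of_mul_le_mul_left ?_ h8
    linarith
  rw [div_le_iff₀ hζ] at h7
  rw [le_div_iff₀ hE₀]
  have h9 : 0 ≤ C ^ 3 := pow_nonneg (by linarith [hB.one_le]) 3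
  have hEp : 0 < E := Real.exp_pos _
  nlinarith [mul_nonneg h9 hEp.le, mul_le_mul_of_nonneg_left hw1 (by positivity : 0 ≤ w * E)]

/-- The gradient bound at a maximum point under the condition `f_j ≥ δ₀ ∑ f_i` where `λ_j < 0`. -/
theorem MaxData.gradNorm_le_of_fpart_ge (hD : MaxData g χ Γ f ψ u u K c y e lam)
    (hf : StructureConditions Γ f) (hu : ContMDiff (𝓡∂ n) 𝓘(ℝ, ℝ) 3 u) (hy : y ∈ chartInterior c)
    (hB : ChartBounds g χ ψ I c C y) (hI : chartFun c u y ∈ I) {w E₀ δ₀ R F₀ : ℝ}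
    (hw : gradNorm g u ((extChartAt (𝓡∂ n) c).symm y) = w) (hw1 : 1 ≤ w)
    (hζ : 0 < K - Real.exp (chartFun c u y)) (hE₀ : 0 < E₀)
    (hE : E₀ ≤ Real.exp (chartFun c u y)) (hδ₀ : 0 < δ₀) (hF₀ : 0 < F₀)
    (hF : F₀ ≤ ∑ i, fpart f i lam) (hsum : 0 ≤ ∑ i, fpart f i lam * lam i)
    (hfj : R ≤ ‖lam‖ → ∀ j, lam j < 0 → δ₀ * ∑ i, fpart f i lam ≤ fpart f j lam) :
    w ≤ K * (n * C ^ 3 + |R|) / E₀ + n * (C ^ 3 + 8 * C ^ 7 * (1 / F₀ + 1) * K / E₀) / δ₀ := by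
  have hC1 := hB.one_le
  have hC0 : 0 ≤ C := by linarith
  have hn : (1 : ℝ) ≤ n := by exact_mod_cast Nat.one_le_iff_ne_zero.2 (NeZero.ne n)
  have hX := hB.norm_chartGrad_le hu hy
  have hfirst := hD.first
  have hsc := hD.scalar hf hu hy hB hI hw
  have hXX : chartForm g.inner c y (chartGrad g.inner c u y) (chartGrad g.inner c u y) =
      w ^ 2 := by
    rw [chartForm_chartGrad_interior hy, ← gradNorm_sq_interior hu hy, hw]
  rw [hw] at hX hfirst
  have hx : ∀ i, fderiv ℝ (chartFun c u) y (e i) =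
      chartForm g.inner c y (chartGrad g.inner c u y) (e i) := fun i =>
    (chartForm_chartGrad_interior hy _).symm
  simp only [hx] at hsc
  have hfirst' := fun i => hfirst (e i)
  simp only [hx] at hfirst'
  set X := chartGrad g.inner c u y
  set E := Real.exp (chartFun c u y)
  set x : Fin n → ℝ := fun i => chartForm g.inner c y X (e i) with hxdef
  set F := ∑ i, fpart f i lam with hFdef
  have hEp : 0 < E := Real.exp_pos _
  have hK : 0 < K := by linarith
  have hw2 : 0 < w ^ 2 := by positivity
  set τ := w ^ 2 / (K - E) * E with hτ
  have hτ0 : w ^ 2 * E₀ / K ≤ τ := by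
    rw [hτ, div_mul_eq_mul_div]
    exact div_le_div₀ (by positivity) (by gcongr) hζ (by linarith)
  have hFpos : 0 < F := hF₀.trans_le hF
  have hsq : ∑ i, x i ^ 2 = w ^ 2 := by
    rw [← hXX, hD.frame.apply_eq_sum X X]
    exact Finset.sum_congr rfl fun i _ => sq _
  -- By pigeonhole some frame direction carries at least the average share of `|∇u|² = ∑ x_i²`.
  obtain ⟨i, hi⟩ : ∃ i, w ^ 2 / n ≤ x i ^ 2 := by
    by_contra! hcon
    have := Finset.sum_lt_sum_of_nonempty (s := Finset.univ)
      ⟨(0 : Fin n), Finset.mem_univ _⟩ (fun i _ => hcon i)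
    rw [hsq, Finset.sum_const, Finset.card_univ, Fintype.card_fin, nsmul_eq_mul,
      mul_div_cancel₀ _ (by positivity)] at this
    exact lt_irrefl _ this
  have hxi : w ≤ n * |x i| := by
    refine le_of_sq_le_sq ?_ (by positivity)
    rw [mul_pow, sq_abs]
    rw [div_le_iff₀ (by positivity)] at hi
    nlinarith [mul_le_mul_of_nonneg_right hn (by positivity : 0 ≤ n * x i ^ 2)]
  -- A bounded `τ` bounds `w` directly, since `τ ≥ w² E₀ / K`. Otherwise `τ` is large enough to
  -- force `λ_i < -|R|`.
  by_cases hbig : τ ≤ n * C ^ 3 + |R|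
  · have h1 : w ≤ K * (n * C ^ 3 + |R|) / E₀ := by
      have := hτ0.trans hbig
      rw [div_le_iff₀ hK] at this
      rw [le_div_iff₀ hE₀]
      nlinarith [mul_le_mul_of_nonneg_right hw1 (by positivity : 0 ≤ w * E₀)]
    have h2 : 0 ≤ n * (C ^ 3 + 8 * C ^ 7 * (1 / F₀ + 1) * K / E₀) / δ₀ := by positivity
    linarith
  push Not at hbig
  have hlam : lam i < -|R| := by
    have h1 := hD.diag i X
    rw [hfirst' i, chartForm_symm g c y (e i) X] at h1
    -- The first order condition in the direction `e_i`. The right side is at most `C³ w ≤ n C³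
    -- |x_i|`, so `λ_i` differs from `-τ` by at most `n C³`.
    have h2 : (lam i + τ) * x i = chartForm χ c y (e i) X := by
      simp only [hxdef]
      linarith
    have h3 := hB.abs_form_le (hB.norm_frame_le hD.frame i) hX
    rw [← h2, abs_mul] at h3
    have h4 : |lam i + τ| ≤ n * C ^ 3 := by
      have h5 := mul_le_mul_of_nonneg_left hxi (abs_nonneg (lam i + τ))
      refine le_of_mul_le_mul_right ?_ (by positivity : 0 < w)
      nlinarith
    have := le_of_abs_le h4
    linarith
  have hfi : δ₀ * F ≤ fpart f i lam := by
    refine hfj ?_ i (by linarith [abs_nonneg R])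
    calc R ≤ |R| := le_abs_self R
      _ ≤ |lam i| := by
        rw [le_abs]
        right
        linarith
      _ ≤ ‖lam‖ := PiLp.norm_apply_le lam i
  set F' := fun i => fpart f i lam
  have hF' : ∀ i, 0 < F' i := fun i => hf.fpart_pos i lam hD.mem
  -- The direction `i` alone contributes `δ₀ F w² / n`; `∑ f_i λ_i ≥ 0` is dropped, and `χ` costs at
  -- most `C³ F`.
  have hQ : δ₀ * F * (w ^ 2 / n) - C ^ 3 * F ≤ ∑ i, F' i *
      (covHess (chartConn g.inner c) (chartFun c u) y (e i) (e i) + x i ^ 2) := by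
    have h1 : ∀ i, F' i * (lam i - C ^ 3 + x i ^ 2) ≤ F' i *
        (covHess (chartConn g.inner c) (chartFun c u) y (e i) (e i) + x i ^ 2) := by
      intro i
      refine mul_le_mul_of_nonneg_left ?_ (hF' i).le
      have h2 := hD.diag i (e i)
      rw [hD.frame i i, if_pos rfl] at h2
      have he := hB.norm_frame_le hD.frame i
      have h3 := le_of_abs_le (hB.abs_form_le he he)
      linarith
    refine le_trans ?_ (Finset.sum_le_sum fun i _ => h1 i)
    simp only [mul_add, mul_sub, Finset.sum_add_distrib, Finset.sum_sub_distrib, ← Finset.sum_mul]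
    have h4 : F' i * x i ^ 2 ≤ ∑ i, F' i * x i ^ 2 :=
      Finset.single_le_sum (f := fun i => F' i * x i ^ 2)
        (fun i _ => mul_nonneg (hF' i).le (sq_nonneg _)) (Finset.mem_univ i)
    have h5 : δ₀ * F * (w ^ 2 / n) ≤ F' i * x i ^ 2 :=
      mul_le_mul hfi hi (by positivity) (hF' i).le
    change _ ≤ ∑ i, F' i * lam i - F * C ^ 3 + _
    linarith
  have hcurv : -(4 * C ^ 7 * w ^ 2 * F) ≤ ∑ i, F' i *
      chartForm g.inner c y (curvVec (chartConn g.inner c) y X (e i)) X := by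
    rw [hFdef, Finset.mul_sum, ← Finset.sum_neg_distrib]
    refine Finset.sum_le_sum fun i _ => ?_
    have h1 := neg_le_of_abs_le (hB.abs_inner_curvVec_le hX (hB.norm_frame_le hD.frame i))
    have := mul_le_mul_of_nonneg_left h1 (hF' i).le
    nlinarith
  have hψz : -C ≤ fderiv ℝ (chartRhs ψ c) (y, chartFun c u y) (0, 1) := by
    have := neg_le_of_abs_le (hB.abs_rhs_le hI (X := 0) (o := 1) (t := 1) (by simp) (by simp))
    linarith
  have h2 := mul_le_mul_of_nonneg_left hQ ((by positivity : 0 ≤ w ^ 2 * E₀ / K).trans hτ0)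
  have h3 := mul_le_mul_of_nonneg_right hψz hw2.le
  have h1 := le_of_scalar_inequality hC1 hw1 hF₀ hF hE₀ hK hδ₀ (by positivity : (0 : ℝ) < n) hτ0
    (by linarith)
  have h2 : 0 ≤ K * (n * C ^ 3 + |R|) / E₀ := by positivity
  linarith

/-- Bounds by `C` at the point `y` for a subsolution-like function `v`; `k` measures its position
in the cones. -/
structure ComparisonBounds (g : Metric n M) (χ : Tensor2 n M) (Γ : Set (Vec n)) (f : Vec n → ℝ)
    (ψ : M → ℝ → ℝ) (v : M → ℝ) (I : Set ℝ) (c : M) (C k : ℝ) (y : Vec n) : Prop where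
  grad : ‖fderiv ℝ (chartFun c v) y‖ ≤ C
  hess : ∀ a, |covHess (chartConn g.inner c) (chartFun c v) y a a + chartForm χ c y a a| ≤
    C * ‖a‖ ^ 2
  mem : ∀ e, IsFrame (chartForm g.inner c y) e → ∀ z ∈ I,
    (WithLp.toLp 2 fun i => covHess (chartConn g.inner c) (chartFun c v) y (e i) (e i) +
      chartForm χ c y (e i) (e i)) ∈ pushedSet Γ f (ψ ((extChartAt (𝓡∂ n) c).symm y) z) k

/-- The gradient bound at a maximum point in the presence of a comparison function `v`. -/
theorem MaxData.gradNorm_le_of_comparison {v : M → ℝ}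
    (hD : MaxData g χ Γ f ψ u s K c y e lam)
    (hs : ∀ x, s x = v x - u x) (hv : ContMDiff (𝓡∂ n) 𝓘(ℝ, ℝ) 2 v)
    (hf : StructureConditions Γ f) (hu : ContMDiff (𝓡∂ n) 𝓘(ℝ, ℝ) 3 u) (hy : y ∈ chartInterior c)
    (hB : ChartBounds g χ ψ I c C y) (hI : chartFun c u y ∈ I) {w E₀ c₀ T k : ℝ}
    (hV : ComparisonBounds g χ Γ f ψ v I c C k y)
    (hw : gradNorm g u ((extChartAt (𝓡∂ n) c).symm y) = w) (hw1 : 1 ≤ w)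
    (hζ : 0 < K - Real.exp (chartFun c s y)) (hE₀ : 0 < E₀)
    (hE : E₀ ≤ Real.exp (chartFun c s y)) (hc₀ : 0 < c₀) (hT : 0 < T) (hk : 0 < k)
    (hsum : c₀ ≤ ∑ i, fpart f i lam * (T - lam i))
    (hψz : 0 ≤ fderiv ℝ (chartRhs ψ c) (y, chartFun c u y) (0, 1))
    (hcurv : NonnegSectionalCurvature (n := n) (M := M) g.inner) :
    w ≤ 3 * C ^ 5 * K / (E₀ * (min (c₀ / (1 + 2 * k * (T + C ^ 3))) (1 / (2 * k)) / 2)) +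
      3 * C ^ 5 * K / (E₀ * min c₀ 1) + 2 * (n * C ^ 4 + 2 * k ^ 2 * (T + C ^ 3 + 1)) := by
  have hC1 := hB.one_le
  have hC0 : 0 ≤ C := by linarith
  have hUd : ContDiffAt ℝ 2 (chartFun c u) y :=
    (contDiffAt_of_contDiffOn_target hy (contDiffOn_chartFun (m := 3) hu c)).of_le (by norm_num)
  have hVd : ContDiffAt ℝ 2 (chartFun c v) y :=
    contDiffAt_of_contDiffOn_target hy (contDiffOn_chartFun (m := 2) hv c)
  have hsc := hD.scalar hf hu hy hB hI hw
  have hXX : chartForm g.inner c y (chartGrad g.inner c u y) (chartGrad g.inner c u y) =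
      w ^ 2 := by
    rw [chartForm_chartGrad_interior hy, ← gradNorm_sq_interior hu hy, hw]
  have hchart : (chartFun c s : Vec n → ℝ) = fun z => chartFun c v z - chartFun c u z :=
    funext fun z => hs _
  have hds : ∀ a, fderiv ℝ (chartFun c s) y a = fderiv ℝ (chartFun c v) y a -
      chartForm g.inner c y (chartGrad g.inner c u y) a := by
    intro a
    rw [chartForm_chartGrad_interior hy, hchart, fderiv_fun_sub (hVd.differentiableAt (by simp))
      (hUd.differentiableAt (by simp))]
    rfl
  have hdds : ∀ a b, covHess (chartConn g.inner c) (chartFun c s) y a b =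
      covHess (chartConn g.inner c) (chartFun c v) y a b -
      covHess (chartConn g.inner c) (chartFun c u) y a b := by
    intro a b
    rw [hchart]
    exact covHess_sub hVd hUd a b
  set X := chartGrad g.inner c u y
  set E := Real.exp (chartFun c s y)
  set x : Fin n → ℝ := fun i => chartForm g.inner c y X (e i) with hxdef
  set F' := fun i => fpart f i lam with hF'def
  have hF' : ∀ i, 0 < F' i := fun i => hf.fpart_pos i lam hD.mem
  set F := ∑ i, fpart f i lam with hFdef
  have hF : 0 ≤ F := Finset.sum_nonneg fun i _ => (hF' i).le
  have hEp : 0 < E := Real.exp_pos _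
  have hK : 0 < K := by linarith
  have hsq : ∑ i, x i ^ 2 = w ^ 2 := by
    rw [← hXX, hD.frame.apply_eq_sum X X]
    exact Finset.sum_congr rfl fun i _ => sq _
  have he := fun i => hB.norm_frame_le hD.frame i
  set d : Vec n := WithLp.toLp 2 fun i => covHess (chartConn g.inner c) (chartFun c v) y
    (e i) (e i) + chartForm χ c y (e i) (e i) with hd
  have hd1 : ∀ i, |d i| ≤ C ^ 3 := fun i => (hV.hess (e i)).trans (by
    calc C * ‖e i‖ ^ 2 ≤ C * C ^ 2 := by
          have := he i
          gcongr
      _ = C ^ 3 := by ring)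
  set S := ∑ i, F' i * (d i - lam i) with hS
  -- Replacing `T` by `d_i` in `hsum` costs at most `T + C³` per unit of `F`.
  have hS1 : c₀ - F * (T + C ^ 3) ≤ S := by
    have h1 : ∑ i, F' i * (T - lam i) - ∑ i, F' i * (T + C ^ 3) ≤ S := by
      rw [← Finset.sum_sub_distrib]
      refine Finset.sum_le_sum fun i _ => ?_
      have := mul_le_mul_of_nonneg_left (neg_le_of_abs_le (hd1 i)) (hF' i).le
      linarith
    rw [← Finset.sum_mul] at h1
    linarith
  have hS2 : ∀ j, 0 < S - 1 / k * F + k * F' j := fun j =>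
    hf.sum_fpart_pos_of_mem_pushedSet (hV.mem e hD.frame _ hI) hD.mem hD.eq.le j
  set Q := ∑ i, F' i * (covHess (chartConn g.inner c) (chartFun c s) y (e i) (e i) +
    fderiv ℝ (chartFun c s) y (e i) ^ 2) with hQ
  -- The tensor `χ` cancels in `∇²v - ∇²u`, leaving `d_i - λ_i`.
  have hQ1 : Q = S + ∑ i, F' i * (fderiv ℝ (chartFun c v) y (e i) - x i) ^ 2 := by
    rw [hQ, hS, ← Finset.sum_add_distrib]
    refine Finset.sum_congr rfl fun i _ => ?_
    have h2 := hD.diag i (e i)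
    rw [hD.frame i i, if_pos rfl] at h2
    have h3 : d i = covHess (chartConn g.inner c) (chartFun c v) y
      (e i) (e i) + chartForm χ c y (e i) (e i) := rfl
    rw [hds, hdds, ← mul_add, h3]
    congr 1
    linarith
  have hκ : 0 ≤ ∑ i, F' i *
      chartForm g.inner c y (curvVec (chartConn g.inner c) y X (e i)) X :=
    Finset.sum_nonneg fun i _ => mul_nonneg (hF' i).le (hcurv.inner_curvVec_nonneg g hy X (e i))
  -- The `ψ_z` and curvature terms have the good sign and are dropped, so `τ Q ≤ 3 C⁵ w (1 + F)`
  -- with `τ ≥ w² E₀ / K`. It remains to bound `Q` below by a multiple of `1 + F`.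
  have hmain : ∀ θ > 0, θ * (1 + F) ≤ Q → w ≤ 3 * C ^ 5 * K / (E₀ * θ) := by
    intro θ hθ hθQ
    rw [le_div_iff₀ (by positivity)]
    have h1 : w ^ 2 / (K - E) * E * Q ≤ 3 * C ^ 5 * w * (1 + F) := by
      have := mul_nonneg hψz (sq_nonneg w)
      linarith
    have h2 : w ^ 2 * E₀ / K ≤ w ^ 2 / (K - E) * E := by
      rw [div_mul_eq_mul_div]
      exact div_le_div₀ (by positivity) (by gcongr) hζ (by linarith)
    have h3 : w ^ 2 * E₀ / K * (θ * (1 + F)) ≤ 3 * C ^ 5 * w * (1 + F) :=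
      (mul_le_mul h2 hθQ (by positivity) ((by positivity : 0 ≤ w ^ 2 * E₀ / K).trans h2)).trans h1
    rw [div_mul_eq_mul_div, div_le_iff₀ hK] at h3
    refine le_of_mul_le_mul_left ?_ (by positivity : 0 < w * (1 + F))
    linarith
  have hp1 : 0 ≤ 3 * C ^ 5 * K / (E₀ * (min (c₀ / (1 + 2 * k * (T + C ^ 3))) (1 / (2 * k)) / 2)) :=
    div_nonneg (by positivity) (mul_nonneg hE₀.le
      (div_nonneg (le_min (by positivity) (by positivity)) two_pos.le))
  have hp2 : 0 ≤ 3 * C ^ 5 * K / (E₀ * min c₀ 1) :=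
    div_nonneg (by positivity) (mul_nonneg hE₀.le (le_min hc₀.le zero_le_one))
  have hp3 : 0 ≤ 2 * (n * C ^ 4 + 2 * k ^ 2 * (T + C ^ 3 + 1)) := by positivity
  -- At this threshold `k f_j ≤ F / (2k)`, half of the term `F / k` in `hS2`, so `S ≥ F / (2k)`.
  -- Combined with `hS1`, this also bounds `S` below by a positive constant, whatever the size of
  -- `F`.
  by_cases hA : ∃ j, F' j ≤ F / (2 * k ^ 2)
  · obtain ⟨j, hj⟩ := hA
    set θ := min (c₀ / (1 + 2 * k * (T + C ^ 3))) (1 / (2 * k)) / 2 with hθ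
    have hθ0 : 0 < θ := half_pos (lt_min (by positivity) (by positivity))
    have h1 : F / (2 * k) ≤ S := by
      have h2 := hS2 j
      have h3 := mul_le_mul_of_nonneg_left hj hk.le
      have h4 : k * (F / (2 * k ^ 2)) = F / (2 * k) := by field_simp
      have h5 : 1 / k * F = F / (2 * k) + F / (2 * k) := by field_simp; ring
      linarith
    have h2 : c₀ / (1 + 2 * k * (T + C ^ 3)) ≤ S := by
      rw [div_le_iff₀ (by positivity)]
      rw [div_le_iff₀ (by positivity)] at h1
      have := mul_le_mul_of_nonneg_right h1 (by positivity : 0 ≤ T + C ^ 3)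
      linarith
    have h3 : θ * (1 + F) ≤ Q := by
      have h4 : 0 ≤ ∑ i, F' i * (fderiv ℝ (chartFun c v) y (e i) - x i) ^ 2 :=
        Finset.sum_nonneg fun i _ => mul_nonneg (hF' i).le (sq_nonneg _)
      have h5 := min_le_left (c₀ / (1 + 2 * k * (T + C ^ 3))) (1 / (2 * k))
      have h6 := mul_le_mul_of_nonneg_right
        (min_le_right (c₀ / (1 + 2 * k * (T + C ^ 3))) (1 / (2 * k))) hF
      have h7 : 1 / (2 * k) * F = F / (2 * k) := by ring
      rw [hθ]
      linarith
    linarith [hmain θ hθ0 h3]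
  · push Not at hA
    by_cases hbig : w ^ 2 ≤ 2 * (n * C ^ 4 + 2 * k ^ 2 * (T + C ^ 3 + 1))
    · linarith [le_self_pow₀ hw1 two_ne_zero]
    push Not at hbig
    -- All `f_i` are now comparable to `F`. From `(p - x)² ≥ x² / 2 - p²` the squares sum to about
    -- `F w²`, which for large `w` covers the deficit `F (T + C³)` of `hS1` with `F` to spare.
    have h1 : ∀ i, x i ^ 2 / 2 - C ^ 4 ≤ (fderiv ℝ (chartFun c v) y (e i) - x i) ^ 2 := by
      intro i
      have h2 : |fderiv ℝ (chartFun c v) y (e i)| ≤ C ^ 2 := by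
        refine ((fderiv ℝ (chartFun c v) y).le_opNorm (e i)).trans ?_
        have := he i
        have := hV.grad
        rw [sq]
        gcongr
      have h3 := sq_le_sq' (neg_le_of_abs_le h2) (le_of_abs_le h2)
      nlinarith [sq_nonneg (x i - 2 * fderiv ℝ (chartFun c v) y (e i))]
    have h2 : F / (2 * k ^ 2) * (w ^ 2 / 2 - n * C ^ 4) ≤
        ∑ i, F' i * (fderiv ℝ (chartFun c v) y (e i) - x i) ^ 2 := by
      have h3 : F / (2 * k ^ 2) * ∑ i, (fderiv ℝ (chartFun c v) y (e i) - x i) ^ 2 ≤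
          ∑ i, F' i * (fderiv ℝ (chartFun c v) y (e i) - x i) ^ 2 := by
        rw [Finset.mul_sum]
        exact Finset.sum_le_sum fun i _ => mul_le_mul_of_nonneg_right (hA i).le (sq_nonneg _)
      have h4 := Finset.sum_le_sum fun i (_ : i ∈ Finset.univ) => h1 i
      rw [Finset.sum_sub_distrib, ← Finset.sum_div, hsq, Finset.sum_const, Finset.card_univ,
        Fintype.card_fin, nsmul_eq_mul] at h4
      exact (mul_le_mul_of_nonneg_left h4 (by positivity)).trans h3
    have h3 : F * (T + C ^ 3 + 1) ≤ F / (2 * k ^ 2) * (w ^ 2 / 2 - n * C ^ 4) := by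
      have h4 : 2 * k ^ 2 * (T + C ^ 3 + 1) ≤ w ^ 2 / 2 - n * C ^ 4 := by linarith
      have h5 := mul_le_mul_of_nonneg_left h4 (by positivity : 0 ≤ F / (2 * k ^ 2))
      refine le_trans (le_of_eq ?_) h5
      field_simp
    have h4 : min c₀ 1 * (1 + F) ≤ Q := by
      have h6 := mul_le_mul_of_nonneg_right (min_le_right c₀ 1) hF
      linarith [min_le_left c₀ 1]
    linarith [hmain _ (lt_min hc₀ one_pos) h4]

end Estimates

/-! ### The comparison function in arbitrary frames. -/

section Comparison

variable {n : ℕ}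

/-- Schur's theorem: the diagonal in an orthonormal frame is a doubly stochastic image of the
eigenvalues. It is needed because a frame diagonalizing `∇²u + χ` need not diagonalize `∇²v + χ`. -/
theorem diag_mem_of_isEigenvalues {C : Set (Vec n)} (hC : Convex ℝ C)
    (hperm : ∀ π : Equiv.Perm (Fin n), ∀ d ∈ C, permute π d ∈ C)
    {G U P : Matrix (Fin n) (Fin n) ℝ} {lam : Vec n} (h : IsEigenvalues G U lam) (hl : lam ∈ C)
    (hP : P.transpose * G * P = 1) :
    (WithLp.toLp 2 fun i => (P.transpose * U * P) i i) ∈ C := by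
  obtain ⟨P₀, hP₀, hU⟩ := h
  have hinv : P * (P.transpose * G) = 1 := mul_eq_one_comm.mp hP
  set Q := P.transpose * G * P₀ with hQ
  have hPQ : P * Q = P₀ := by
    rw [hQ, ← Matrix.mul_assoc, hinv, Matrix.one_mul]
  have hQQ : Q.transpose * Q = 1 := by
    calc Q.transpose * Q = Q.transpose * (P.transpose * G * P) * Q := by rw [hP, Matrix.mul_one]
      _ = (P * Q).transpose * G * (P * Q) := by
        simp only [Matrix.transpose_mul, Matrix.mul_assoc]
      _ = 1 := by rw [hPQ, hP₀]
  have hQU : Q.transpose * (P.transpose * U * P) * Q = Matrix.diagonal fun i => lam i := by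
    rw [← hU, ← hPQ]
    simp only [Matrix.transpose_mul, Matrix.mul_assoc]
  have := doublyStochastic_mulVec_mem hC hperm (sq_mem_doublyStochastic hQQ) hl
  simp only [diag_eq_of_orthogonal hQQ hQU]
  exact this

theorem continuous_pushed (k : ℝ) (j : Fin n) : Continuous (pushed k j) := by
  unfold pushed
  refine (PiLp.continuous_toLp 2 _).comp (continuous_pi fun i => ?_)
  fun_prop

/-- Membership in `pushedSet` is an open condition, jointly in the point and the level. -/
theorem StructureConditions.eventually_mem_pushedSet {Γ : Set (Vec n)} {f : Vec n → ℝ}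
    (hf : StructureConditions Γ f) {E : Type*} [TopologicalSpace E] {s : Set E} {p₀ : E}
    {d : E → Vec n} {σ : E → ℝ} (hd : ContinuousWithinAt d s p₀) (hσ : ContinuousWithinAt σ s p₀)
    {k : ℝ} (h : d p₀ ∈ pushedSet Γ f (σ p₀) k) :
    ∀ᶠ p in 𝓝[s] p₀, d p ∈ pushedSet Γ f (σ p) k := by
  refine Filter.eventually_all.2 fun j => ?_
  have h1 : ContinuousWithinAt (fun p => pushed k j (d p)) s p₀ :=
    (continuous_pushed k j).continuousAt.comp_continuousWithinAt hd
  have h2 : ContinuousWithinAt (fun p => f (pushed k j (d p))) s p₀ :=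
    ContinuousAt.comp_continuousWithinAt (f := fun p => pushed k j (d p))
      (hf.differentiableAt (h j).1).continuousAt h1
  filter_upwards [h1 (hf.isOpen.mem_nhds (h j).1), hσ.eventually_lt h2 (h j).2] with p hp1 hp2
  exact ⟨hp1, hp2⟩

theorem continuousOn_diag {B : Vec n → Vec n →L[ℝ] Vec n →L[ℝ] ℝ} {s : Set (Vec n)}
    (hB : ContinuousOn B s) (E : Type*) [TopologicalSpace E] (i j : Fin n) :
    ContinuousOn (fun p : Vec n × (Fin n → Vec n) × E => B p.1 (p.2.1 i) (p.2.1 j))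
      (s ×ˢ Set.univ) := by
  have h1 : ContinuousOn (fun p : Vec n × (Fin n → Vec n) × E => B p.1) (s ×ˢ Set.univ) :=
    hB.comp continuousOn_fst fun p hp => hp.1
  exact (h1.clm_apply (by fun_prop)).clm_apply (by fun_prop)

variable [NeZero n] {M : Type*} [TopologicalSpace M]
  [ChartedSpace (EuclideanHalfSpace n) M] [IsManifold (𝓡∂ n) ∞ M] {g : Metric n M}
  {χ : Tensor2 n M} {Γ : Set (Vec n)} {f : Vec n → ℝ} {ψ : M → ℝ → ℝ} {v : M → ℝ}

/-- The bilinear form `∇²v + χ` in the chart at `c`. -/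
def hessForm (g : Metric n M) (χ : Tensor2 n M) (c : M) (v : M → ℝ) (y : Vec n) :
    Vec n →L[ℝ] Vec n →L[ℝ] ℝ :=
  bilin fun i j => hessCoord g.inner c v y i j + tensorCoord χ c y i j

theorem hessForm_apply (hv : ContMDiff (𝓡∂ n) 𝓘(ℝ, ℝ) 2 v) {c : M} {y : Vec n}
    (hy : y ∈ chartInterior c) (a b : Vec n) : hessForm g χ c v y a b =
      covHess (chartConn g.inner c) (chartFun c v) y a b + chartForm χ c y a b := by
  have h := bilin_hessCoord g hy (contDiffAt_of_contDiffOn_target hy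
    (contDiffOn_chartFun (m := 2) hv c)) a b
  change _ = covHess (chartConn g.inner c) (chartFun c v) y a b at h
  rw [← h, hessForm, chartForm, bilin_apply, bilin_apply, bilin_apply]
  simp only [smul_add, Finset.sum_add_distrib]

theorem continuousOn_hessForm (g : Metric n M) (hχ : χ.IsSmooth)
    (hv : ContMDiff (𝓡∂ n) 𝓘(ℝ, ℝ) 2 v) (c : M) :
    ContinuousOn (hessForm g χ c v) (extChartAt (𝓡∂ n) c).target := by
  have hV := contDiffOn_chartFun (m := 2) hv c
  refine (contDiffOn_bilin (m := 0) fun i j => ?_).continuousOn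
  refine ContDiffOn.add ?_ ((contDiffOn_tensorCoord hχ c i j).of_le (by simp))
  have h1 : ∀ k, ContDiffOn ℝ 1 (pd k (chartFun c v)) (extChartAt (𝓡∂ n) c).target :=
    fun k => contDiffOn_pd hV (by norm_num) k
  exact (contDiffOn_pd (h1 j) (by simp) i).sub (ContDiffOn.sum fun k _ =>
    ((contDiffOn_christoffel g c k i j).of_le (by simp)).mul ((h1 k).of_le (by simp)))

/-- The parameter `k` is found at `c` alone. It persists nearby because membership in `pushedSet` is
open and the pairs of a frame and a value `z ∈ I` range over a compact set; the level `sup ψ` covers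
every `z` at `c`. -/
theorem exists_comparisonBounds (hf : StructureConditions Γ f) (hχ : χ.IsSmooth)
    (hψ : ContMDiff ((𝓡∂ n).prod 𝓘(ℝ, ℝ)) 𝓘(ℝ, ℝ) 1 (fun p : M × ℝ => ψ p.1 p.2))
    (hv : ContMDiff (𝓡∂ n) 𝓘(ℝ, ℝ) 2 v) {I : Set ℝ} (hI : IsCompact I)
    (hcone : ConeCondition g.inner χ Γ f (fun x => sSup (ψ x '' I)) v) (c : M) :
    ∃ k > 0, ∀ᶠ C : ℝ in Filter.atTop,
      ∀ᶠ y in 𝓝[(extChartAt (𝓡∂ n) c).target] (extChartAt (𝓡∂ n) c c),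
      y ∈ chartInterior c → ComparisonBounds g χ Γ f ψ v I c C k y := by
  set y₀ := extChartAt (𝓡∂ n) c c with hy₀
  have h0 : y₀ ∈ (extChartAt (𝓡∂ n) c).target := mem_extChartAt_target c
  have hG := (contDiffOn_chartForm g.isSmooth c).continuousOn
  have hH := continuousOn_hessForm g hχ hv c
  have hR := (contDiffOn_chartRhs hψ c).continuousOn
  obtain ⟨lam, hlam, hev⟩ := hcone c c (mem_chart_source _ c)
  obtain ⟨k, hk, hmem⟩ := hf.exists_mem_pushedSet hlam
  have hbdd : ∀ z ∈ I, ψ c z ≤ sSup (ψ c '' I) := by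
    intro z hz
    have hcont : Continuous (ψ c) := hψ.continuous.comp (Continuous.prodMk_right c)
    exact le_csSup (hI.image hcont).bddAbove (Set.mem_image_of_mem _ hz)
  have hsymm : (extChartAt (𝓡∂ n) c).symm y₀ = c := extChartAt_to_inv c
  refine ⟨k, hk, ?_⟩
  obtain ⟨R, hcoer, hRpos⟩ := ((eventually_coercive hG h0 fun a ha => chartForm_pos g h0 ha).and
    (Filter.eventually_ge_atTop 0)).exists
  have hopen : ∀ᶠ y in 𝓝 y₀, ∀ q ∈ (Set.univ.pi fun _ : Fin n => Metric.closedBall (0 : Vec n) R)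
      ×ˢ I, y ∈ (extChartAt (𝓡∂ n) c).target → IsFrame (chartForm g.inner c y) q.1 →
      (WithLp.toLp 2 fun i => hessForm g χ c v y (q.1 i) (q.1 i)) ∈
        pushedSet Γ f (chartRhs ψ c (y, q.2)) k := by
    refine ((isCompact_univ_pi fun _ => isCompact_closedBall 0 R).prod
      hI).eventually_forall_of_forall_eventually fun q hq => ?_
    have hp₀ : (y₀, q) ∈ (extChartAt (𝓡∂ n) c).target ×ˢ
      (Set.univ : Set ((Fin n → Vec n) × ℝ)) := ⟨h0, Set.mem_univ _⟩
    suffices h : ∀ᶠ p in 𝓝[(extChartAt (𝓡∂ n) c).target ×ˢ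
        (Set.univ : Set ((Fin n → Vec n) × ℝ))] (y₀, q), IsFrame (chartForm g.inner c p.1) p.2.1 →
        (WithLp.toLp 2 fun i => hessForm g χ c v p.1 (p.2.1 i) (p.2.1 i)) ∈
          pushedSet Γ f (chartRhs ψ c (p.1, p.2.2)) k by
      rw [eventually_nhdsWithin_iff] at h
      filter_upwards [h] with p hp hp1 hp2
      exact hp ⟨hp1, Set.mem_univ _⟩ hp2
    by_cases hfr : IsFrame (chartForm g.inner c y₀) q.1
    · have hd : ContinuousOn (fun p : Vec n × (Fin n → Vec n) × ℝ =>
          (WithLp.toLp 2 fun i => hessForm g χ c v p.1 (p.2.1 i) (p.2.1 i) : Vec n))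
          ((extChartAt (𝓡∂ n) c).target ×ˢ Set.univ) :=
        (PiLp.continuous_toLp 2 _).comp_continuousOn
          (continuousOn_pi.2 fun i => continuousOn_diag hH ℝ i i)
      have hσ : ContinuousOn (fun p : Vec n × (Fin n → Vec n) × ℝ => chartRhs ψ c (p.1, p.2.2))
          ((extChartAt (𝓡∂ n) c).target ×ˢ Set.univ) :=
        hR.comp (by fun_prop) fun p hp => ⟨hp.1, Set.mem_univ _⟩
      refine (hf.eventually_mem_pushedSet (hd _ hp₀) (hσ _ hp₀) (k := k) ?_).mono
        fun p hp _ => hp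
      have h1 : chartRhs ψ c (y₀, q.2) ≤ sSup (ψ c '' I) := by
        rw [chartRhs, hsymm]
        exact hbdd _ hq.2
      set P : Matrix (Fin n) (Fin n) ℝ := Matrix.of fun i j => q.1 j i
      have heP : q.1 = frameOf P := rfl
      have h2 := diag_mem_of_isEigenvalues (hf.convex_pushedSet _ k)
        (fun π d hd => hf.permute_mem_pushedSet π hd) hev hmem
        ((isFrame_frameOf _ _ _ P).1 hfr)
      have h3 : ∀ i, hessForm g χ c v y₀ (q.1 i) (q.1 i) = (P.transpose *
          (hessCoord g.inner c v y₀ + tensorCoord χ c y₀) * P) i i := fun i =>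
        bilin_eq_matrix (hessCoord g.inner c v y₀ + tensorCoord χ c y₀) P i i
      simp only [h3]
      exact fun j => superlevel_anti h1 (h2 j)
    -- Failing to be a frame is an open condition, so near such a tuple there is nothing to prove.
    · simp only [IsFrame, not_forall] at hfr
      obtain ⟨i, j, hij⟩ := hfr
      filter_upwards [((continuousOn_diag hG ℝ i j) _ hp₀).eventually_ne hij] with p hp hfr
      exact absurd (hfr i j) hp
  filter_upwards [eventually_norm_fderiv_le ((contDiffOn_chartFun (m := 2) hv c).of_le
    (by norm_num)), eventually_norm_le_of_continuousOn
    (F := Vec n →L[ℝ] Vec n →L[ℝ] ℝ) hH h0] with C h1 h2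
  filter_upwards [h1, h2, hcoer, hopen.filter_mono nhdsWithin_le_nhds,
    self_mem_nhdsWithin] with y h1 h2 h3 h4 hyt hy
  refine ⟨h1 hy, fun a => ?_, fun e he z hz => ?_⟩
  · rw [← hessForm_apply hv hy]
    refine ((hessForm g χ c v y).le_opNorm₂ a a).trans ?_
    rw [mul_assoc, ← sq]
    gcongr
  · have h5 := h4 (e, z) ⟨fun i _ => ?_, hz⟩ hyt he
    · simpa only [hessForm_apply hv hy, chartRhs] using h5
    · have h6 := h3 (e i)
      rw [he i i, if_pos rfl, mul_one] at h6
      simpa using le_of_sq_le_sq h6 hRpos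

end Comparison

/-! ### From local bounds at maximum points to the global bound. -/

section Global

variable {n : ℕ} [NeZero n] {M : Type*} [TopologicalSpace M]
  [ChartedSpace (EuclideanHalfSpace n) M] [IsManifold (𝓡∂ n) ∞ M] {g : Metric n M}
  {χ : Tensor2 n M} {Γ : Set (Vec n)} {f : Vec n → ℝ} {ψ : M → ℝ → ℝ} {u : M → ℝ}

theorem continuous_gradNorm_sq (hu : ContMDiff (𝓡∂ n) 𝓘(ℝ, ℝ) 3 u) :
    Continuous fun x => gradNorm g u x ^ 2 := by
  rw [continuous_iff_continuousAt]
  intro c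
  have h1 : ContinuousOn (fun y => fderivWithin ℝ (chartFun c u) (Set.range (𝓡∂ n)) y
      (chartGrad g.inner c u y)) (extChartAt (𝓡∂ n) c).target :=
    (contDiffOn_fderivWithin_range (k := 0) (contDiffOn_chartFun (m := 3) hu c)
      (by norm_num)).continuousOn.clm_apply (contDiffOn_chartGrad g hu c).continuousOn
  have h2 := h1.comp (continuousOn_extChartAt c) (extChartAt (𝓡∂ n) c).mapsTo
  refine (h2.continuousAt (extChartAt_source_mem_nhds c)).congr ?_
  filter_upwards [extChartAt_source_mem_nhds (I := 𝓡∂ n) c] with x hx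
  have h3 := gradNorm_sq g (hu.mdifferentiable (by norm_num))
    ((extChartAt (𝓡∂ n) c).map_source hx)
  rw [(extChartAt (𝓡∂ n) c).left_inv hx] at h3
  exact h3.symm

/-- A local bound at the interior maximum points of `|∇u| / (K - exp s)` gives the global bound. -/
theorem StructureConditions.exists_gradNorm_le [CompactSpace M] (hf : StructureConditions Γ f)
    (hχ : χ.IsSmooth)
    (hψ : ContMDiff ((𝓡∂ n).prod 𝓘(ℝ, ℝ)) 𝓘(ℝ, ℝ) 1 (fun p : M × ℝ => ψ p.1 p.2)) {I : Set ℝ}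
    {s : (M → ℝ) → M → ℝ}
    (hs : ∀ u, ContMDiff (𝓡∂ n) 𝓘(ℝ, ℝ) 3 u → ContMDiff (𝓡∂ n) 𝓘(ℝ, ℝ) 2 (s u)) {K : ℝ}
    (hK : ∀ u, (∀ x, u x ∈ I) → ∀ x, 1 ≤ K - Real.exp (s u x))
    (hloc : ∀ c : M, ∃ W : ℝ, ∀ᶠ y in 𝓝[(extChartAt (𝓡∂ n) c).target] (extChartAt (𝓡∂ n) c c),
      y ∈ chartInterior c → ∀ u, ContMDiff (𝓡∂ n) 𝓘(ℝ, ℝ) 3 u → (∀ x, u x ∈ I) →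
      1 ≤ gradNorm g u ((extChartAt (𝓡∂ n) c).symm y) →
      ∀ e lam, MaxData g χ Γ f ψ u (s u) K c y e lam →
        gradNorm g u ((extChartAt (𝓡∂ n) c).symm y) ≤ W) :
    ∃ C : ℝ, ∀ u : M → ℝ, ContMDiff (𝓡∂ n) 𝓘(ℝ, ℝ) 3 u → (∀ x, u x ∈ I) →
      IsAdmissibleSolution g.inner χ Γ f ψ u → ∀ B : ℝ, 0 ≤ B →
        (∀ y ∈ (𝓡∂ n).boundary M, gradNorm g u y ≤ B) → ∀ x, gradNorm g u x ≤ C * (1 + B) := by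
  have hloc' : ∃ W : ℝ, ∀ x ∈ (Set.univ : Set M), (𝓡∂ n).IsInteriorPoint x → ∀ u,
      ContMDiff (𝓡∂ n) 𝓘(ℝ, ℝ) 3 u →
      (∀ x, u x ∈ I) → IsAdmissibleSolution g.inner χ Γ f ψ u →
      (∀ x', gradNorm g u x' ^ 2 ≤ gradNorm g u x ^ 2 /
        (K - Real.exp (s u x)) ^ 2 * (K - Real.exp (s u x')) ^ 2) → gradNorm g u x ≤ W := by
    refine isCompact_univ.induction_on
      (p := fun S => ∃ W : ℝ, ∀ x ∈ S, (𝓡∂ n).IsInteriorPoint x → ∀ u,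
      ContMDiff (𝓡∂ n) 𝓘(ℝ, ℝ) 3 u →
      (∀ x, u x ∈ I) → IsAdmissibleSolution g.inner χ Γ f ψ u →
      (∀ x', gradNorm g u x' ^ 2 ≤ gradNorm g u x ^ 2 /
        (K - Real.exp (s u x)) ^ 2 * (K - Real.exp (s u x')) ^ 2) → gradNorm g u x ≤ W)
      ⟨0, by simp⟩ (fun S S' hS => ?_) (fun S S' => ?_) fun c _ => ?_
    · rintro ⟨W, hW⟩
      exact ⟨W, fun x hx => hW x (hS hx)⟩
    · rintro ⟨W, hW⟩ ⟨W', hW'⟩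
      refine ⟨max W W', fun x hx hi u h1 h2 h3 h4 => ?_⟩
      rcases hx with hx | hx
      · exact (hW x hx hi u h1 h2 h3 h4).trans (le_max_left _ _)
      · exact (hW' x hx hi u h1 h2 h3 h4).trans (le_max_right _ _)
    · obtain ⟨W, hW⟩ := hloc c
      rw [nhdsWithin_extChartAt_target_eq, ← map_extChartAt_nhds, Filter.eventually_map] at hW
      have hW' := hW.and (extChartAt_source_mem_nhds (I := 𝓡∂ n) c)
      rw [nhdsWithin_univ]
      -- The local estimate presupposes `|∇u| ≥ 1`; smaller gradients are covered by the `1`.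
      refine ⟨_, hW', max W 1, ?_⟩
      rintro x ⟨hx, hxs⟩ hi u hu hI hadm hmax
      have hleft := (extChartAt (𝓡∂ n) c).left_inv hxs
      have hyt := (extChartAt (𝓡∂ n) c).map_source hxs
      have hy : extChartAt (𝓡∂ n) c x ∈ chartInterior c := by
        rwa [mem_chartInterior_iff hyt, hleft]
      by_cases h1 : gradNorm g u x ≤ 1
      · exact h1.trans (le_max_right _ _)
      push Not at h1
      have hx' := hx hy u hu hI
      obtain ⟨e, lam, hD⟩ := hf.exists_maxData (g := g) hχ hu (hs u hu)
        (fun x => zero_lt_one.trans_le (hK u hI x)) hψ hadm hy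
        (by rw [hleft]; linarith) (by
          rw [chartFun, hleft]
          exact hmax)
      rw [hleft] at hx'
      exact (hx' h1.le e lam hD).trans (le_max_left _ _)
  obtain ⟨W, hW⟩ := hloc'
  -- Passing from the maximum point `x₀` to `x` costs the factor `ζ x / ζ x₀ ≤ K`. At `x₀` the
  -- gradient is at most `W` in the interior and at most `B` on the boundary.
  refine ⟨|K| * (|W| + 1), fun u hu hI hadm B hB hbd x => ?_⟩
  have hζ := hK u hI
  have hζ0 : ∀ x, 0 < K - Real.exp (s u x) := fun x => zero_lt_one.trans_le (hζ x)
  have hζK : ∀ x, K - Real.exp (s u x) ≤ K := fun x => by linarith [Real.exp_pos (s u x)]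
  have hK0 : 0 < K := (hζ0 x).trans_le (hζK x)
  have hcont : Continuous fun x => gradNorm g u x ^ 2 / (K - Real.exp (s u x)) ^ 2 :=
    (continuous_gradNorm_sq hu).div ((continuous_const.sub
      (Real.continuous_exp.comp (hs u hu).continuous)).pow 2) fun x => (pow_pos (hζ0 x) 2).ne'
  obtain ⟨x₀, -, hx₀⟩ := isCompact_univ.exists_isMaxOn ⟨x, Set.mem_univ x⟩ hcont.continuousOn
  have hmax : ∀ x', gradNorm g u x' ^ 2 ≤ gradNorm g u x₀ ^ 2 /
      (K - Real.exp (s u x₀)) ^ 2 * (K - Real.exp (s u x')) ^ 2 := fun x' => by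
    rw [← div_le_iff₀ (pow_pos (hζ0 x') 2)]
    exact hx₀ (Set.mem_univ x')
  have h1 : gradNorm g u x ≤ gradNorm g u x₀ * K := by
    refine le_of_sq_le_sq ((hmax x).trans ?_) (mul_nonneg (gradNorm_nonneg _) hK0.le)
    rw [mul_pow]
    gcongr
    · exact div_le_self (sq_nonneg _) (one_le_pow₀ (hζ x₀))
    · exact (hζ0 x).le
    · exact hζK x
  have h2 : gradNorm g u x₀ ≤ (|W| + 1) * (1 + B) := by
    rcases (𝓡∂ n).isInteriorPoint_or_isBoundaryPoint x₀ with hi | hb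
    · have h3 := (hW x₀ (Set.mem_univ _) hi u hu hI hadm hmax).trans (le_abs_self W)
      nlinarith [abs_nonneg W, mul_nonneg (abs_nonneg W) hB]
    · have h3 := hbd x₀ hb
      nlinarith [abs_nonneg W, mul_nonneg (abs_nonneg W) hB]
  calc gradNorm g u x ≤ gradNorm g u x₀ * K := h1
    _ ≤ (|W| + 1) * (1 + B) * K := by gcongr
    _ = |K| * (|W| + 1) * (1 + B) := by rw [abs_of_pos hK0]; ring

theorem fderiv_chartRhs_snd
    (hψ : ContMDiff ((𝓡∂ n).prod 𝓘(ℝ, ℝ)) 𝓘(ℝ, ℝ) 1 (fun p : M × ℝ => ψ p.1 p.2)) {c : M}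
    {y : Vec n} (hy : y ∈ chartInterior c) (z : ℝ) :
    fderiv ℝ (chartRhs ψ c) (y, z) (0, 1) = deriv (ψ ((extChartAt (𝓡∂ n) c).symm y)) z := by
  have h1 : DifferentiableAt ℝ (chartRhs ψ c) (y, z) :=
    ((contDiffOn_chartRhs hψ c).contDiffAt (prod_mem_nhds (target_mem_nhds hy.1 hy.2)
      Filter.univ_mem)).differentiableAt (by simp)
  have h2 : HasDerivAt (fun t : ℝ => (y, t)) ((0 : Vec n), (1 : ℝ)) z :=
    (hasDerivAt_const z y).prodMk (hasDerivAt_id z)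
  exact (h1.hasFDerivAt.comp_hasDerivAt z h2).deriv.symm

end Global

end HessianEq

end


/-! ### The three cases. -/

theorem mainTheorem10 {n : ℕ} [NeZero n] (hn : 2 ≤ n)
    {M : Type*} [TopologicalSpace M] [T2Space M] [CompactSpace M]
    [ChartedSpace (EuclideanHalfSpace n) M] [IsManifold (𝓡∂ n) ∞ M]
    -- the Riemannian metric and the smooth symmetric tensor `χ`
    (g : HessianEq.Metric n M) (χ : HessianEq.Tensor2 n M)
    (hχ : HessianEq.Tensor2.IsSmooth χ) (hχ_symm : ∀ x v w, χ x v w = χ x w v)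
    -- the cone and the function
    (Γ : Set (HessianEq.Vec n)) (f : HessianEq.Vec n → ℝ)
    (hf : HessianEq.StructureConditions Γ f)
    -- the right-hand side `ψ(x, z)`, a `C¹` function on `M × ℝ`
    (ψ : M → ℝ → ℝ)
    (hψ : ContMDiff ((𝓡∂ n).prod 𝓘(ℝ, ℝ)) 𝓘(ℝ, ℝ) 1 (fun p : M × ℝ => ψ p.1 p.2))
    -- bounds `a ≤ u ≤ b`; for the values of `ψ` on `M × [a, b]` the constant `inf ψ - sup_{∂Γ} f`
    -- is positive and the sets `Γ^σ` are nonempty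
    (a b : ℝ)
    (hδ : HessianEq.supBdry Γ f < ⨅ (x : M) (z ∈ Set.Icc a b), (ψ x z : EReal))
    (hne : ∀ (x : M), ∀ z ∈ Set.Icc a b, (HessianEq.superlevel Γ f (ψ x z)).Nonempty)
    (hcases :
      -- (i)
      Γ = HessianEq.posCone n ∨
      -- (ii')
      ((∃ v : M → ℝ, ContMDiff (𝓡∂ n) 𝓘(ℝ, ℝ) 2 v ∧
          HessianEq.ConeCondition g.inner χ Γ f (fun x => sSup (ψ x '' Set.Icc a b)) v) ∧
        (∀ (x : M), ∀ z ∈ Set.Icc a b, 0 ≤ deriv (ψ x) z) ∧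
        HessianEq.NonnegSectionalCurvature (n := n) (M := M) g.inner) ∨
      -- (iii')
      ((∀ lam ∈ Γ, 0 ≤ ∑ i, HessianEq.fpart f i lam * lam i) ∧
        (∀ σ₁ σ₂ : ℝ, HessianEq.supBdry Γ f < (σ₁ : EReal) →
          (HessianEq.superlevel Γ f σ₂).Nonempty → ∃ δ₀ > 0, ∃ R : ℝ,
          ∀ σ ∈ Set.Icc σ₁ σ₂, ∀ lam ∈ HessianEq.levelSurface Γ f σ, R ≤ ‖lam‖ →
            ∀ j, lam j < 0 →
              δ₀ * ∑ i, HessianEq.fpart f i lam ≤ HessianEq.fpart f j lam))) :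
    -- one constant `C` for all admissible solutions `u ∈ C³` with `a ≤ u ≤ b`
    ∃ C : ℝ, ∀ u : M → ℝ, ContMDiff (𝓡∂ n) 𝓘(ℝ, ℝ) 3 u →
      (∀ x, u x ∈ Set.Icc a b) →
      HessianEq.IsAdmissibleSolution g.inner χ Γ f ψ u →
      -- `max_M |∇u| ≤ C (1 + max_{∂M} |∇u|)`, where `B` is any bound of `|∇u|` on `∂M`
      ∀ B : ℝ, 0 ≤ B →
        (∀ y ∈ (𝓡∂ n).boundary M, HessianEq.gradNorm g u y ≤ B) →
        ∀ x, HessianEq.gradNorm g u x ≤ C * (1 + B) := by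
  rcases isEmpty_or_nonempty M with hM | hM
  · exact ⟨0, fun u _ _ _ B _ _ x => hM.elim x⟩
  by_cases hab : a ≤ b
  swap
  · exact ⟨0, fun u _ hu _ B _ _ x => absurd ((hu x).1.trans (hu x).2) hab⟩
  have hψc : Continuous fun p : M × ℝ => ψ p.1 p.2 := hψ.continuous
  have hI : IsCompact (Set.Icc a b) := isCompact_Icc
  -- At the largest value of `ψ` a single point `T (1, …, 1)` lies above the level of every solution
  -- at every `x`. Concavity then gives the uniform constant `c₀` in `hsumT`.
  obtain ⟨⟨x₁, z₁⟩, hp₁, hmax⟩ := (isCompact_univ.prod hI).exists_isMaxOn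
    ⟨(hM.some, a), Set.mem_univ _, le_rfl, hab⟩ hψc.continuousOn
  have hσ₂ : ∀ x, ∀ z ∈ Set.Icc a b, ψ x z ≤ ψ x₁ z₁ := fun x z hz =>
    hmax (⟨Set.mem_univ x, hz⟩ : (x, z) ∈ Set.univ ×ˢ Set.Icc a b)
  have hσne := hne x₁ z₁ hp₁.2
  obtain ⟨T, hT, hTΓ, hTf⟩ := hf.exists_const_mem_superlevel hσne
  set c₀ := f (WithLp.toLp 2 fun _ => T) - ψ x₁ z₁ with hc₀
  have hc₀pos : 0 < c₀ := sub_pos.2 hTf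
  have hsumT : ∀ lam ∈ Γ, f lam ≤ ψ x₁ z₁ →
      c₀ ≤ ∑ i, HessianEq.fpart f i lam * (T - lam i) := by
    intro lam hl hle
    have h := hf.le_add_sum_fpart hl hTΓ
    simp only at h
    linarith
  have h12 : (2 : WithTop ℕ∞) ≤ 3 := by norm_num
  have hKu : ∀ u : M → ℝ, (∀ x, u x ∈ Set.Icc a b) → ∀ x, 1 ≤ 1 + Real.exp b - Real.exp (u x) :=
    fun u hu x => by linarith [Real.exp_le_exp.2 (hu x).2]
  rcases hcases with hΓ | ⟨⟨v, hv, hcone⟩, hψz, hcurv⟩ | ⟨hsum, hδ₀⟩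
  · refine hf.exists_gradNorm_le (s := id) hχ hψ (fun u hu => hu.of_le h12) hKu fun c => ?_
    obtain ⟨C, hC⟩ := (HessianEq.exists_chartBounds g hχ hψ hI c).exists
    refine ⟨C ^ 3 * (1 + Real.exp b) / Real.exp a, ?_⟩
    filter_upwards [hC] with y hB hy u hu hIu hw1 e lam hD
    have hζ := hKu u hIu ((extChartAt (𝓡∂ n) c).symm y)
    refine hD.gradNorm_le_of_pos (fun i => ?_) hu hy (hB hy) rfl hw1
      (by unfold HessianEq.chartFun; linarith) (Real.exp_pos a) (Real.exp_le_exp.2 (hIu _).1)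
    have := hD.mem
    rw [hΓ] at this
    exact this i
  · obtain ⟨xm, -, hxm⟩ := isCompact_univ.exists_isMinOn ⟨hM.some, Set.mem_univ _⟩
      hv.continuous.continuousOn
    obtain ⟨xM, -, hxM⟩ := isCompact_univ.exists_isMaxOn ⟨hM.some, Set.mem_univ _⟩
      hv.continuous.continuousOn
    -- Since `v - u ≤ max v - a`, this value of `K` gives `ζ ≥ 1`; the lower bound `exp (min v - b)`
    -- serves as `E₀`.
    have hKv : ∀ u : M → ℝ, (∀ x, u x ∈ Set.Icc a b) → ∀ x,
        1 ≤ 1 + Real.exp (v xM - a) - Real.exp (v x - u x) := fun u hu x => by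
      have h1 : v x ≤ v xM := hxM (Set.mem_univ x)
      have := Real.exp_le_exp.2 (sub_le_sub h1 (hu x).1)
      linarith
    refine hf.exists_gradNorm_le (s := fun u x => v x - u x) hχ hψ
      (fun u hu => hv.sub (hu.of_le h12)) hKv fun c => ?_
    obtain ⟨k, hk, hCk⟩ := HessianEq.exists_comparisonBounds hf hχ hψ hv
      hI hcone c
    obtain ⟨C, hC, hV⟩ := ((HessianEq.exists_chartBounds g hχ hψ
      hI c).and hCk).exists
    refine ⟨3 * C ^ 5 * (1 + Real.exp (v xM - a)) / (Real.exp (v xm - b) *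
      (min (c₀ / (1 + 2 * k * (T + C ^ 3))) (1 / (2 * k)) / 2)) +
      3 * C ^ 5 * (1 + Real.exp (v xM - a)) / (Real.exp (v xm - b) * min c₀ 1) +
      2 * (n * C ^ 4 + 2 * k ^ 2 * (T + C ^ 3 + 1)), ?_⟩
    filter_upwards [hC, hV] with y hB hV hy u hu hIu hw1 e lam hD
    have hζ := hKv u hIu ((extChartAt (𝓡∂ n) c).symm y)
    have hvm : v xm ≤ v ((extChartAt (𝓡∂ n) c).symm y) := hxm (Set.mem_univ _)
    refine hD.gradNorm_le_of_comparison (E₀ := Real.exp (v xm - b)) (fun x => rfl) hv hf hu hy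
      (hB hy) (hIu _) (hV hy) rfl hw1 (by unfold HessianEq.chartFun; linarith) (Real.exp_pos _)
      (Real.exp_le_exp.2 (sub_le_sub hvm (hIu _).2)) hc₀pos hT hk
      (hsumT lam hD.mem (hD.eq.le.trans (hσ₂ _ _ (hIu _)))) ?_ hcurv
    rw [HessianEq.fderiv_chartRhs_snd hψ hy]
    exact hψz _ _ (hIu _)
  -- The hypothesis of case (iii') needs real levels: `σ₁` separates `sup_{∂Γ} f` from `inf ψ`, and
  -- `max ψ` is the upper level.
  · obtain ⟨σ₁, hσ₁, hσ₁'⟩ := EReal.lt_iff_exists_real_btwn.1 hδ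
    obtain ⟨δ₀, hδ₀pos, R, hR⟩ := hδ₀ σ₁ (ψ x₁ z₁) hσ₁ hσne
    have hσle : ∀ x, ∀ z ∈ Set.Icc a b, σ₁ ≤ ψ x z := fun x z hz =>
      EReal.coe_le_coe_iff.1 (hσ₁'.le.trans ((iInf_le _ x).trans (iInf₂_le z hz)))
    refine hf.exists_gradNorm_le (s := id) hχ hψ (fun u hu => hu.of_le h12) hKu fun c => ?_
    obtain ⟨C, hC⟩ := (HessianEq.exists_chartBounds g hχ hψ hI c).exists
    refine ⟨(1 + Real.exp b) * (n * C ^ 3 + |R|) / Real.exp a + n * (C ^ 3 + 8 * C ^ 7 *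
      (1 / (c₀ / T) + 1) * (1 + Real.exp b) / Real.exp a) / δ₀, ?_⟩
    filter_upwards [hC] with y hB hy u hu hIu hw1 e lam hD
    have hζ := hKu u hIu ((extChartAt (𝓡∂ n) c).symm y)
    have hle := hD.eq.le.trans (hσ₂ _ _ (hIu _))
    -- Dropping `∑ f_i λ_i ≥ 0` from `hsumT` leaves `c₀ ≤ T ∑ f_i`.
    have hF : c₀ / T ≤ ∑ i, HessianEq.fpart f i lam := by
      rw [div_le_iff₀ hT, Finset.sum_mul]
      have h1 := hsumT lam hD.mem hle
      have h2 := hsum lam hD.mem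
      simp only [mul_sub, Finset.sum_sub_distrib] at h1
      linarith
    exact hD.gradNorm_le_of_fpart_ge (E₀ := Real.exp a) hf hu hy (hB hy) (hIu _) rfl hw1
      (by unfold HessianEq.chartFun; linarith) (Real.exp_pos a) (Real.exp_le_exp.2 (hIu _).1)
      hδ₀pos (div_pos hc₀pos hT) hF (hsum lam hD.mem)
      fun hl j hj => hR (f lam) ⟨(hσle _ _ (hIu _)).trans_eq hD.eq.symm, hle⟩ lam ⟨hD.mem, rfl⟩
        hl j hj
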